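/- Setting. Let $n,m\ge 0$. Consider a junction with incoming roads $h=1,\dots,n$ on $\Omega_h=(-\infty,0)$ and outgoing roads $h=n+1,\dots,n+m$ on $\Omega_h=(0,\infty)$. For every $h$ let $K_h=[a_h,b_h]$ with $a_h<b_h$ and $0\in K_h$, and let $f_h\colon K_h\to[0,\infty)$ be Lipschitz and concave with $f_h(a_h)=f_h(b_h)=0$; assume $\sum_{i\le n}f_i(0)=\sum_{j>n}f_j(0)$. Let $f_h'$ be any monotone pointwise representative of the derivative of $f_h$ on $K_h$. Let $\hat\eta_h\colon\mathbb R\to\mathbb R$ be convex, with the convention $\hat\eta_h'(a_h-)=-\infty$, $\hat\eta_h'(b_h+)=+\infty$, and for every $M\in\mathbb R$ let $\Pi_h^M\colon[0,1]\to\{\rho\in K_h: \hat\eta_h'(\rho-)\le M\le\hat\eta_h'(\rho+)\}$ be increasing (not necessarily strictly) and surjective. Let $\chi(\rho,\xi)=1$ if $0<\xi<\rho$, $-1$ if $\rho<\xi<0$, and $0$ otherwise. Let $D_\xi=\{g\in\mathbb R:\operatorname{sgn}(\xi)g=|g|\le 1\}$, and let $L^1(A\times B,D_\xi)$ be the set of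 $g\in L^1(A\times B)$ with $g(y,\xi)\in D_\xi$ for a.e. $(y,\xi)$. With interior and closure relative to $K_h$, put $\Gamma_h^{\rm in}=\operatorname{Int}\{f_h'\ge0\}$, $\Gamma_h^{\rm out}=\overline{\{f_h'<0\}}$ for $h\le n$, and $\Gamma_h^{\rm in}=\operatorname{Int}\{f_h'\le0\}$, $\Gamma_h^{\rm out}=\overline{\{f_h'>0\}}$ for $h>n$. The coupling function $\Psi$ maps data $g=(g_h)$, $g_h\in L^1(\Gamma_h^{\rm in},D_\xi)$, to $\Psi_h[g](\xi)=\chi(\hat\rho_h,\xi)$, $\xi\in\Gamma_h^{\rm out}$, where $\hat\rho_h=\Pi_h^M(z)$ for some $M\in\mathbb R$, $z\in[0,1]$ common to all roads such that $$\sum_{i\le n}\Big(\int_{\Gamma_i^{\rm out}}f_i'\,\Psi_i[g]\,d\xi+\int_{\Gamma_i^{\rm in}}f_i'\,g_i\,d\xi\Big)=\sum_{j>n}\Big(\int_{\Gamma_j^{\rm out}}f_j'\,\Psi_j[g]\,d\xi+\int_{\Gamma_j^{\rm in}}f_j'\,g_j\,d\xi\Big).$$ Theorem. Let $\varepsilon>0$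 and $g_{0,h}\in L^1(\Omega_h\times K_h,D_\xi)$ for all $h$. There is a unique distributional solution $g_h\in C([0,\infty),L^1(\Omega_h\times K_h,D_\xi))$ of $$\partial_tg_h+f_h'(\xi)\,\partial_xg_h=\frac{\chi(\rho_{g_h},\xi)-g_h}{\varepsilon}\quad(t>0,\ x\in\Omega_h,\ \xi\in K_h),\qquad \rho_{g_h}(t,x)=\int_{K_h}g_h(t,x,\xi)\,d\xi,$$ with $g_h(0,\cdot,\cdot)=g_{0,h}$ and, for a.e. $t>0$ and a.e. $\xi\in\Gamma_h^{\rm out}$, $g_h(t,0,\xi)=\Psi_h[g(t,0,\Gamma^{\rm in})](\xi)$. Here $g_h(t,0,\xi)\in D_\xi$ is a measurable boundary trace, defined by the requirement that the weak formulation, with boundary term $\int\!\!\int f_h'\,g_h(t,0,\xi)\,\varphi(t,0,\xi)\,d\xi\,dt$ (sign $-$ for $h\le n$, $+$ for $h>n$, when all terms are collected on one side together with $\iiint g_h(\partial_t\varphi+f_h'\partial_x\varphi)+\frac{\chi(\rho_{g_h},\xi)-g_h}{\varepsilon}\varphi$), holds for all smooth $\varphi$ with compact support in $(0,\infty)\times\mathbb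 R\times\mathbb R$. Moreover $\rho_{g_h}(t,x)\in K_h$ for every $t\ge 0$ and a.e. $x\in\Omega_h$, and: (i) $\sum_h\iint_{\Omega_h\times K_h}g_h(T,x,\xi)\,dx\,d\xi=\sum_h\iint_{\Omega_h\times K_h}g_{0,h}\,dx\,d\xi$ for every $T\ge0$. (ii) For solutions $g^1,g^2$ (same $\varepsilon$) with initial data $g_0^1,g_0^2$, and every $t\ge0$, $$\sum_h\|\rho_{g_h^1}(t)-\rho_{g_h^2}(t)\|_{L^1(\Omega_h)}\le\sum_h\|g_h^1(t)-g_h^2(t)\|_{L^1(\Omega_h\times K_h)}\le\sum_h\|g_{0,h}^1-g_{0,h}^2\|_{L^1(\Omega_h\times K_h)}.$$ (iii) Fix the initial data $g_0$ and let $g^\varepsilon$ be the solution for $\varepsilon>0$. There are non-negative bounded measurable functions $m_h^\varepsilon(t,x,\xi)$ with $\frac{\chi(\rho_{g_h^\varepsilon},\xi)-g_h^\varepsilon}{\varepsilon}=\partial_\xi m_h^\varepsilon$ in the sense of distributions on $(0,\infty)\times\Omega_h\times(a_h,b_h)$ and such that for every $T>0$ there are functions $\mu_h\in L^\infty(K_h)$,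 independent of $\varepsilon$, with $$\iint_{(0,T)\times\Omega_h}m_h^\varepsilon(t,x,\xi)\,dt\,dx\le\mu_h(\xi)\qquad\text{for all }\varepsilon>0\text{ and a.e. }\xi\in K_h.$$ -/

import Mathlib

open MeasureTheory Set Filter Topology
open scoped NNReal ENNReal

noncomputable section

/-- The data of a single junction with `n` incoming roads `Sum.inl i` and `m` outgoing roads
`Sum.inr j`: the state intervals `[a h, b h]`, the fluxes `f h`, a pointwise representative `df h`
of the derivative of `f h`, the entropies `η h`, and the priority functions `prio h M z`. -/
structure Junction (n m : ℕ) where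
  a : Fin n ⊕ Fin m → ℝ
  b : Fin n ⊕ Fin m → ℝ
  f : Fin n ⊕ Fin m → ℝ → ℝ
  df : Fin n ⊕ Fin m → ℝ → ℝ
  η : Fin n ⊕ Fin m → ℝ → ℝ
  prio : Fin n ⊕ Fin m → ℝ → ℝ → ℝ

/-- The equilibrium function `χ(ρ, ξ)`. -/
def chi (ρ ξ : ℝ) : ℝ :=
  if 0 < ξ ∧ ξ < ρ then 1 else if ρ < ξ ∧ ξ < 0 then -1 else 0

/-- The set `D_ξ` of admissible kinetic values at `ξ`. -/
def kinSet (ξ : ℝ) : Set ℝ :=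
  {g | Real.sign ξ * g = |g| ∧ |g| ≤ 1}

/-- The half line occupied by a road: incoming roads are `(-∞, 0)`, outgoing ones `(0, ∞)`. -/
def roadDomain {n m : ℕ} : Fin n ⊕ Fin m → Set ℝ
  | Sum.inl _ => Iio 0
  | Sum.inr _ => Ioi 0

/-- The sign `+1` of incoming and `-1` of outgoing roads. -/
def roadSign {n m : ℕ} : Fin n ⊕ Fin m → ℝ
  | Sum.inl _ => 1
  | Sum.inr _ => -1

namespace Junction

variable {n m : ℕ}

/-- The state interval `K_h`. -/
def K (N : Junction n m) (h : Fin n ⊕ Fin m) : Set ℝ := Icc (N.a h) (N.b h)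

/-- The states `ρ ∈ K_h` with `η_h'(ρ-) ≤ M ≤ η_h'(ρ+)`, under the convention
`η_h'(a_h-) = -∞` and `η_h'(b_h+) = +∞`. -/
def levelSet (N : Junction n m) (h : Fin n ⊕ Fin m) (M : ℝ) : Set ℝ :=
  {ρ | ρ ∈ N.K h ∧ (ρ = N.a h ∨ derivWithin (N.η h) (Iio ρ) ρ ≤ M) ∧
    (ρ = N.b h ∨ M ≤ derivWithin (N.η h) (Ioi ρ) ρ)}

/-- The assumptions on the data. -/
structure Admissible (N : Junction n m) : Prop where
  lt : ∀ h, N.a h < N.b h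
  zero_mem : ∀ h, (0 : ℝ) ∈ N.K h
  flux_nonneg : ∀ h, ∀ ξ ∈ N.K h, 0 ≤ N.f h ξ
  flux_lipschitz : ∀ h, ∃ L : ℝ≥0, LipschitzOnWith L (N.f h) (N.K h)
  flux_concave : ∀ h, ConcaveOn ℝ (N.K h) (N.f h)
  flux_left : ∀ h, N.f h (N.a h) = 0
  flux_right : ∀ h, N.f h (N.b h) = 0
  flux_balance : ∑ i : Fin n, N.f (Sum.inl i) 0 - ∑ j : Fin m, N.f (Sum.inr j) 0 = 0
  /-- `df h` is a monotone representative of the almost everywhere derivative of `f h`. -/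
  df_antitone : ∀ h, AntitoneOn (N.df h) (N.K h)
  df_deriv : ∀ h, ∀ᵐ ξ ∂(volume.restrict (N.K h)), HasDerivAt (N.f h) (N.df h ξ) ξ
  entropy_convex : ∀ h, ConvexOn ℝ univ (N.η h)
  prio_mono : ∀ h M, MonotoneOn (N.prio h M) (Icc 0 1)
  prio_surj : ∀ h M, N.prio h M '' Icc 0 1 = N.levelSet h M

/-- The states whose characteristics run into the junction: the interior relative to `K_h` of
`{f_h' ≥ 0}` on incoming roads and of `{f_h' ≤ 0}` on outgoing roads. -/
def Gin (N : Junction n m) (h : Fin n ⊕ Fin m) : Set ℝ :=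
  {ξ | ξ ∈ N.K h ∧ ∀ᶠ y in 𝓝[N.K h] ξ, 0 ≤ roadSign h * N.df h y}

/-- The states whose characteristics leave the junction: the closure of `{f_h' < 0}` on incoming
roads and of `{f_h' > 0}` on outgoing roads (`K_h` is closed, so this is the closure in `K_h`). -/
def Gout (N : Junction n m) (h : Fin n ⊕ Fin m) : Set ℝ :=
  closure {ξ | ξ ∈ N.K h ∧ roadSign h * N.df h ξ < 0}

/-- The pair `p = (M, z)` is admissible for the data `g` on the sets `Gin`: `z ∈ [0,1]`, and with
the outgoing values `χ(prio h M z, ·)` on `Gout h` the mass flux through the junction balances. -/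
def IsCouplingParam (N : Junction n m) (g : Fin n ⊕ Fin m → ℝ → ℝ) (p : ℝ × ℝ) : Prop :=
  p.2 ∈ Icc (0 : ℝ) 1 ∧
    ∑ i : Fin n, ((∫ ξ in N.Gout (Sum.inl i),
          N.df (Sum.inl i) ξ * chi (N.prio (Sum.inl i) p.1 p.2) ξ)
        + ∫ ξ in N.Gin (Sum.inl i), N.df (Sum.inl i) ξ * g (Sum.inl i) ξ)
      = ∑ j : Fin m, ((∫ ξ in N.Gout (Sum.inr j),
          N.df (Sum.inr j) ξ * chi (N.prio (Sum.inr j) p.1 p.2) ξ)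
        + ∫ ξ in N.Gin (Sum.inr j), N.df (Sum.inr j) ξ * g (Sum.inr j) ξ)

open Classical in
/-- The kinetic coupling function `Ψ`: it maps the data `g` on the sets `Gin` to
`χ(prio h M z, ·)` on the sets `Gout`, where `(M, z)` balances the mass flux. For admissible data
such a pair exists, and any two of them give the same values almost everywhere on `Gout`. -/
def Psi (N : Junction n m) (g : Fin n ⊕ Fin m → ℝ → ℝ) (h : Fin n ⊕ Fin m) (ξ : ℝ) : ℝ :=
  if hp : ∃ p : ℝ × ℝ, N.IsCouplingParam g p then
    chi (N.prio h hp.choose.1 hp.choose.2) ξ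
  else 0

/-- Lebesgue measure on the phase space `Ω_h × K_h`. -/
def phase (N : Junction n m) (h : Fin n ⊕ Fin m) : Measure (ℝ × ℝ) :=
  volume.restrict (roadDomain h ×ˢ N.K h)

/-- The space `L¹(Ω_h × K_h)`. -/
abbrev Kin (N : Junction n m) (h : Fin n ⊕ Fin m) : Type := Lp ℝ 1 (N.phase h)

/-- The condition `u ∈ L¹(Ω_h × K_h, D_ξ)`. -/
def TakesKinValues (N : Junction n m) (h : Fin n ⊕ Fin m) (u : N.Kin h) : Prop :=
  ∀ᵐ p ∂(N.phase h), u p ∈ kinSet p.2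

/-- The density `ρ_u(x) = ∫_{K_h} u(x, ξ) dξ`. -/
def density (N : Junction n m) (h : Fin n ⊕ Fin m) (u : N.Kin h) (x : ℝ) : ℝ :=
  ∫ ξ in N.K h, u (x, ξ)

/-- The relaxation term `(χ(ρ_u(x), ξ) - u(x, ξ)) / ε`. -/
def relax (N : Junction n m) (ε : ℝ) (h : Fin n ⊕ Fin m) (u : N.Kin h) (p : ℝ × ℝ) : ℝ :=
  (chi (N.density h u p.1) p.2 - u p) / ε

/-- `γ` is a boundary trace at `x = 0` of a distributional solution `u` of
`∂_t u + f_h'(ξ) ∂_x u = (χ(ρ_u, ξ) - u) / ε` on `(0,∞) × Ω_h × K_h`: the equation holds when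
tested with smooth functions that have compact support in `t > 0` but need not vanish at `x = 0`,
with boundary values `γ`. -/
def IsWeakSolutionWithTrace (N : Junction n m) (ε : ℝ) (h : Fin n ⊕ Fin m)
    (u : C(ℝ≥0, N.Kin h)) (γ : ℝ → ℝ → ℝ) : Prop :=
  ∀ φ : ℝ × ℝ × ℝ → ℝ, ContDiff ℝ (⊤ : ℕ∞) φ → HasCompactSupport φ →
    tsupport φ ⊆ Ioi (0 : ℝ) ×ˢ univ →
    (∫ t in Ioi (0 : ℝ), ∫ p,
        (u t.toNNReal p * (deriv (fun s => φ (s, p.1, p.2)) t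
            + N.df h p.2 * deriv (fun y => φ (t, y, p.2)) p.1)
          + N.relax ε h (u t.toNNReal) p * φ (t, p.1, p.2)) ∂(N.phase h))
      - roadSign h * ∫ t in Ioi (0 : ℝ), ∫ ξ in N.K h, N.df h ξ * γ t ξ * φ (t, 0, ξ) = 0

/-- `g` is a distributional solution in `C([0,∞), L¹(Ω_h × K_h, D_ξ))` of the BGK model with
initial data `g0` and coupling condition `g_h(t,0,ξ) = Ψ_h[g(t,0,Γ^in)](ξ)` on `Γ_h^out`. -/
structure IsBGKSolution (N : Junction n m) (ε : ℝ) (g0 : ∀ h, N.Kin h)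
    (g : ∀ h, C(ℝ≥0, N.Kin h)) : Prop where
  values : ∀ h t, N.TakesKinValues h (g h t)
  initial : ∀ h, g h 0 = g0 h
  equation : ∃ γ : Fin n ⊕ Fin m → ℝ → ℝ → ℝ,
    (∀ h, Measurable (Function.uncurry (γ h))) ∧
    (∀ h, ∀ᵐ q ∂((volume : Measure (ℝ × ℝ)).restrict (Ioi (0 : ℝ) ×ˢ N.K h)),
      γ h q.1 q.2 ∈ kinSet q.2) ∧
    (∀ h, N.IsWeakSolutionWithTrace ε h (g h) (γ h)) ∧
    ∀ᵐ t ∂((volume : Measure ℝ).restrict (Ioi 0)), ∀ h,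
      ∀ᵐ ξ ∂((volume : Measure ℝ).restrict (N.Gout h)),
        N.Psi (fun k => γ k t) h ξ = γ h t ξ

/-- The relaxation term of `u` equals `∂_ξ w` in the sense of distributions on
`(0,∞) × Ω_h × (a_h, b_h)`. -/
def RelaxIsDerivOf (N : Junction n m) (ε : ℝ) (h : Fin n ⊕ Fin m)
    (u : C(ℝ≥0, N.Kin h)) (w : ℝ × ℝ × ℝ → ℝ) : Prop :=
  ∀ φ : ℝ × ℝ × ℝ → ℝ, ContDiff ℝ (⊤ : ℕ∞) φ → HasCompactSupport φ →
    tsupport φ ⊆ Ioi (0 : ℝ) ×ˢ (roadDomain h ×ˢ Ioo (N.a h) (N.b h)) →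
    ∫ t in Ioi (0 : ℝ), ∫ p, N.relax ε h (u t.toNNReal) p * φ (t, p.1, p.2) ∂(N.phase h)
      = - ∫ t in Ioi (0 : ℝ), ∫ p,
          w (t, p.1, p.2) * deriv (fun y => φ (t, p.1, y)) p.2 ∂(N.phase h)

end Junction

end

/-!
On every road the solution is extended by zero to the whole line. It then solves
`∂_t U + c ∂_x U + lam U = X + c β δ_{x=0}`
with the speed `c = f_h'` and a source at the junction that inserts the particles entering the road
and removes those leaving it. Characteristics do not see each other, so this equation has an
explicit mild solution (`mild`): along each characteristic one integrates `X`, and one adds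
`± β` at the time of crossing `x = 0`. Mild solutions are weak solutions (`mild_weak`);
conversely a weak solution that is continuous in `L¹` is the mild one (`ae_eq_mild_of_weak`),
because the homogeneous equation has only the zero solution (`eq_zero_of_weak`). The weak
formulation with boundary trace is thus equivalent to an explicit formula, in which the trace is, up
to sign, the datum `β`. The loss term `-U / ε` may be put into the damping `lam` or into the source
`X`; the first choice serves the contraction, the second the moments.

The heart of the contraction is the coupling. The states `prio h M z` of all roads increase along
the lexicographic order of `(M, z)` (`prio_le_or_ge`). So of two couplings one has the larger states
on every road, the differences of the outgoing fluxes all have the same sign, and their sum is the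
difference of the incoming fluxes (`coupling_contraction`). In particular the outgoing values do not
depend on the choice of `(M, z)`. A balancing pair exists by the intermediate value theorem along
the same order (`exists_param`); the total incoming flux lies in the required range since
`∑ f_i(0) = ∑ f_j(0)` and the fluxes vanish at the end points of `K_h` (`sum_inflow_mem`). Together
with the `L¹` balance on each half line (`sum_lintegral_mild_le`) and
`‖χ(ρ) - χ(ρ')‖ = |ρ - ρ'| ≤ ‖g - g'‖`,
this gives `e^{t/ε} ‖U₁(t) - U₂(t)‖ ≤ ‖U₁(0) - U₂(0)‖ + (e^{t/ε} - 1) sup ‖V₁ - V₂‖` for the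
solutions `U_k` of the problems whose relaxation source is computed from given functions `V_k`
(`IsResponse.exp_mul_sum_le`). With `V_k = U_k` the `L¹` contraction and uniqueness follow. With
equal initial values the map `V ↦ U` has Lipschitz constant `1 - e^{-T/ε} < 1` on `[0, T]`, so that
its iterates converge to a solution (`exists_isResponse_self`). Each step is explicit
(`exists_isResponse`): the particles leaving the roads are known from the characteristics, their
flux determines the coupling, and the coupling determines the particles that enter. That the
solution so obtained vanishes outside the road and has values in `D_ξ` is `mild_crossData_mem`.

Multiplying the equation by `κ(ξ)` and integrating gives the moment identities (`integral_mul_mild`,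
`IsKineticSolution.integral_mul_eq`). For `κ = 1` the relaxation term drops out and the boundary
fluxes cancel, which is conservation of mass. The function `m_h` is the primitive in `ξ` of the
relaxation term (`entropyDefect`). The value `χ(ρ, ξ)` is the greatest element of `D_ξ` for `ξ < ρ`
and the least one for `ξ > ρ`. Hence the relaxation term is nonnegative below the density and
nonpositive above it; as it has integral zero, `m_h ≥ 0`. The moment with `κ = 1_{ξ < ξ₀}` expresses
the integral of `m_h(·, ·, ξ₀)` by partial masses and boundary fluxes. The masses `‖g_h(t)‖` grow at
a rate that is independent of `ε`, by the moment with `κ = sgn ξ`, so this bound is uniform in `ε`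
(`IsKineticSolution.lintegral_entropyDefect_le`).
-/

noncomputable section

namespace KineticTransport

/-! ### Free transport in Lagrangian coordinates -/

/-- The position at time `t` of the particle that starts in `p = (x, ξ)` and moves with
velocity `c ξ`. -/
def shift (c : ℝ → ℝ) (t : ℝ) (p : ℝ × ℝ) : ℝ × ℝ := (p.1 + t * c p.2, p.2)

/-- The time at which the particle starting in `p` crosses the junction `x = 0`. For particles at
rest the division by zero gives the value `0`, which no open time interval `(0, t)` contains. -/
def crossTime (c : ℝ → ℝ) (p : ℝ × ℝ) : ℝ := -p.1 / c p.2

/-- The contribution of the volume source `X` at times `s ∈ S` to the solution, in Lagrangian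
coordinates and with the damping `e^{-lam t}` factored out. -/
def sourceTerm (c : ℝ → ℝ) (lam : ℝ) (X : ℝ × ℝ × ℝ → ℝ) (S : Set ℝ) (p : ℝ × ℝ) : ℝ :=
  ∫ s in S, Real.exp (lam * s) * X (s, shift c s p)

/-- The contribution of the point source `c β δ_{x=0}` at times `s ∈ S`, in Lagrangian coordinates
and with the damping factored out: the particle collects `± β` when it crosses the junction. -/
def crossTerm (c : ℝ → ℝ) (lam : ℝ) (β : ℝ × ℝ → ℝ) (S : Set ℝ) (p : ℝ × ℝ) : ℝ :=
  S.indicator (fun s => SignType.sign (c p.2) * Real.exp (lam * s) * β (s, p.2)) (crossTime c p)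

/-- The solution of `∂_t U + c ∂_x U + lam U = X + c β δ_{x=0}` with initial values `U₀`, in
Lagrangian coordinates and multiplied by `e^{lam t}`. -/
def lagrange (c : ℝ → ℝ) (lam : ℝ) (U₀ : ℝ × ℝ → ℝ) (X : ℝ × ℝ × ℝ → ℝ) (β : ℝ × ℝ → ℝ)
    (t : ℝ) (p : ℝ × ℝ) : ℝ :=
  U₀ p + sourceTerm c lam X (Ioo 0 t) p + crossTerm c lam β (Ioo 0 t) p

/-- The mild solution of `∂_t U + c ∂_x U + lam U = X + c β δ_{x=0}`, `U(0) = U₀`. -/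
def mild (c : ℝ → ℝ) (lam : ℝ) (U₀ : ℝ × ℝ → ℝ) (X : ℝ × ℝ × ℝ → ℝ) (β : ℝ × ℝ → ℝ)
    (t : ℝ) (p : ℝ × ℝ) : ℝ :=
  Real.exp (-(lam * t)) * lagrange c lam U₀ X β t (shift c (-t) p)

variable {c : ℝ → ℝ} {lam : ℝ}

lemma shift_shift (s t : ℝ) (p : ℝ × ℝ) : shift c s (shift c t p) = shift c (s + t) p := by
  simp only [shift, Prod.mk.injEq, and_true]; ring

@[simp] lemma shift_zero (p : ℝ × ℝ) : shift c 0 p = p := by simp [shift]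

lemma shift_neg_shift (t : ℝ) (p : ℝ × ℝ) : shift c (-t) (shift c t p) = p := by
  simp [shift_shift]

lemma shift_shift_neg (t : ℝ) (p : ℝ × ℝ) : shift c t (shift c (-t) p) = p := by
  simp [shift_shift]

@[fun_prop]
lemma measurable_shift (hc : Measurable c) (t : ℝ) : Measurable (shift c t) := by
  unfold shift; fun_prop

lemma measurable_shift_uncurry (hc : Measurable c) :
    Measurable fun q : ℝ × ℝ × ℝ => shift c q.1 q.2 := by
  unfold shift; fun_prop

lemma measurable_crossTime (hc : Measurable c) : Measurable (crossTime c) := by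
  unfold crossTime; fun_prop

lemma measurePreserving_shift (hc : Measurable c) (t : ℝ) :
    MeasurePreserving (shift c t) volume volume := by
  have h1 : MeasurePreserving (fun p : ℝ × ℝ => (p.1, p.2 + t * c p.1))
      (volume.prod volume) (volume.prod volume) :=
    MeasurePreserving.skew_product (f := id) (g := fun ξ x => x + t * c ξ)
      (MeasurePreserving.id _) (by fun_prop)
      (Eventually.of_forall fun ξ => (measurePreserving_add_right volume (t * c ξ)).map_eq)
  exact (Measure.measurePreserving_swap.comp h1).comp Measure.measurePreserving_swap

lemma measurableEmbedding_shift (hc : Measurable c) (t : ℝ) : MeasurableEmbedding (shift c t) :=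
  (measurable_shift hc t).measurableEmbedding
    (Function.LeftInverse.injective (g := shift c (-t)) (shift_neg_shift t))

lemma integral_comp_shift (hc : Measurable c) (t : ℝ) (F : ℝ × ℝ → ℝ) :
    ∫ p, F (shift c t p) = ∫ p, F p :=
  (measurePreserving_shift hc t).integral_comp (measurableEmbedding_shift hc t) F

lemma lintegral_comp_shift (hc : Measurable c) (t : ℝ) (F : ℝ × ℝ → ℝ≥0∞) :
    ∫⁻ p, F (shift c t p) = ∫⁻ p, F p :=
  (measurePreserving_shift hc t).lintegral_comp_emb (measurableEmbedding_shift hc t) F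

/-- In the coordinates (crossing time, `ξ`) the phase space volume has density `|c ξ|`. -/
lemma map_crossTime (hc : Measurable c) :
    Measure.map (fun p : ℝ × ℝ => (crossTime c p, p.2))
      (volume.restrict {p : ℝ × ℝ | c p.2 ≠ 0})
      = (volume : Measure (ℝ × ℝ)).withDensity fun q => ENNReal.ofReal |c q.2| := by
  have hmeas : Measurable fun p : ℝ × ℝ => (crossTime c p, p.2) :=
    (measurable_crossTime hc).prodMk measurable_snd
  have hset : MeasurableSet {p : ℝ × ℝ | c p.2 ≠ 0} :=
    (hc.comp measurable_snd) (measurableSet_singleton (0 : ℝ)).compl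
  refine Measure.ext_of_lintegral _ fun F hF => ?_
  rw [lintegral_map hF hmeas, lintegral_withDensity_eq_lintegral_mul _ (by fun_prop) hF,
    ← lintegral_indicator hset, Measure.volume_eq_prod,
    lintegral_prod_symm (f := {p : ℝ × ℝ | c p.2 ≠ 0}.indicator
      fun p => F (crossTime c p, p.2)) ((hF.comp hmeas).indicator hset).aemeasurable,
    lintegral_prod_symm _ (by fun_prop)]
  refine lintegral_congr fun ξ => ?_
  by_cases h : c ξ = 0
  · simp [h, indicator]
  · have h' : -(c ξ) ≠ 0 := neg_ne_zero.2 h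
    have e := Real.smul_map_volume_mul_left h'
    simp only [indicator, mem_ofPred_eq, ne_eq, h, not_false_eq_true, if_true, Pi.mul_apply]
    conv_lhs => rw [← e]
    rw [lintegral_smul_measure, lintegral_map (by unfold crossTime; fun_prop) (by fun_prop)]
    simp only [smul_eq_mul, abs_neg]
    rw [← lintegral_const_mul _ (by unfold crossTime; fun_prop)]
    refine lintegral_congr fun s => ?_
    simp only [crossTime]
    congr 3
    field_simp

lemma lintegral_crossTime (hc : Measurable c) {F : ℝ × ℝ → ℝ≥0∞} (hF : Measurable F)
    (h0 : ∀ ξ, c ξ = 0 → F (0, ξ) = 0) :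
    ∫⁻ p : ℝ × ℝ, F (crossTime c p, p.2) = ∫⁻ s, ∫⁻ ξ, ENNReal.ofReal |c ξ| * F (s, ξ) := by
  have hmeas : Measurable fun p : ℝ × ℝ => (crossTime c p, p.2) :=
    (measurable_crossTime hc).prodMk measurable_snd
  have hset : MeasurableSet {p : ℝ × ℝ | c p.2 ≠ 0} :=
    (hc.comp measurable_snd) (measurableSet_singleton (0 : ℝ)).compl
  have e : ∫⁻ p : ℝ × ℝ, F (crossTime c p, p.2)
      = ∫⁻ p in {p : ℝ × ℝ | c p.2 ≠ 0}, F (crossTime c p, p.2) := by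
    rw [← lintegral_indicator hset]
    refine lintegral_congr fun p => ?_
    by_cases h : c p.2 = 0
    · simp [indicator, h, crossTime, h0]
    · simp [indicator, h]
  rw [e, ← lintegral_map hF hmeas, map_crossTime hc,
    lintegral_withDensity_eq_lintegral_mul _ (by fun_prop) hF, Measure.volume_eq_prod,
    lintegral_prod _ (by fun_prop)]
  rfl

lemma integral_crossTime (hc : Measurable c) {F : ℝ × ℝ → ℝ} (hF : Measurable F)
    (h0 : ∀ ξ, c ξ = 0 → F (0, ξ) = 0) :
    ∫ p : ℝ × ℝ, F (crossTime c p, p.2) = ∫ q : ℝ × ℝ, |c q.2| * F q := by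
  have hmeas : Measurable fun p : ℝ × ℝ => (crossTime c p, p.2) :=
    (measurable_crossTime hc).prodMk measurable_snd
  have hset : MeasurableSet {p : ℝ × ℝ | c p.2 ≠ 0} :=
    (hc.comp measurable_snd) (measurableSet_singleton (0 : ℝ)).compl
  have e : ∫ p : ℝ × ℝ, F (crossTime c p, p.2)
      = ∫ p in {p : ℝ × ℝ | c p.2 ≠ 0}, F (crossTime c p, p.2) := by
    rw [← integral_indicator hset]
    refine integral_congr_ae (Eventually.of_forall fun p => ?_)
    by_cases h : c p.2 = 0
    · simp [indicator, h, crossTime, h0]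
    · simp [indicator, h]
  rw [e, ← integral_map hmeas.aemeasurable hF.aestronglyMeasurable, map_crossTime hc,
    integral_withDensity_eq_integral_toReal_smul (by fun_prop) (by simp)]
  simp

lemma measurable_sourceTerm (hc : Measurable c) {X : ℝ × ℝ × ℝ → ℝ} (hX : Measurable X)
    (S : Set ℝ) : Measurable (sourceTerm c lam X S) := by
  have : StronglyMeasurable (Function.uncurry fun (p : ℝ × ℝ) (s : ℝ) =>
      Real.exp (lam * s) * X (s, shift c s p)) := by
    refine Measurable.stronglyMeasurable ?_
    have := measurable_shift_uncurry hc
    have h2 : Measurable fun z : (ℝ × ℝ) × ℝ => (z.2, shift c z.2 z.1) :=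
      measurable_snd.prodMk (this.comp (measurable_snd.prodMk measurable_fst))
    exact (by fun_prop : Measurable fun z : (ℝ × ℝ) × ℝ => Real.exp (lam * z.2)).mul (hX.comp h2)
  exact (this.integral_prod_right (ν := volume.restrict S)).measurable

lemma measurable_sourceTerm_uncurry (hc : Measurable c) {X : ℝ × ℝ × ℝ → ℝ} (hX : Measurable X) :
    Measurable fun q : ℝ × ℝ × ℝ => sourceTerm c lam X (Ioo 0 q.1) q.2 := by
  have : StronglyMeasurable (Function.uncurry fun (q : ℝ × ℝ × ℝ) (s : ℝ) =>
      (Ioo 0 q.1).indicator (fun s => Real.exp (lam * s) * X (s, shift c s q.2)) s) := by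
    refine Measurable.stronglyMeasurable ?_
    have := measurable_shift_uncurry hc
    have h2 : Measurable fun z : (ℝ × ℝ × ℝ) × ℝ => (z.2, shift c z.2 z.1.2) :=
      measurable_snd.prodMk (this.comp (measurable_snd.prodMk (by fun_prop)))
    have h3 : Measurable fun z : (ℝ × ℝ × ℝ) × ℝ =>
        Real.exp (lam * z.2) * X (z.2, shift c z.2 z.1.2) :=
      (by fun_prop : Measurable fun z : (ℝ × ℝ × ℝ) × ℝ => Real.exp (lam * z.2)).mul (hX.comp h2)
    have hs : MeasurableSet {z : (ℝ × ℝ × ℝ) × ℝ | 0 < z.2 ∧ z.2 < z.1.1} :=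
      (measurableSet_lt measurable_const measurable_snd).inter
        (measurableSet_lt measurable_snd (by fun_prop))
    exact h3.indicator hs
  have h := (this.integral_prod_right (ν := volume)).measurable
  simpa only [sourceTerm, integral_indicator measurableSet_Ioo] using h

lemma measurable_signType_coe : Measurable fun x : ℝ => ((SignType.sign x : SignType) : ℝ) := by
  refine Monotone.measurable fun x y hxy => ?_
  have h := SignType.sign.monotone hxy
  revert h
  cases SignType.sign x <;> cases SignType.sign y <;> simp

lemma measurable_crossTerm_uncurry (hc : Measurable c) {β : ℝ × ℝ → ℝ} (hβ : Measurable β) :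
    Measurable fun q : ℝ × ℝ × ℝ => crossTerm c lam β (Ioo 0 q.1) q.2 := by
  have h1 : Measurable fun q : ℝ × ℝ × ℝ => crossTime c q.2 :=
    (measurable_crossTime hc).comp measurable_snd
  have hs : MeasurableSet {q : ℝ × ℝ × ℝ | 0 < crossTime c q.2 ∧ crossTime c q.2 < q.1} :=
    (measurableSet_lt measurable_const h1).inter (measurableSet_lt h1 measurable_fst)
  have h2 : Measurable fun q : ℝ × ℝ × ℝ => ((SignType.sign (c q.2.2) : SignType) : ℝ)
      * Real.exp (lam * crossTime c q.2) * β (crossTime c q.2, q.2.2) :=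
    ((measurable_signType_coe.comp (hc.comp (by fun_prop))).mul
      (Real.measurable_exp.comp (h1.const_mul lam))).mul (hβ.comp (h1.prodMk (by fun_prop)))
  exact h2.indicator hs

lemma measurable_crossTerm (hc : Measurable c) {β : ℝ × ℝ → ℝ} (hβ : Measurable β)
    {S : Set ℝ} (hS : MeasurableSet S) : Measurable (crossTerm c lam β S) := by
  have h1 := measurable_crossTime hc
  have h2 : Measurable fun q : ℝ × ℝ => ((SignType.sign (c q.2) : SignType) : ℝ)
      * Real.exp (lam * crossTime c q) * β (crossTime c q, q.2) :=
    ((measurable_signType_coe.comp (hc.comp (by fun_prop))).mul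
      (Real.measurable_exp.comp (h1.const_mul lam))).mul (hβ.comp (h1.prodMk (by fun_prop)))
  exact h2.indicator (h1 hS)

lemma measurable_lagrange_uncurry (hc : Measurable c) {U₀ : ℝ × ℝ → ℝ} (hU₀ : Measurable U₀)
    {X : ℝ × ℝ × ℝ → ℝ} (hX : Measurable X) {β : ℝ × ℝ → ℝ} (hβ : Measurable β) :
    Measurable fun q : ℝ × ℝ × ℝ => lagrange c lam U₀ X β q.1 q.2 :=
  ((hU₀.comp measurable_snd).add (measurable_sourceTerm_uncurry hc hX)).add
    (measurable_crossTerm_uncurry hc hβ)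

lemma measurable_mild_uncurry (hc : Measurable c) {U₀ : ℝ × ℝ → ℝ} (hU₀ : Measurable U₀)
    {X : ℝ × ℝ × ℝ → ℝ} (hX : Measurable X) {β : ℝ × ℝ → ℝ} (hβ : Measurable β) :
    Measurable fun q : ℝ × ℝ × ℝ => mild c lam U₀ X β q.1 q.2 := by
  have h := (measurable_lagrange_uncurry (lam := lam) hc hU₀ hX hβ).comp
    (measurable_fst.prodMk ((measurable_shift_uncurry hc).comp
      ((measurable_fst (α := ℝ) (β := ℝ × ℝ)).neg.prodMk measurable_snd)))
  exact (by fun_prop : Measurable fun q : ℝ × ℝ × ℝ => Real.exp (-(lam * q.1))).mul h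

/-! ### Estimates in `L¹` -/

/-- The mass per unit of time that the point source `c β δ_{x=0}` emits or absorbs. -/
def crossFlux (c : ℝ → ℝ) (β : ℝ × ℝ → ℝ) (s : ℝ) : ℝ≥0∞ := ∫⁻ ξ, ‖c ξ * β (s, ξ)‖ₑ

lemma measurable_crossFlux (hc : Measurable c) {β : ℝ × ℝ → ℝ} (hβ : Measurable β) :
    Measurable (crossFlux c β) := by
  have : Measurable fun q : ℝ × ℝ => ‖c q.2 * β q‖ₑ := by fun_prop
  exact this.lintegral_prod_right'

lemma lintegral_sourceTerm_le (hc : Measurable c) {X : ℝ × ℝ × ℝ → ℝ} (hX : Measurable X)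
    (S : Set ℝ) :
    ∫⁻ p, ‖sourceTerm c lam X S p‖ₑ
      ≤ ∫⁻ s in S, ENNReal.ofReal (Real.exp (lam * s)) * ∫⁻ p, ‖X (s, p)‖ₑ := by
  calc ∫⁻ p, ‖sourceTerm c lam X S p‖ₑ
      ≤ ∫⁻ p, ∫⁻ s in S, ‖Real.exp (lam * s) * X (s, shift c s p)‖ₑ :=
        lintegral_mono fun p => enorm_integral_le_lintegral_enorm _
    _ = ∫⁻ s in S, ∫⁻ p, ‖Real.exp (lam * s) * X (s, shift c s p)‖ₑ := by
        refine lintegral_lintegral_swap (Measurable.aemeasurable ?_)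
        have h2 : Measurable fun z : (ℝ × ℝ) × ℝ => (z.2, shift c z.2 z.1) :=
          measurable_snd.prodMk ((measurable_shift_uncurry hc).comp
            (measurable_snd.prodMk measurable_fst))
        exact ((by fun_prop : Measurable fun z : (ℝ × ℝ) × ℝ => Real.exp (lam * z.2)).mul
          (hX.comp h2)).enorm
    _ = _ := by
        refine lintegral_congr fun s => ?_
        simp only [enorm_mul]
        have hm : Measurable fun p => ‖X (s, shift c s p)‖ₑ :=
          ((hX.comp measurable_prodMk_left).comp (measurable_shift hc s)).enorm
        rw [lintegral_const_mul _ hm, lintegral_comp_shift hc s fun p => ‖X (s, p)‖ₑ,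
          Real.enorm_eq_ofReal (Real.exp_pos _).le]

/-- In `L¹` the point source contributes exactly the mass that it emits or absorbs, since distinct
particles cross `x = 0` at distinct pairs of time and velocity. -/
lemma lintegral_crossTerm (hc : Measurable c) {β : ℝ × ℝ → ℝ} (hβ : Measurable β)
    {S : Set ℝ} (hS : MeasurableSet S) :
    ∫⁻ p, ‖crossTerm c lam β S p‖ₑ
      = ∫⁻ s in S, ENNReal.ofReal (Real.exp (lam * s)) * crossFlux c β s := by
  have hm : Measurable fun q : ℝ × ℝ => ((SignType.sign (c q.2) : SignType) : ℝ)
      * Real.exp (lam * q.1) * β q :=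
    ((measurable_signType_coe.comp (hc.comp measurable_snd)).mul (by fun_prop)).mul hβ
  have hm' : Measurable (({q : ℝ × ℝ | q.1 ∈ S}).indicator fun q : ℝ × ℝ =>
      ‖((SignType.sign (c q.2) : SignType) : ℝ) * Real.exp (lam * q.1) * β q‖ₑ) :=
    hm.enorm.indicator (measurable_fst hS)
  have e := lintegral_crossTime hc hm' (fun ξ h => by simp [indicator, h])
  have e1 : ∀ p : ℝ × ℝ, ‖crossTerm c lam β S p‖ₑ
      = ({q : ℝ × ℝ | q.1 ∈ S}).indicator (fun q : ℝ × ℝ =>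
      ‖((SignType.sign (c q.2) : SignType) : ℝ) * Real.exp (lam * q.1) * β q‖ₑ)
        (crossTime c p, p.2) := by
    intro p
    by_cases h : crossTime c p ∈ S <;> simp [crossTerm, indicator, h]
  simp only [e1]
  rw [e, ← lintegral_indicator hS]
  refine lintegral_congr fun s => ?_
  by_cases h : s ∈ S
  · simp only [indicator, h, mem_ofPred_eq, if_true, crossFlux]
    rw [← lintegral_const_mul _ (by fun_prop)]
    refine lintegral_congr fun ξ => ?_
    rw [← Real.enorm_eq_ofReal_abs, ← Real.enorm_eq_ofReal (Real.exp_pos _).le,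
      ← enorm_mul, ← enorm_mul]
    rcases lt_trichotomy (c ξ) 0 with h | h | h
    · simp [sign_neg h]; ring
    · simp [h]
    · simp [sign_pos h]; ring
  · simp [indicator, h]

/-! ### The mild solution solves the transport equation weakly -/

lemma integrable_of_bounded_of_box {F : ℝ × ℝ × ℝ → ℝ} (hF : Measurable F) {M R : ℝ}
    (hM : ∀ q, |F q| ≤ M)
    (hR : ∀ q, F q ≠ 0 → |q.1| ≤ R ∧ |q.2.1| ≤ R ∧ |q.2.2| ≤ R) : Integrable F := by
  have hs : IsCompact (Icc (-R) R ×ˢ Icc (-R) R ×ˢ Icc (-R) R) :=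
    isCompact_Icc.prod (isCompact_Icc.prod isCompact_Icc)
  have hi : IntegrableOn F (Icc (-R) R ×ˢ Icc (-R) R ×ˢ Icc (-R) R) :=
    Measure.integrableOn_of_bounded (M := M) hs.measure_lt_top.ne hF.aestronglyMeasurable
      (Eventually.of_forall hM)
  rw [integrableOn_iff_integrable_of_support_subset] at hi
  · exact hi
  · intro q hq
    obtain ⟨h1, h2, h3⟩ := hR q hq
    exact ⟨abs_le.1 h1, abs_le.1 h2, abs_le.1 h3⟩

/-- Integration by parts on a single characteristic: the function paired with `deriv θ` is the sum
of a constant, the primitive of `X` and a jump of height `h` at the time `σ`. -/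
lemma integral_primitive_mul_deriv {A h σ : ℝ} {X : ℝ → ℝ} (hX : Measurable X)
    (hXb : ∀ T, ∃ C, ∀ s ∈ Ioo 0 T, |X s| ≤ C) {θ : ℝ → ℝ} (hθ : ContDiff ℝ 1 θ)
    (hc : HasCompactSupport θ) (h0 : θ 0 = 0) :
    ∫ t in Ioi (0 : ℝ), (A + (∫ s in Ioo 0 t, X s) + (Ioo 0 t).indicator (fun _ => h) σ)
        * deriv θ t
      = -(∫ s in Ioi (0 : ℝ), X s * θ s) - (Ioi (0 : ℝ)).indicator (fun σ => h * θ σ) σ := by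
  have hd : Continuous (deriv θ) := hθ.continuous_deriv le_rfl
  have hdc : HasCompactSupport (deriv θ) := hc.deriv
  have hdi : Integrable (deriv θ) := hd.integrable_of_hasCompactSupport hdc
  obtain ⟨T, hT⟩ : ∃ T, ∀ t, deriv θ t ≠ 0 → t < T := by
    obtain ⟨T, hT⟩ := (hdc.isCompact.bddAbove)
    exact ⟨T + 1, fun t ht => (hT (subset_tsupport _ ht)).trans_lt (by linarith)⟩
  obtain ⟨C, hC⟩ := hXb T
  -- Fubini's theorem on the triangle `0 < s < t`
  have hmeas : Measurable fun z : ℝ × ℝ =>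
      {z : ℝ × ℝ | z.2 ∈ Ioo 0 z.1}.indicator (fun z => X z.2 * deriv θ z.1) z := by
    refine Measurable.indicator ?_ ?_
    · exact (hX.comp measurable_snd).mul (hd.measurable.comp measurable_fst)
    · exact (measurableSet_lt measurable_const measurable_snd).inter
        (measurableSet_lt measurable_snd measurable_fst)
  have hint : Integrable (fun z : ℝ × ℝ =>
      {z : ℝ × ℝ | z.2 ∈ Ioo 0 z.1}.indicator (fun z => X z.2 * deriv θ z.1) z)
      ((volume.restrict (Ioi 0)).prod (volume.restrict (Ioi 0))) := by
    have hg : Integrable (fun z : ℝ × ℝ => deriv θ z.1 * (Ioo 0 T).indicator (fun _ => C) z.2)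
        ((volume.restrict (Ioi 0)).prod (volume.restrict (Ioi 0))) :=
      Integrable.mul_prod hdi.restrict
        ((integrable_indicator_iff measurableSet_Ioo).2 (by simp)).restrict
    refine hg.mono hmeas.aestronglyMeasurable (Eventually.of_forall fun z => ?_)
    by_cases hz : z.2 ∈ Ioo 0 z.1
    · by_cases hd0 : deriv θ z.1 = 0
      · simp [indicator, hd0]
      · have hz' : z.2 ∈ Ioo 0 T := ⟨hz.1, hz.2.trans (hT _ hd0)⟩
        have := (hC _ hz').trans (le_abs_self C)
        simp only [indicator, mem_ofPred_eq, hz, hz', if_true, norm_mul, Real.norm_eq_abs]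
        rw [mul_comm]
        gcongr
    · simp only [indicator, mem_ofPred_eq, hz, if_false, norm_zero]
      positivity
  have e1 : ∫ t in Ioi (0 : ℝ), (∫ s in Ioo 0 t, X s) * deriv θ t
      = -(∫ s in Ioi (0 : ℝ), X s * θ s) := by
    calc ∫ t in Ioi (0 : ℝ), (∫ s in Ioo 0 t, X s) * deriv θ t
        = ∫ t in Ioi (0 : ℝ), ∫ s in Ioi (0 : ℝ),
          {z : ℝ × ℝ | z.2 ∈ Ioo 0 z.1}.indicator (fun z => X z.2 * deriv θ z.1) (t, s) := by
          refine integral_congr_ae (Eventually.of_forall fun t => ?_)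
          dsimp only
          rw [← integral_mul_const, ← integral_indicator measurableSet_Ioo,
            ← integral_indicator measurableSet_Ioi]
          congr 1; ext s
          by_cases h1 : 0 < s <;> by_cases h2 : s < t <;> simp [indicator, h1, h2]
      _ = ∫ s in Ioi (0 : ℝ), ∫ t in Ioi (0 : ℝ),
          {z : ℝ × ℝ | z.2 ∈ Ioo 0 z.1}.indicator (fun z => X z.2 * deriv θ z.1) (t, s) :=
          integral_integral_swap hint
      _ = ∫ s in Ioi (0 : ℝ), -(X s * θ s) := by
          refine setIntegral_congr_fun measurableSet_Ioi fun s hs => ?_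
          have : ∀ t, (Ioi (0 : ℝ)).indicator (fun t => {z : ℝ × ℝ | z.2 ∈ Ioo 0 z.1}.indicator
              (fun z => X z.2 * deriv θ z.1) (t, s)) t
              = (Ioi s).indicator (fun t => X s * deriv θ t) t := by
            intro t
            have hs' : (0 : ℝ) < s := hs
            by_cases h2 : s < t
            · simp [indicator, h2, hs', hs'.trans h2]
            · simp [indicator, h2]
          rw [← integral_indicator measurableSet_Ioi]
          simp only [this]
          rw [integral_indicator measurableSet_Ioi, integral_const_mul,
            hc.integral_Ioi_deriv_eq hθ]
          ring
      _ = _ := integral_neg _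
  have e2 : ∫ t in Ioi (0 : ℝ), (Ioo 0 t).indicator (fun _ => h) σ * deriv θ t
      = -(Ioi (0 : ℝ)).indicator (fun σ => h * θ σ) σ := by
    by_cases hσ : 0 < σ
    · have : ∀ t, (Ioi (0 : ℝ)).indicator (fun t => (Ioo 0 t).indicator (fun _ => h) σ
          * deriv θ t) t = (Ioi σ).indicator (fun t => h * deriv θ t) t := by
        intro t
        by_cases h2 : σ < t
        · simp [indicator, h2, hσ, hσ.trans h2]
        · simp [indicator, h2]
      rw [← integral_indicator measurableSet_Ioi]
      simp only [this]
      rw [integral_indicator measurableSet_Ioi, integral_const_mul,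
        hc.integral_Ioi_deriv_eq hθ]
      simp [indicator, hσ]
    · simp [indicator, hσ]
  have e3 : ∫ t in Ioi (0 : ℝ), A * deriv θ t = 0 := by
    rw [integral_const_mul, hc.integral_Ioi_deriv_eq hθ, h0]; simp
  have i3 : IntegrableOn (fun t => A * deriv θ t) (Ioi 0) := (hdi.const_mul A).integrableOn
  have i2 : IntegrableOn (fun t => (Ioo 0 t).indicator (fun _ => h) σ * deriv θ t) (Ioi 0) := by
    have : (fun t => (Ioo 0 t).indicator (fun _ => h) σ * deriv θ t)
        = fun t => (if 0 < σ then h else 0) * (Ioi σ).indicator (deriv θ) t := by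
      ext t; by_cases h1 : 0 < σ <;> by_cases h2 : σ < t <;> simp [indicator, h1, h2]
    rw [this]
    exact ((hdi.indicator measurableSet_Ioi).const_mul _).integrableOn
  have i1 : IntegrableOn (fun t => (∫ s in Ioo 0 t, X s) * deriv θ t) (Ioi 0) := by
    have := hint.integral_prod_left
    refine this.congr (Eventually.of_forall fun t => ?_)
    dsimp only
    rw [← integral_mul_const, ← integral_indicator measurableSet_Ioo,
      ← integral_indicator measurableSet_Ioi]
    congr 1; ext s
    by_cases h1 : 0 < s <;> by_cases h2 : s < t <;> simp [indicator, h1, h2]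
  simp only [add_mul]
  have h1 := integral_add (i3.add i1) i2
  have h2 := integral_add i3 i1
  simp only [Pi.add_apply] at h1 h2
  rw [h1, h2, e1, e2, e3]
  ring

/-- The transport operator `∂_t φ + c ∂_x φ - lam φ` applied to a test function. -/
def transportOp (c : ℝ → ℝ) (lam : ℝ) (φ : ℝ × ℝ × ℝ → ℝ) (q : ℝ × ℝ × ℝ) : ℝ :=
  fderiv ℝ φ q (1, c q.2.2, 0) - lam * φ q

lemma transportOp_eq (φ : ℝ × ℝ × ℝ → ℝ) (q : ℝ × ℝ × ℝ) :
    transportOp c lam φ q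
      = fderiv ℝ φ q (1, 0, 0) + c q.2.2 * fderiv ℝ φ q (0, 1, 0) - lam * φ q := by
  have : ((1, c q.2.2, 0) : ℝ × ℝ × ℝ) = (1, 0, 0) + c q.2.2 • (0, 1, 0) := by simp
  rw [transportOp, this, map_add, map_smul, smul_eq_mul]

lemma measurable_transportOp (hc : Measurable c) {φ : ℝ × ℝ × ℝ → ℝ} (hφ : ContDiff ℝ 1 φ) :
    Measurable (transportOp c lam φ) := by
  have h1 : Continuous fun q => fderiv ℝ φ q (1, 0, 0) :=
    (hφ.continuous_fderiv one_ne_zero).clm_apply continuous_const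
  have h2 : Continuous fun q => fderiv ℝ φ q (0, 1, 0) :=
    (hφ.continuous_fderiv one_ne_zero).clm_apply continuous_const
  have h3 : transportOp c lam φ = _ := funext (transportOp_eq φ)
  rw [h3]
  exact (h1.measurable.add ((hc.comp (by fun_prop)).mul h2.measurable)).sub
    (hφ.continuous.measurable.const_mul lam)

/-- A test function and its derivatives are bounded and vanish outside a box. -/
lemma exists_testFunction_bounds {φ : ℝ × ℝ × ℝ → ℝ} (hφ : ContDiff ℝ 1 φ)
    (hs : HasCompactSupport φ) {L : ℝ} (hL : ∀ ξ, |c ξ| ≤ L) :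
    ∃ M R, 0 ≤ M ∧ 0 ≤ R ∧ (∀ q, |φ q| ≤ M) ∧ (∀ q, |transportOp c lam φ q| ≤ M) ∧
      ∀ q, (φ q ≠ 0 ∨ transportOp c lam φ q ≠ 0) → |q.1| ≤ R ∧ |q.2.1| ≤ R ∧ |q.2.2| ≤ R := by
  have h1 : Continuous fun q => fderiv ℝ φ q (1, 0, 0) :=
    (hφ.continuous_fderiv one_ne_zero).clm_apply continuous_const
  have h2 : Continuous fun q => fderiv ℝ φ q (0, 1, 0) :=
    (hφ.continuous_fderiv one_ne_zero).clm_apply continuous_const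
  obtain ⟨M0, hM0⟩ := hφ.continuous.bounded_above_of_compact_support hs
  obtain ⟨M1, hM1⟩ := h1.bounded_above_of_compact_support
    (hs.fderiv_apply (𝕜 := ℝ) (1, 0, 0))
  obtain ⟨M2, hM2⟩ := h2.bounded_above_of_compact_support
    (hs.fderiv_apply (𝕜 := ℝ) (0, 1, 0))
  obtain ⟨R, hR⟩ := hs.isCompact.isBounded.subset_closedBall (0 : ℝ × ℝ × ℝ)
  have hL0 : 0 ≤ L := (abs_nonneg _).trans (hL 0)
  have n0 : 0 ≤ M0 := (norm_nonneg _).trans (hM0 0)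
  have n1 : 0 ≤ M1 := (norm_nonneg _).trans (hM1 0)
  have n2 : 0 ≤ M2 := (norm_nonneg _).trans (hM2 0)
  have nl : 0 ≤ |lam| := abs_nonneg lam
  refine ⟨M0 + (M1 + L * M2 + |lam| * M0), max R 0, by positivity, le_max_right _ _, fun q => ?_,
    fun q => ?_, fun q hq => ?_⟩
  · exact (hM0 q).trans (le_add_of_nonneg_right (by positivity))
  · rw [transportOp_eq]
    have e1 := hM1 q
    have e2 : |c q.2.2 * fderiv ℝ φ q (0, 1, 0)| ≤ L * M2 := by
      rw [abs_mul]; exact mul_le_mul (hL _) (hM2 q) (abs_nonneg _) hL0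
    have e3 : |lam * φ q| ≤ |lam| * M0 := by
      rw [abs_mul]; exact mul_le_mul_of_nonneg_left (hM0 q) nl
    have := abs_sub (fderiv ℝ φ q (1, 0, 0) + c q.2.2 * fderiv ℝ φ q (0, 1, 0)) (lam * φ q)
    have := abs_add_le (fderiv ℝ φ q (1, 0, 0)) (c q.2.2 * fderiv ℝ φ q (0, 1, 0))
    rw [Real.norm_eq_abs] at e1
    linarith
  · have hq' : q ∈ tsupport φ := by
      by_contra hn
      have z1 : φ q = 0 := image_eq_zero_of_notMem_tsupport hn
      have z2 : fderiv ℝ φ q = 0 := by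
        by_contra hne
        exact hn (support_fderiv_subset ℝ hne)
      simp [z1, z2, transportOp] at hq
    have hb := hR hq'
    rw [mem_closedBall_zero_iff, Prod.norm_def, Prod.norm_def, max_le_iff, max_le_iff] at hb
    exact ⟨hb.1.trans (le_max_left _ _), hb.2.1.trans (le_max_left _ _),
      hb.2.2.trans (le_max_left _ _)⟩

/-- The transport operator is the derivative along the characteristics of the damped test function.
-/
lemma hasDerivAt_along_characteristic {φ : ℝ × ℝ × ℝ → ℝ} (hφ : ContDiff ℝ 1 φ) (p : ℝ × ℝ)
    (t : ℝ) : HasDerivAt (fun t => Real.exp (-(lam * t)) * φ (t, shift c t p))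
      (Real.exp (-(lam * t)) * transportOp c lam φ (t, shift c t p)) t := by
  have h1 : HasDerivAt (fun t : ℝ => ((t, shift c t p) : ℝ × ℝ × ℝ)) (1, c p.2, 0) t := by
    refine (hasDerivAt_id t).prodMk (HasDerivAt.prodMk ?_ (hasDerivAt_const t p.2))
    simpa using ((hasDerivAt_id t).mul_const (c p.2)).const_add p.1
  have h2 := ((hφ.differentiable one_ne_zero) (t, shift c t p)).hasFDerivAt.comp_hasDerivAt t h1
  have h3 : HasDerivAt (fun t => Real.exp (-(lam * t))) (Real.exp (-(lam * t)) * (-lam)) t := by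
    simpa using (((hasDerivAt_id t).const_mul lam).neg).exp
  refine (h3.mul h2).congr_deriv ?_
  simp only [transportOp, Function.comp_apply, shift]
  ring

lemma abs_lagrange_le {U₀ : ℝ × ℝ → ℝ} {CU : ℝ} (bU₀ : ∀ p, |U₀ p| ≤ CU)
    {X : ℝ × ℝ × ℝ → ℝ} {CX : ℝ} (bX : ∀ q, |X q| ≤ CX)
    {β : ℝ × ℝ → ℝ} {Cβ : ℝ} (bβ : ∀ q, |β q| ≤ Cβ) {t R : ℝ} (ht : |t| ≤ R) (p : ℝ × ℝ) :
    |lagrange c lam U₀ X β t p|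
      ≤ CU + Real.exp (|lam| * R) * CX * R + Real.exp (|lam| * R) * Cβ := by
  have hCX : 0 ≤ CX := (abs_nonneg _).trans (bX 0)
  have hCβ : 0 ≤ Cβ := (abs_nonneg _).trans (bβ 0)
  have hR0 : 0 ≤ R := (abs_nonneg _).trans ht
  have hexp : ∀ t : ℝ, |t| ≤ R → Real.exp (lam * t) ≤ Real.exp (|lam| * R) := fun t ht => by
    refine Real.exp_le_exp.2 ((le_abs_self _).trans ?_)
    rw [abs_mul]; gcongr
  have hR : ∀ s ∈ Ioo 0 t, |s| ≤ R := fun s hs => by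
    rw [abs_of_pos hs.1]; exact hs.2.le.trans ((le_abs_self _).trans ht)
  have b1 : |sourceTerm c lam X (Ioo 0 t) p| ≤ Real.exp (|lam| * R) * CX * R := by
    rw [← Real.norm_eq_abs]
    refine (norm_setIntegral_le_of_norm_le_const (C := Real.exp (|lam| * R) * CX) (by simp)
      fun s hs => ?_).trans ?_
    · simp only [norm_mul, Real.norm_eq_abs, Real.abs_exp]
      exact mul_le_mul (hexp _ (hR s hs)) (bX _) (abs_nonneg _) (Real.exp_pos _).le
    · refine mul_le_mul_of_nonneg_left ?_ (by positivity)
      simp only [measureReal_def, Real.volume_Ioo, sub_zero, ENNReal.toReal_ofReal']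
      exact max_le ((le_abs_self _).trans ht) hR0
  have b2 : |crossTerm c lam β (Ioo 0 t) p| ≤ Real.exp (|lam| * R) * Cβ := by
    by_cases h : crossTime c p ∈ Ioo 0 t
    · simp only [crossTerm, indicator, h, if_true, abs_mul, Real.abs_exp]
      have : |((SignType.sign (c p.2) : SignType) : ℝ)| ≤ 1 := by
        cases SignType.sign (c p.2) <;> simp
      calc _ ≤ 1 * Real.exp (|lam| * R) * Cβ := mul_le_mul (mul_le_mul this (hexp _ (hR _ h))
            (Real.exp_pos _).le zero_le_one) (bβ _) (abs_nonneg _) (by positivity)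
        _ = _ := by ring
    · simp only [crossTerm, indicator, h, if_false, abs_zero]; positivity
  exact (abs_add_le _ _).trans (add_le_add ((abs_add_le _ _).trans (add_le_add (bU₀ _) b1)) b2)

/-- The mild solution satisfies the weak formulation, including the point source at `x = 0`. -/
theorem mild_weak (hc : Measurable c) {L : ℝ} (hL : ∀ ξ, |c ξ| ≤ L) {U₀ : ℝ × ℝ → ℝ}
    (hU₀ : Measurable U₀) {CU : ℝ} (bU₀ : ∀ p, |U₀ p| ≤ CU)
    {X : ℝ × ℝ × ℝ → ℝ} (hX : Measurable X) {CX : ℝ} (bX : ∀ q, |X q| ≤ CX)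
    {β : ℝ × ℝ → ℝ} (hβ : Measurable β) {Cβ : ℝ} (bβ : ∀ q, |β q| ≤ Cβ)
    {φ : ℝ × ℝ × ℝ → ℝ} (hφ : ContDiff ℝ 1 φ) (hs : HasCompactSupport φ)
    (hpos : tsupport φ ⊆ Ioi (0 : ℝ) ×ˢ univ) :
    (∫ t in Ioi (0 : ℝ), ∫ p, (mild c lam U₀ X β t p * transportOp c lam φ (t, p)
        + X (t, p) * φ (t, p)))
      + ∫ t in Ioi (0 : ℝ), ∫ ξ, c ξ * β (t, ξ) * φ (t, 0, ξ) = 0 := by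
  obtain ⟨M, R, hM0, hR0, bφ, bD, hbox⟩ := exists_testFunction_bounds (lam := lam) hφ hs hL
  have hL0 : 0 ≤ L := (abs_nonneg _).trans (hL 0)
  have hCX : 0 ≤ CX := (abs_nonneg _).trans (bX 0)
  have hCβ : 0 ≤ Cβ := (abs_nonneg _).trans (bβ 0)
  have hCU : 0 ≤ CU := (abs_nonneg _).trans (bU₀ 0)
  have mφ : Measurable φ := hφ.continuous.measurable
  have mD : Measurable (transportOp c lam φ) := measurable_transportOp hc hφ
  have msh : Measurable fun q : ℝ × ℝ × ℝ => (q.1, shift c q.1 q.2) :=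
    measurable_fst.prodMk (measurable_shift_uncurry hc)
  -- the test function along the characteristics, and its time derivative
  let θ : ℝ × ℝ → ℝ → ℝ := fun p t => Real.exp (-(lam * t)) * φ (t, shift c t p)
  let θ' : ℝ × ℝ × ℝ → ℝ := fun q =>
    Real.exp (-(lam * q.1)) * transportOp c lam φ (q.1, shift c q.1 q.2)
  have hθ' : ∀ p t, deriv (θ p) t = θ' (t, p) := fun p t =>
    (hasDerivAt_along_characteristic hφ p t).deriv
  have zero_of_nonpos : ∀ t p, t ≤ 0 → φ (t, p) = 0 := fun t p ht => by
    refine image_eq_zero_of_notMem_tsupport fun h => ?_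
    exact absurd (hpos h).1 (not_lt.2 ht)
  have hexp : ∀ t : ℝ, |t| ≤ R → Real.exp (-(lam * t)) ≤ Real.exp (|lam| * R) := fun t ht => by
    refine Real.exp_le_exp.2 ((neg_le_abs _).trans ?_)
    rw [abs_mul]; gcongr
  have hexp' : ∀ t : ℝ, |t| ≤ R → Real.exp (lam * t) ≤ Real.exp (|lam| * R) := fun t ht => by
    refine Real.exp_le_exp.2 ((le_abs_self _).trans ?_)
    rw [abs_mul]; gcongr
  -- boxes in Lagrangian coordinates
  have hbox' : ∀ q : ℝ × ℝ × ℝ, (φ (q.1, shift c q.1 q.2) ≠ 0 ∨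
      transportOp c lam φ (q.1, shift c q.1 q.2) ≠ 0) →
      |q.1| ≤ R + R * L ∧ |q.2.1| ≤ R + R * L ∧ |q.2.2| ≤ R + R * L := by
    intro q hq
    obtain ⟨h1, h2, h3⟩ := hbox _ hq
    dsimp only [shift] at h1 h2 h3
    have hRL : 0 ≤ R * L := by positivity
    refine ⟨by linarith, ?_, by linarith⟩
    have e : q.2.1 = (q.2.1 + q.1 * c q.2.2) - q.1 * c q.2.2 := by ring
    have e2 : |q.1 * c q.2.2| ≤ R * L := by
      rw [abs_mul]; exact mul_le_mul h1 (hL _) (abs_nonneg _) hR0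
    rw [e]
    exact (abs_sub _ _).trans (add_le_add h2 e2)
  have hboxR : ∀ q : ℝ × ℝ × ℝ, (φ (q.1, shift c q.1 q.2) ≠ 0 ∨
      transportOp c lam φ (q.1, shift c q.1 q.2) ≠ 0) → |q.1| ≤ R :=
    fun q hq => (hbox _ hq).1
  let E := Real.exp (|lam| * R)
  have hE : 0 ≤ E := (Real.exp_pos _).le
  -- the source in Lagrangian coordinates
  let Y : ℝ × ℝ × ℝ → ℝ := fun q => Real.exp (lam * q.1) * X (q.1, shift c q.1 q.2)
  have mY : Measurable Y :=
    (by fun_prop : Measurable fun q : ℝ × ℝ × ℝ => Real.exp (lam * q.1)).mul (hX.comp msh)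
  have bY : ∀ q : ℝ × ℝ × ℝ, |q.1| ≤ R → |Y q| ≤ E * CX := fun q hq => by
    simp only [Y, abs_mul, Real.abs_exp]
    exact mul_le_mul (hexp' _ hq) (bX _) (abs_nonneg _) hE
  have mlag : Measurable fun q : ℝ × ℝ × ℝ => lagrange c lam U₀ X β q.1 q.2 :=
    measurable_lagrange_uncurry hc hU₀ hX hβ
  have blag : ∀ q : ℝ × ℝ × ℝ, |q.1| ≤ R →
      |lagrange c lam U₀ X β q.1 q.2| ≤ CU + E * CX * R + E * Cβ :=
    fun q hq => abs_lagrange_le bU₀ bX bβ hq q.2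
  have mθ' : Measurable θ' :=
    (by fun_prop : Measurable fun q : ℝ × ℝ × ℝ => Real.exp (-(lam * q.1))).mul (mD.comp msh)
  have mθ : Measurable fun q : ℝ × ℝ × ℝ => θ q.2 q.1 :=
    (by fun_prop : Measurable fun q : ℝ × ℝ × ℝ => Real.exp (-(lam * q.1))).mul (mφ.comp msh)
  have bθ' : ∀ q, |θ' q| ≤ E * M := fun q => by
    by_cases h : transportOp c lam φ (q.1, shift c q.1 q.2) = 0
    · simp only [θ', h, mul_zero, abs_zero]; positivity
    · simp only [θ', abs_mul, Real.abs_exp]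
      exact mul_le_mul (hexp _ (hboxR q (Or.inr h))) (bD _) (abs_nonneg _) hE
  have bθ : ∀ q : ℝ × ℝ × ℝ, |θ q.2 q.1| ≤ E * M := fun q => by
    by_cases h : φ (q.1, shift c q.1 q.2) = 0
    · simp only [θ, h, mul_zero, abs_zero]; positivity
    · simp only [θ, abs_mul, Real.abs_exp]
      exact mul_le_mul (hexp _ (hboxR q (Or.inl h))) (bφ _) (abs_nonneg _) hE
  -- joint integrability, needed for the exchange of the integrals over `t` and `p`
  have int1 : Integrable fun q : ℝ × ℝ × ℝ => lagrange c lam U₀ X β q.1 q.2 * θ' q := by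
    refine integrable_of_bounded_of_box (mlag.mul mθ')
      (M := (CU + E * CX * R + E * Cβ) * (E * M)) (R := R + R * L) (fun q => ?_) fun q hq => ?_
    · by_cases h : transportOp c lam φ (q.1, shift c q.1 q.2) = 0
      · simp only [θ', h, mul_zero, abs_zero]; positivity
      · rw [abs_mul]
        exact mul_le_mul (blag _ (hboxR q (Or.inr h))) (bθ' q) (abs_nonneg _) (by positivity)
    · refine hbox' q (Or.inr fun h => hq ?_)
      simp [θ', h]
  have int2 : Integrable fun q : ℝ × ℝ × ℝ => Y q * θ q.2 q.1 := by
    refine integrable_of_bounded_of_box (mY.mul mθ)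
      (M := (E * CX) * (E * M)) (R := R + R * L) (fun q => ?_) fun q hq => ?_
    · by_cases h : φ (q.1, shift c q.1 q.2) = 0
      · simp only [θ, h, mul_zero, abs_zero]; positivity
      · rw [abs_mul]
        exact mul_le_mul (bY _ (hboxR q (Or.inl h))) (bθ q) (abs_nonneg _) (by positivity)
    · refine hbox' q (Or.inl fun h => hq ?_)
      simp [θ, h]
  -- passage to Lagrangian coordinates
  have step1 : ∀ t, ∫ p, (mild c lam U₀ X β t p * transportOp c lam φ (t, p)
        + X (t, p) * φ (t, p))
      = ∫ p, (lagrange c lam U₀ X β t p * θ' (t, p) + Y (t, p) * θ p t) := fun t => by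
    rw [← integral_comp_shift hc t]
    refine integral_congr_ae (Eventually.of_forall fun p => ?_)
    simp only [mild, shift_neg_shift, θ', Y, θ]
    have : Real.exp (lam * t) * Real.exp (-(lam * t)) = 1 := by rw [← Real.exp_add]; simp
    linear_combination (-(X (t, shift c t p) * φ (t, shift c t p))) * this
  have int12 : Integrable (Function.uncurry fun (t : ℝ) (p : ℝ × ℝ) =>
      lagrange c lam U₀ X β t p * θ' (t, p) + Y (t, p) * θ p t)
      ((volume.restrict (Ioi 0)).prod volume) := by
    have h := (int1.add int2).restrict (s := Ioi (0 : ℝ) ×ˢ univ)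
    rwa [Measure.volume_eq_prod ℝ (ℝ × ℝ), ← Measure.prod_restrict, Measure.restrict_univ] at h
  -- evaluation of the time integral on each characteristic
  have step2 : ∀ᵐ p : ℝ × ℝ, ∫ t in Ioi (0 : ℝ),
      (lagrange c lam U₀ X β t p * θ' (t, p) + Y (t, p) * θ p t)
      = - (Ioi (0 : ℝ)).indicator (fun σ => ((SignType.sign (c p.2) : SignType) : ℝ)
        * β (σ, p.2) * φ (σ, 0, p.2)) (crossTime c p) := by
    have i1 := (int1.swap).prod_right_ae
    have i2 := (int2.swap).prod_right_ae
    filter_upwards [i1, i2] with p h1 h2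
    have h1' : IntegrableOn (fun t => lagrange c lam U₀ X β t p * θ' (t, p)) (Ioi 0) :=
      h1.integrableOn
    have h2' : IntegrableOn (fun t => Y (t, p) * θ p t) (Ioi 0) := h2.integrableOn
    rw [integral_add h1' h2']
    have cθ : ContDiff ℝ 1 (θ p) := by
      have : ContDiff ℝ 1 fun t : ℝ => ((t, shift c t p) : ℝ × ℝ × ℝ) := by
        unfold shift; fun_prop
      exact (by fun_prop : ContDiff ℝ 1 fun t : ℝ => Real.exp (-(lam * t))).mul (hφ.comp this)
    have sθ : HasCompactSupport (θ p) := by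
      refine HasCompactSupport.intro (isCompact_Icc (a := -R) (b := R)) fun t ht => ?_
      by_contra hne
      have : φ (t, shift c t p) ≠ 0 := fun h => hne (by simp [θ, h])
      exact ht (abs_le.1 (hboxR (t, p) (Or.inl this)))
    have z0 : θ p 0 = 0 := by simp [θ, zero_of_nonpos]
    have key := integral_primitive_mul_deriv (A := U₀ p) (h := ((SignType.sign (c p.2) : SignType)
      : ℝ) * Real.exp (lam * crossTime c p) * β (crossTime c p, p.2)) (σ := crossTime c p)
      (X := fun s => Y (s, p)) (mY.comp measurable_prodMk_right)
      (fun T => ⟨Real.exp (|lam| * |T|) * CX, fun s hs' => by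
        simp only [Y, abs_mul, Real.abs_exp]
        refine mul_le_mul ?_ (bX _) (abs_nonneg _) (Real.exp_pos _).le
        refine Real.exp_le_exp.2 ((le_abs_self _).trans ?_)
        rw [abs_mul]
        refine mul_le_mul_of_nonneg_left ?_ (abs_nonneg _)
        rw [abs_of_pos hs'.1]; exact hs'.2.le.trans (le_abs_self _)⟩) cθ sθ z0
    simp only [hθ'] at key
    have e : ∀ t, lagrange c lam U₀ X β t p = U₀ p + (∫ s in Ioo 0 t, Y (s, p))
        + (Ioo 0 t).indicator (fun _ => ((SignType.sign (c p.2) : SignType)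
      : ℝ) * Real.exp (lam * crossTime c p) * β (crossTime c p, p.2)) (crossTime c p) := fun t => by
      simp only [lagrange, sourceTerm, crossTerm, Y, indicator]
    simp only [e]
    rw [key]
    have e3 : (Ioi (0 : ℝ)).indicator (fun σ => ((SignType.sign (c p.2) : SignType) : ℝ)
        * Real.exp (lam * crossTime c p) * β (crossTime c p, p.2) * θ p σ) (crossTime c p)
        = (Ioi (0 : ℝ)).indicator (fun σ => ((SignType.sign (c p.2) : SignType) : ℝ)
        * β (σ, p.2) * φ (σ, 0, p.2)) (crossTime c p) := by
      by_cases hc0 : c p.2 = 0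
      · simp [indicator, hc0]
      · have hz : shift c (crossTime c p) p = (0, p.2) := by
          simp only [shift, crossTime, Prod.mk.injEq, and_true]; field_simp; ring
        have : Real.exp (lam * crossTime c p) * Real.exp (-(lam * crossTime c p)) = 1 := by
          rw [← Real.exp_add]; simp
        simp only [indicator, θ, hz]
        split_ifs
        · linear_combination (((SignType.sign (c p.2) : SignType) : ℝ) * β (crossTime c p, p.2)
            * φ (crossTime c p, 0, p.2)) * this
        · rfl
    rw [e3]; ring
  simp only [step1]
  rw [integral_integral_swap int12, integral_congr_ae step2, integral_neg]
  -- the crossing times as new variables: the integral over all particles becomes the flux at the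
  -- junction
  let G : ℝ × ℝ → ℝ := fun q => (Ioi (0 : ℝ)).indicator
    (fun σ => ((SignType.sign (c q.2) : SignType) : ℝ) * β (σ, q.2) * φ (σ, 0, q.2)) q.1
  have mG : Measurable G := by
    have h1 : Measurable fun q : ℝ × ℝ => ((SignType.sign (c q.2) : SignType) : ℝ) * β (q.1, q.2)
        * φ (q.1, 0, q.2) :=
      ((measurable_signType_coe.comp (hc.comp measurable_snd)).mul hβ).mul
        (mφ.comp (by fun_prop))
    exact h1.indicator (measurable_fst measurableSet_Ioi)
  have e4 := integral_crossTime hc mG (fun ξ h => by simp [G])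
  have e5 : ∀ q : ℝ × ℝ, |c q.2| * G q = (Ioi (0 : ℝ) ×ˢ univ).indicator
      (fun q => c q.2 * β q * φ (q.1, 0, q.2)) q := fun q => by
    have : |c q.2| * ((SignType.sign (c q.2) : SignType) : ℝ) = c q.2 := abs_mul_sign _
    by_cases h : 0 < q.1
    · simp only [G, indicator, mem_Ioi, h, if_true, mem_prod, mem_univ, and_true]
      linear_combination (β q * φ (q.1, 0, q.2)) * this
    · simp [G, indicator, h]
  have e6 : ∫ q : ℝ × ℝ, |c q.2| * G q
      = ∫ t in Ioi (0 : ℝ), ∫ ξ, c ξ * β (t, ξ) * φ (t, 0, ξ) := by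
    simp only [e5]
    rw [integral_indicator (measurableSet_Ioi.prod MeasurableSet.univ),
      Measure.volume_eq_prod, setIntegral_prod]
    · simp
    · rw [← Measure.volume_eq_prod]
      have mF : Measurable fun q : ℝ × ℝ => c q.2 * β q * φ (q.1, 0, q.2) :=
        ((hc.comp measurable_snd).mul hβ).mul (mφ.comp (by fun_prop))
      have hcpt : IsCompact (Icc (-R) R ×ˢ Icc (-R) R) := isCompact_Icc.prod isCompact_Icc
      have hi : IntegrableOn (fun q : ℝ × ℝ => c q.2 * β q * φ (q.1, 0, q.2))
          (Icc (-R) R ×ˢ Icc (-R) R) := by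
        refine Measure.integrableOn_of_bounded (M := L * Cβ * M) hcpt.measure_lt_top.ne
          mF.aestronglyMeasurable (Eventually.of_forall fun q => ?_)
        simp only [norm_mul, Real.norm_eq_abs]
        exact mul_le_mul (mul_le_mul (hL _) (bβ _) (abs_nonneg _) hL0) (bφ _) (abs_nonneg _)
          (by positivity)
      rw [integrableOn_iff_integrable_of_support_subset] at hi
      · exact hi.integrableOn
      · intro q hq
        have : φ (q.1, 0, q.2) ≠ 0 := fun h => hq (by simp [h])
        obtain ⟨h1, -, h3⟩ := hbox _ (Or.inl this)
        exact ⟨abs_le.1 h1, abs_le.1 h3⟩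
  have e7 : ∀ p : ℝ × ℝ, (Ioi (0 : ℝ)).indicator (fun σ => ((SignType.sign (c p.2) : SignType) : ℝ)
      * β (σ, p.2) * φ (σ, 0, p.2)) (crossTime c p) = G (crossTime c p, p.2) := fun p => rfl
  simp only [e7]
  rw [e4, e6]
  ring

/-! ### Continuity in `L¹` and moments of mild solutions -/

/-- Regularity of the data of a transport problem: the initial value is measurable, bounded and
integrable, the sources are measurable and bounded, and they supply mass at a locally bounded
rate. -/
structure IsData (c : ℝ → ℝ) (U₀ : ℝ × ℝ → ℝ) (X : ℝ × ℝ × ℝ → ℝ) (β : ℝ × ℝ → ℝ) : Prop where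
  meas_init : Measurable U₀
  bdd_init : ∃ C, ∀ p, |U₀ p| ≤ C
  int_init : ∫⁻ p, ‖U₀ p‖ₑ < ∞
  meas_source : Measurable X
  bdd_source : ∃ C, ∀ q, |X q| ≤ C
  meas_cross : Measurable β
  bdd_cross : ∃ C, ∀ q, |β q| ≤ C
  mass : ∀ T : ℝ, ∃ C : ℝ≥0, ∀ s ∈ Ioo 0 T, (∫⁻ p, ‖X (s, p)‖ₑ) + crossFlux c β s ≤ C

lemma integrableOn_source {X : ℝ × ℝ × ℝ → ℝ} (hX : Measurable X)
    (bX : ∃ C, ∀ q, |X q| ≤ C) (p : ℝ × ℝ) (T : ℝ) :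
    IntegrableOn (fun s => Real.exp (lam * s) * X (s, shift c s p)) (Ioo 0 T) := by
  obtain ⟨C, hC⟩ := bX
  have hC0 : 0 ≤ C := (abs_nonneg _).trans (hC 0)
  have m1 : Measurable fun s : ℝ => Real.exp (lam * s) * X (s, shift c s p) := by
    have : Measurable fun s : ℝ => ((s, shift c s p) : ℝ × ℝ × ℝ) := by unfold shift; fun_prop
    exact (by fun_prop : Measurable fun s : ℝ => Real.exp (lam * s)).mul (hX.comp this)
  have cont : Continuous fun s : ℝ => Real.exp (lam * s) * C := by fun_prop
  refine Integrable.mono ((cont.integrableOn_Icc (a := 0) (b := T)).mono_set Ioo_subset_Icc_self)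
    m1.aestronglyMeasurable (Eventually.of_forall fun s => ?_)
  simp only [norm_mul, Real.norm_eq_abs]
  exact mul_le_mul_of_nonneg_left ((hC _).trans (le_abs_self _)) (abs_nonneg _)

/-- In Lagrangian coordinates the solution changes between two times only by what the sources
supply. -/
lemma lintegral_lagrange_sub_le (hc : Measurable c) {U₀ : ℝ × ℝ → ℝ} {X : ℝ × ℝ × ℝ → ℝ}
    {β : ℝ × ℝ → ℝ} (h : IsData c U₀ X β) {t₁ t₂ : ℝ} (h12 : t₁ ≤ t₂) :
    ∫⁻ p, ‖lagrange c lam U₀ X β t₂ p - lagrange c lam U₀ X β t₁ p‖ₑ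
      ≤ ∫⁻ s in Ioo 0 t₂ \ Ioo 0 t₁, ENNReal.ofReal (Real.exp (lam * s))
        * ((∫⁻ p, ‖X (s, p)‖ₑ) + crossFlux c β s) := by
  have hS : MeasurableSet (Ioo 0 t₂ \ Ioo 0 t₁) := measurableSet_Ioo.diff measurableSet_Ioo
  have hsub : Ioo 0 t₁ ⊆ Ioo 0 t₂ := Ioo_subset_Ioo_right h12
  have e : ∀ p, lagrange c lam U₀ X β t₂ p - lagrange c lam U₀ X β t₁ p
      = sourceTerm c lam X (Ioo 0 t₂ \ Ioo 0 t₁) p + crossTerm c lam β (Ioo 0 t₂ \ Ioo 0 t₁) p := by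
    intro p
    have e1 : sourceTerm c lam X (Ioo 0 t₂ \ Ioo 0 t₁) p
        = sourceTerm c lam X (Ioo 0 t₂) p - sourceTerm c lam X (Ioo 0 t₁) p :=
      setIntegral_sdiff measurableSet_Ioo
        (integrableOn_source h.meas_source h.bdd_source p t₂) hsub
    have e2 : crossTerm c lam β (Ioo 0 t₂ \ Ioo 0 t₁) p
        = crossTerm c lam β (Ioo 0 t₂) p - crossTerm c lam β (Ioo 0 t₁) p := by
      simp only [crossTerm, indicator_sdiff hsub, Pi.sub_apply]
    rw [e1, e2]; simp only [lagrange]; ring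
  have mflux := measurable_crossFlux hc h.meas_cross
  have mX : Measurable fun s => ∫⁻ p, ‖X (s, p)‖ₑ := h.meas_source.enorm.lintegral_prod_right'
  calc _ ≤ ∫⁻ p, (‖sourceTerm c lam X (Ioo 0 t₂ \ Ioo 0 t₁) p‖ₑ
        + ‖crossTerm c lam β (Ioo 0 t₂ \ Ioo 0 t₁) p‖ₑ) :=
        lintegral_mono fun p => by rw [e]; exact enorm_add_le _ _
    _ = (∫⁻ p, ‖sourceTerm c lam X (Ioo 0 t₂ \ Ioo 0 t₁) p‖ₑ)
        + ∫⁻ p, ‖crossTerm c lam β (Ioo 0 t₂ \ Ioo 0 t₁) p‖ₑ :=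
        lintegral_add_left (measurable_sourceTerm hc h.meas_source _).enorm _
    _ ≤ _ := by
        rw [lintegral_crossTerm hc h.meas_cross hS]
        refine (add_le_add_left (lintegral_sourceTerm_le hc h.meas_source _) _).trans ?_
        rw [← lintegral_add_left (by fun_prop)]
        simp only [mul_add]
        exact le_rfl

lemma lintegral_lagrange_sub_le_const (hc : Measurable c) {U₀ : ℝ × ℝ → ℝ} {X : ℝ × ℝ × ℝ → ℝ}
    {β : ℝ × ℝ → ℝ} (h : IsData c U₀ X β) (T : ℝ) :
    ∃ C : ℝ≥0, ∀ t₁ t₂, 0 ≤ t₁ → t₁ ≤ t₂ → t₂ ≤ T →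
      ∫⁻ p, ‖lagrange c lam U₀ X β t₂ p - lagrange c lam U₀ X β t₁ p‖ₑ
        ≤ C * ENNReal.ofReal (t₂ - t₁) := by
  obtain ⟨C, hC⟩ := h.mass T
  refine ⟨(Real.exp (|lam| * |T|)).toNNReal * C, fun t₁ t₂ h0 h12 hT => ?_⟩
  refine (lintegral_lagrange_sub_le hc h h12).trans ?_
  calc _ ≤ ∫⁻ s in Ioo 0 t₂ \ Ioo 0 t₁, ((Real.exp (|lam| * |T|)).toNNReal * C : ℝ≥0∞) := by
        refine setLIntegral_mono measurable_const fun s hs => ?_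
        have hs' : s ∈ Ioo 0 T := ⟨hs.1.1, hs.1.2.trans_le hT⟩
        refine mul_le_mul' ?_ (hC s hs')
        refine ENNReal.ofReal_le_ofReal (Real.exp_le_exp.2 ((le_abs_self _).trans ?_))
        rw [abs_mul]
        refine mul_le_mul_of_nonneg_left ?_ (abs_nonneg _)
        rw [abs_of_pos hs'.1]; exact hs'.2.le.trans (le_abs_self _)
    _ = ((Real.exp (|lam| * |T|)).toNNReal * C : ℝ≥0∞) * volume (Ioo 0 t₂ \ Ioo 0 t₁) := by
        rw [setLIntegral_const]
    _ ≤ ((Real.exp (|lam| * |T|)).toNNReal * C : ℝ≥0∞) * volume (Ico t₁ t₂) := by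
        gcongr
        intro s hs
        refine ⟨?_, hs.1.2⟩
        by_contra hlt
        exact hs.2 ⟨hs.1.1, not_le.1 hlt⟩
    _ = _ := by rw [Real.volume_Ico]; push_cast; rfl

lemma integrable_lagrange (hc : Measurable c) {U₀ : ℝ × ℝ → ℝ} {X : ℝ × ℝ × ℝ → ℝ}
    {β : ℝ × ℝ → ℝ} (h : IsData c U₀ X β) {t : ℝ} (ht : 0 ≤ t) :
    Integrable (lagrange c lam U₀ X β t) := by
  obtain ⟨C, hC⟩ := lintegral_lagrange_sub_le_const (lam := lam) hc h t
  have h1 : Integrable fun p => lagrange c lam U₀ X β t p - lagrange c lam U₀ X β 0 p := by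
    refine ⟨?_, (hC 0 t le_rfl ht le_rfl).trans_lt (by finiteness)⟩
    have := measurable_lagrange_uncurry (lam := lam) hc h.meas_init h.meas_source h.meas_cross
    exact ((this.comp measurable_prodMk_left).sub
      (this.comp measurable_prodMk_left)).aestronglyMeasurable
  have h0 : Integrable (lagrange c lam U₀ X β 0) := by
    have : lagrange c lam U₀ X β 0 = U₀ := by
      ext p; simp [lagrange, sourceTerm, crossTerm]
    rw [this]
    exact ⟨h.meas_init.aestronglyMeasurable, h.int_init⟩
  refine (h1.add h0).congr (Eventually.of_forall fun p => ?_)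
  simp

/-- The group of translations along the characteristics is strongly continuous in `L¹`. -/
lemma tendsto_lintegral_shift (hc : Measurable c) {L : ℝ} (hL : ∀ ξ, |c ξ| ≤ L) {V : ℝ × ℝ → ℝ}
    (hV : Integrable V) (t₀ : ℝ) :
    Tendsto (fun t => ∫⁻ p, ‖V (shift c t p) - V (shift c t₀ p)‖ₑ) (𝓝 t₀) (𝓝 0) := by
  have hL0 : 0 ≤ L := (abs_nonneg _).trans (hL 0)
  refine ENNReal.tendsto_nhds_zero.2 fun ε hε => ?_
  obtain ⟨g, gs, hg, gc, gi⟩ := hV.exists_hasCompactSupport_lintegral_sub_le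
    (ε := ε / 3) (by simpa using hε.ne')
  have key : Tendsto (fun t => ∫⁻ p, ‖g (shift c t p) - g (shift c t₀ p)‖ₑ) (𝓝 t₀)
      (𝓝 (∫⁻ _ : ℝ × ℝ, 0)) := by
    obtain ⟨M, hM⟩ := gc.bounded_above_of_compact_support gs
    obtain ⟨R, hR⟩ := gs.isCompact.isBounded.subset_closedBall (0 : ℝ × ℝ)
    let B : Set (ℝ × ℝ) := Icc (-(|R| + (|t₀| + 1) * L)) (|R| + (|t₀| + 1) * L) ×ˢ Icc (-|R|) |R|
    have hB : IsCompact B := isCompact_Icc.prod isCompact_Icc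
    have hgB : ∀ t, |t| ≤ |t₀| + 1 → ∀ p, p ∉ B → g (shift c t p) = 0 := by
      intro t ht p hp
      by_contra hne
      have hb := hR (subset_tsupport _ hne)
      rw [mem_closedBall_zero_iff, Prod.norm_def, max_le_iff] at hb
      obtain ⟨h1, h2⟩ := hb
      simp only [shift, Real.norm_eq_abs] at h1 h2
      refine hp ⟨abs_le.1 ?_, abs_le.1 (h2.trans (le_abs_self R))⟩
      have e2 : |t * c p.2| ≤ (|t₀| + 1) * L := by
        rw [abs_mul]; exact mul_le_mul ht (hL _) (abs_nonneg _) (by positivity)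
      have e : p.1 = (p.1 + t * c p.2) - t * c p.2 := by ring
      rw [e]
      exact (abs_sub _ _).trans (add_le_add (h1.trans (le_abs_self R)) e2)
    refine tendsto_lintegral_filter_of_dominated_convergence
      (B.indicator fun _ => ENNReal.ofReal (M + M)) ?_ ?_ ?_ ?_
    · exact Eventually.of_forall fun t => ((gc.measurable.comp (measurable_shift hc t)).sub
        (gc.measurable.comp (measurable_shift hc t₀))).enorm
    · have hnear : ∀ᶠ t in 𝓝 t₀, |t| ≤ |t₀| + 1 := by
        filter_upwards [Metric.ball_mem_nhds t₀ one_pos] with t ht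
        rw [Metric.mem_ball, Real.dist_eq] at ht
        have := abs_add_le (t - t₀) t₀
        rw [sub_add_cancel] at this
        linarith
      filter_upwards [hnear] with t ht
      refine Eventually.of_forall fun p => ?_
      by_cases hp : p ∈ B
      · simp only [hp, indicator_of_mem]
        rw [Real.enorm_eq_ofReal_abs]
        exact ENNReal.ofReal_le_ofReal ((abs_sub _ _).trans (add_le_add (hM _) (hM _)))
      · simp [hp, hgB t ht p hp, hgB t₀ (by linarith) p hp]
    · rw [lintegral_indicator hB.measurableSet, setLIntegral_const]
      exact (ENNReal.mul_lt_top (by simp) hB.measure_lt_top).ne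
    · refine Eventually.of_forall fun p => ?_
      have : Continuous fun t => ‖g (shift c t p) - g (shift c t₀ p)‖ₑ := by
        unfold shift; fun_prop
      simpa using this.tendsto t₀
  rw [lintegral_zero] at key
  filter_upwards [ENNReal.tendsto_nhds_zero.1 key (ε / 3)
    (by simpa [pos_iff_ne_zero] using hε.ne')] with t ht
  have mV := hV.aestronglyMeasurable
  have a1 : ∀ t, AEMeasurable (fun p => ‖V (shift c t p) - g (shift c t p)‖ₑ) := fun t =>
    ((mV.aemeasurable.sub gc.measurable.aemeasurable).enorm).comp_quasiMeasurePreserving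
      (measurePreserving_shift hc t).quasiMeasurePreserving
  calc ∫⁻ p, ‖V (shift c t p) - V (shift c t₀ p)‖ₑ
      ≤ ∫⁻ p, (‖V (shift c t p) - g (shift c t p)‖ₑ
        + (‖g (shift c t p) - g (shift c t₀ p)‖ₑ + ‖V (shift c t₀ p) - g (shift c t₀ p)‖ₑ)) := by
        refine lintegral_mono fun p => ?_
        have e : V (shift c t p) - V (shift c t₀ p) = (V (shift c t p) - g (shift c t p))
          + ((g (shift c t p) - g (shift c t₀ p)) - (V (shift c t₀ p) - g (shift c t₀ p))) := by
            ring
        rw [e]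
        exact (enorm_add_le _ _).trans (add_le_add_right (enorm_sub_le) _)
    _ = (∫⁻ p, ‖V p - g p‖ₑ) + ((∫⁻ p, ‖g (shift c t p) - g (shift c t₀ p)‖ₑ)
        + ∫⁻ p, ‖V p - g p‖ₑ) := by
        rw [lintegral_add_left' (a1 t), lintegral_add_right' _ (a1 t₀),
          lintegral_comp_shift hc t fun p => ‖V p - g p‖ₑ,
          lintegral_comp_shift hc t₀ fun p => ‖V p - g p‖ₑ]
    _ ≤ ε / 3 + (ε / 3 + ε / 3) := by gcongr
    _ = ε := by rw [← add_assoc, ENNReal.add_thirds]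

/-- Continuity of `t ↦ U (t, ·)` from `[0, ∞)` to `L¹`, for functions instead of classes. -/
def ContinuousInL1 (U : ℝ × ℝ × ℝ → ℝ) : Prop :=
  (∀ t, 0 ≤ t → Integrable fun p => U (t, p)) ∧
    ∀ t₀, 0 ≤ t₀ → Tendsto (fun t => ∫⁻ p, ‖U (t, p) - U (t₀, p)‖ₑ) (𝓝[Ici 0] t₀) (𝓝 0)

lemma ContinuousInL1.sub {U V : ℝ × ℝ × ℝ → ℝ} (hU : ContinuousInL1 U) (hV : ContinuousInL1 V) :
    ContinuousInL1 fun q => U q - V q := by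
  refine ⟨fun t ht => (hU.1 t ht).sub (hV.1 t ht), fun t₀ ht₀ => ?_⟩
  have h := (hU.2 t₀ ht₀).add (hV.2 t₀ ht₀)
  rw [add_zero] at h
  refine tendsto_of_tendsto_of_tendsto_of_le_of_le' tendsto_const_nhds h
    (Eventually.of_forall fun _ => zero_le) ?_
  filter_upwards [self_mem_nhdsWithin] with t ht
  have m1 : AEMeasurable fun p => ‖U (t, p) - U (t₀, p)‖ₑ :=
    ((hU.1 t ht).sub (hU.1 t₀ ht₀)).aestronglyMeasurable.enorm
  rw [← lintegral_add_left' m1]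
  refine lintegral_mono fun p => ?_
  rw [show U (t, p) - V (t, p) - (U (t₀, p) - V (t₀, p))
    = (U (t, p) - U (t₀, p)) - (V (t, p) - V (t₀, p)) by ring]
  exact enorm_sub_le

lemma continuousInL1_mild (hc : Measurable c) {L : ℝ} (hL : ∀ ξ, |c ξ| ≤ L) {U₀ : ℝ × ℝ → ℝ}
    {X : ℝ × ℝ × ℝ → ℝ} {β : ℝ × ℝ → ℝ} (h : IsData c U₀ X β) :
    ContinuousInL1 fun q => mild c lam U₀ X β q.1 q.2 := by
  refine ⟨fun t ht => ?_, fun t₀ ht₀ => ?_⟩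
  · exact (((measurePreserving_shift hc (-t)).integrable_comp_emb
      (measurableEmbedding_shift hc (-t))).2 (integrable_lagrange (lam := lam) hc h ht)).const_mul
        (Real.exp (-(lam * t)))
  · obtain ⟨C, hC⟩ := lintegral_lagrange_sub_le_const (lam := lam) hc h (t₀ + 1)
    have hi := integrable_lagrange (lam := lam) hc h ht₀
    let e : ℝ → ℝ := fun t => Real.exp (-(lam * t))
    have ce : Continuous e := by fun_prop
    -- three contributions to the difference: the sources acting between `t₀` and `t`, the change of
    -- the damping factor, and the translation along the characteristics
    have l1 : Tendsto (fun t => ‖e t‖ₑ * (C * ENNReal.ofReal |t - t₀|)) (𝓝[Ici 0] t₀) (𝓝 0) := by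
      have h1 : Tendsto (fun t => ENNReal.ofReal (|e t| * (C * |t - t₀|))) (𝓝[Ici 0] t₀) (𝓝 0) := by
        have : Continuous fun t => ENNReal.ofReal (|e t| * (C * |t - t₀|)) :=
          ENNReal.continuous_ofReal.comp (by fun_prop)
        have h2 := (this.tendsto t₀).mono_left (nhdsWithin_le_nhds (s := Ici 0))
        simpa using h2
      refine h1.congr fun t => ?_
      rw [ENNReal.ofReal_mul (abs_nonneg _), ENNReal.ofReal_mul C.coe_nonneg,
        Real.enorm_eq_ofReal_abs]
      simp
    have l2 : Tendsto (fun t => ‖e t - e t₀‖ₑ * ∫⁻ p, ‖lagrange c lam U₀ X β t₀ p‖ₑ)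
        (𝓝[Ici 0] t₀) (𝓝 0) := by
      have : Continuous fun t => ‖e t - e t₀‖ₑ := by fun_prop
      have h2 := (this.tendsto t₀).mono_left (nhdsWithin_le_nhds (s := Ici 0))
      rw [sub_self, enorm_zero] at h2
      have h3 := ENNReal.Tendsto.mul_const h2 (b := ∫⁻ p, ‖lagrange c lam U₀ X β t₀ p‖ₑ)
        (Or.inr hi.2.ne)
      simpa using h3
    have l3 : Tendsto (fun t => ‖e t₀‖ₑ * ∫⁻ p, ‖lagrange c lam U₀ X β t₀ (shift c (-t) p)
        - lagrange c lam U₀ X β t₀ (shift c (-t₀) p)‖ₑ) (𝓝[Ici 0] t₀) (𝓝 0) := by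
      have h1 := ((tendsto_lintegral_shift hc hL hi (-t₀)).comp
        (continuous_neg.tendsto t₀)).mono_left (nhdsWithin_le_nhds (s := Ici 0))
      have h3 := ENNReal.Tendsto.const_mul h1 (a := ‖e t₀‖ₑ) (Or.inr (by simp))
      simpa using h3
    have lim := l1.add (l2.add l3)
    simp only [add_zero] at lim
    refine tendsto_of_tendsto_of_tendsto_of_le_of_le' tendsto_const_nhds lim
      (Eventually.of_forall fun _ => zero_le) ?_
    have hnear : ∀ᶠ t in 𝓝[Ici 0] t₀, t ≤ t₀ + 1 :=
      nhdsWithin_le_nhds (Iic_mem_nhds (by linarith))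
    filter_upwards [self_mem_nhdsWithin, hnear] with t ht ht1
    have hit := integrable_lagrange (lam := lam) hc h ht
    have bnd : ∫⁻ p, ‖lagrange c lam U₀ X β t p - lagrange c lam U₀ X β t₀ p‖ₑ
        ≤ C * ENNReal.ofReal |t - t₀| := by
      rcases le_total t t₀ with h1 | h1
      · simp only [enorm_sub_rev (lagrange c lam U₀ X β t _)]
        rw [abs_sub_comm, abs_of_nonneg (by linarith)]
        exact hC t t₀ ht h1 (by linarith)
      · rw [abs_of_nonneg (by linarith)]
        exact hC t₀ t ht₀ h1 ht1
    have mm : ∀ s, Measurable (lagrange c lam U₀ X β s) := fun s =>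
      (measurable_lagrange_uncurry (lam := lam) hc h.meas_init h.meas_source h.meas_cross).comp
        measurable_prodMk_left
    have ms := measurable_shift hc
    calc ∫⁻ p, ‖mild c lam U₀ X β t p - mild c lam U₀ X β t₀ p‖ₑ
        ≤ ∫⁻ p, (‖e t‖ₑ * ‖lagrange c lam U₀ X β t (shift c (-t) p)
            - lagrange c lam U₀ X β t₀ (shift c (-t) p)‖ₑ
          + (‖e t - e t₀‖ₑ * ‖lagrange c lam U₀ X β t₀ (shift c (-t) p)‖ₑ
          + ‖e t₀‖ₑ * ‖lagrange c lam U₀ X β t₀ (shift c (-t) p)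
            - lagrange c lam U₀ X β t₀ (shift c (-t₀) p)‖ₑ)) := by
          refine lintegral_mono fun p => ?_
          simp only [← enorm_mul]
          refine le_trans (le_of_eq ?_) ((enorm_add_le _ _).trans
            (add_le_add_right (enorm_add_le _ _) _))
          congr 1
          simp only [mild, e]; ring
      _ = ‖e t‖ₑ * (∫⁻ p, ‖lagrange c lam U₀ X β t p - lagrange c lam U₀ X β t₀ p‖ₑ)
          + (‖e t - e t₀‖ₑ * (∫⁻ p, ‖lagrange c lam U₀ X β t₀ p‖ₑ)
          + ‖e t₀‖ₑ * ∫⁻ p, ‖lagrange c lam U₀ X β t₀ (shift c (-t) p)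
            - lagrange c lam U₀ X β t₀ (shift c (-t₀) p)‖ₑ) := by
          have m1 := ((mm t).sub (mm t₀)).comp (ms (-t))
          have m2 := (mm t₀).comp (ms (-t))
          have m3 := (mm t₀).comp (ms (-t₀))
          simp only [Function.comp_def, Pi.sub_apply] at m1 m2 m3
          rw [lintegral_add_left (by fun_prop), lintegral_add_left (by fun_prop),
            lintegral_const_mul _ (by fun_prop), lintegral_const_mul _ (by fun_prop),
            lintegral_const_mul _ (by fun_prop),
            lintegral_comp_shift hc (-t) fun p =>
              ‖lagrange c lam U₀ X β t p - lagrange c lam U₀ X β t₀ p‖ₑ,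
            lintegral_comp_shift hc (-t) fun p => ‖lagrange c lam U₀ X β t₀ p‖ₑ]
      _ ≤ _ := by gcongr

/-- The balance law for the moments `∫∫ κ(ξ) U(t, x, ξ) dx dξ` of an undamped mild solution. -/
theorem integral_mul_mild (hc : Measurable c) {U₀ : ℝ × ℝ → ℝ} {X : ℝ × ℝ × ℝ → ℝ}
    {β : ℝ × ℝ → ℝ} (h : IsData c U₀ X β) {κ : ℝ → ℝ} (hκ : Measurable κ) {Cκ : ℝ}
    (bκ : ∀ ξ, |κ ξ| ≤ Cκ) (t : ℝ) :
    ∫ p : ℝ × ℝ, κ p.2 * mild c 0 U₀ X β t p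
      = (∫ p : ℝ × ℝ, κ p.2 * U₀ p) + (∫ s in Ioo 0 t, ∫ p : ℝ × ℝ, κ p.2 * X (s, p))
        + ∫ s in Ioo 0 t, ∫ ξ, κ ξ * (c ξ * β (s, ξ)) := by
  obtain ⟨C, hC⟩ := h.mass t
  have finX : ∫⁻ s in Ioo 0 t, ∫⁻ p, ‖X (s, p)‖ₑ < ∞ := by
    refine (setLIntegral_mono measurable_const fun s hs =>
      (le_self_add.trans (hC s hs))).trans_lt ?_
    rw [setLIntegral_const]
    exact ENNReal.mul_lt_top (by simp) (by simp)
  have finβ : ∫⁻ s in Ioo 0 t, crossFlux c β s < ∞ := by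
    refine (setLIntegral_mono measurable_const fun s hs =>
      (le_add_self.trans (hC s hs))).trans_lt ?_
    rw [setLIntegral_const]
    exact ENNReal.mul_lt_top (by simp) (by simp)
  have iU : Integrable U₀ := ⟨h.meas_init.aestronglyMeasurable, h.int_init⟩
  have iS : Integrable (sourceTerm c 0 X (Ioo 0 t)) :=
    ⟨(measurable_sourceTerm hc h.meas_source _).aestronglyMeasurable,
      (lintegral_sourceTerm_le hc h.meas_source _).trans_lt (by simpa using finX)⟩
  have iC : Integrable (crossTerm c 0 β (Ioo 0 t)) :=
    ⟨(measurable_crossTerm hc h.meas_cross measurableSet_Ioo).aestronglyMeasurable, by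
      rw [HasFiniteIntegral, lintegral_crossTerm hc h.meas_cross measurableSet_Ioo]
      simpa using finβ⟩
  have mulκ : ∀ {V : ℝ × ℝ → ℝ}, Integrable V → Integrable fun p : ℝ × ℝ => κ p.2 * V p :=
    fun hV => hV.bdd_mul (c := Cκ) (hκ.comp measurable_snd).aestronglyMeasurable
      (Eventually.of_forall fun p => bκ _)
  have e0 : ∫ p : ℝ × ℝ, κ p.2 * mild c 0 U₀ X β t p
      = ∫ p : ℝ × ℝ, κ p.2 * lagrange c 0 U₀ X β t p := by
    rw [← integral_comp_shift hc t]
    simp [mild, shift]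
  -- `κ` depends on `ξ` only and is constant along the characteristics
  have e1 : ∫ p : ℝ × ℝ, κ p.2 * sourceTerm c 0 X (Ioo 0 t) p
      = ∫ s in Ioo 0 t, ∫ p : ℝ × ℝ, κ p.2 * X (s, p) := by
    have m2 : Measurable fun z : (ℝ × ℝ) × ℝ => (z.2, shift c z.2 z.1) :=
      measurable_snd.prodMk ((measurable_shift_uncurry hc).comp
        (measurable_snd.prodMk measurable_fst))
    have m3 : Measurable fun z : (ℝ × ℝ) × ℝ => κ z.1.2 * X (z.2, shift c z.2 z.1) :=
      (hκ.comp (by fun_prop)).mul (h.meas_source.comp m2)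
    have hint : Integrable (Function.uncurry fun (p : ℝ × ℝ) (s : ℝ) =>
        κ p.2 * X (s, shift c s p)) (volume.prod (volume.restrict (Ioo 0 t))) := by
      refine Integrable.bdd_mul (c := Cκ) ⟨(h.meas_source.comp m2).aestronglyMeasurable, ?_⟩
        (hκ.comp (by fun_prop : Measurable fun z : (ℝ × ℝ) × ℝ => z.1.2)).aestronglyMeasurable
        (Eventually.of_forall fun p => bκ _)
      have m4 : Measurable fun z : (ℝ × ℝ) × ℝ => ‖X (z.2, shift c z.2 z.1)‖ₑ :=
        (h.meas_source.comp m2).enorm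
      rw [HasFiniteIntegral, lintegral_prod_symm _ m4.aemeasurable]
      refine lt_of_eq_of_lt (lintegral_congr fun s => ?_) finX
      exact lintegral_comp_shift hc s fun p => ‖X (s, p)‖ₑ
    calc ∫ p : ℝ × ℝ, κ p.2 * sourceTerm c 0 X (Ioo 0 t) p
        = ∫ p : ℝ × ℝ, ∫ s in Ioo 0 t, κ p.2 * X (s, shift c s p) := by
          simp [sourceTerm, integral_const_mul]
      _ = ∫ s in Ioo 0 t, ∫ p : ℝ × ℝ, κ p.2 * X (s, shift c s p) := integral_integral_swap hint
      _ = _ := by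
          refine integral_congr_ae (Eventually.of_forall fun s => ?_)
          exact integral_comp_shift hc s fun p => κ p.2 * X (s, p)
  have e2 : ∫ p : ℝ × ℝ, κ p.2 * crossTerm c 0 β (Ioo 0 t) p
      = ∫ s in Ioo 0 t, ∫ ξ, κ ξ * (c ξ * β (s, ξ)) := by
    let G : ℝ × ℝ → ℝ := fun q => (Ioo 0 t).indicator
      (fun s => κ q.2 * (((SignType.sign (c q.2) : SignType) : ℝ) * β (s, q.2))) q.1
    have mG : Measurable G := by
      have h1 : Measurable fun q : ℝ × ℝ =>
          κ q.2 * (((SignType.sign (c q.2) : SignType) : ℝ) * β (q.1, q.2)) :=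
        (hκ.comp measurable_snd).mul
          ((measurable_signType_coe.comp (hc.comp measurable_snd)).mul h.meas_cross)
      exact h1.indicator (measurable_fst measurableSet_Ioo)
    have e4 := integral_crossTime hc mG (fun ξ h => by simp [G])
    have e3 : ∀ p : ℝ × ℝ, κ p.2 * crossTerm c 0 β (Ioo 0 t) p = G (crossTime c p, p.2) := by
      intro p
      by_cases hp : crossTime c p ∈ Ioo 0 t <;>
        simp only [crossTerm, G, indicator, hp, if_true, if_false, zero_mul, Real.exp_zero,
          mul_one, mul_zero]
    have e5 : ∀ q : ℝ × ℝ, |c q.2| * G q = (Ioo 0 t ×ˢ univ).indicator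
        (fun q => κ q.2 * (c q.2 * β q)) q := fun q => by
      have : |c q.2| * ((SignType.sign (c q.2) : SignType) : ℝ) = c q.2 := abs_mul_sign _
      by_cases h : q.1 ∈ Ioo 0 t
      · simp only [G, indicator, h, if_true, mem_prod, mem_univ, and_true]
        linear_combination (κ q.2 * β q) * this
      · simp only [G, indicator, h, if_false, mul_zero, mem_prod, false_and]
    simp only [e3]
    rw [e4]
    simp only [e5]
    rw [integral_indicator (measurableSet_Ioo.prod MeasurableSet.univ),
      Measure.volume_eq_prod, setIntegral_prod]
    · simp
    · rw [IntegrableOn, ← Measure.prod_restrict, Measure.restrict_univ]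
      refine Integrable.bdd_mul (c := Cκ) ⟨?_, ?_⟩
        (hκ.comp measurable_snd).aestronglyMeasurable (Eventually.of_forall fun p => bκ _)
      · exact ((hc.comp measurable_snd).mul h.meas_cross).aestronglyMeasurable
      · have mm : Measurable fun q : ℝ × ℝ => ‖c q.2 * β q‖ₑ :=
          ((hc.comp measurable_snd).mul h.meas_cross).enorm
        rw [HasFiniteIntegral, lintegral_prod _ mm.aemeasurable]
        exact finβ
  rw [e0]
  simp only [lagrange, mul_add]
  have h1 := integral_add ((mulκ iU).add (mulκ iS)) (mulκ iC)
  have h2 := integral_add (mulκ iU) (mulκ iS)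
  simp only [Pi.add_apply] at h1 h2
  rw [h1, h2, e1, e2]

/-! ### Uniqueness of weak solutions -/

/-- A continuous function on `[0, ∞)` whose weak derivative on `(0, ∞)` vanishes is constant. -/
lemma eqOn_const_of_integral_deriv_mul_eq_zero {H : ℝ → ℝ} (hH : ContinuousOn H (Ici 0))
    (h : ∀ α : ℝ → ℝ, ContDiff ℝ (⊤ : ℕ∞) α → HasCompactSupport α → tsupport α ⊆ Ioi 0 →
      ∫ t in Ioi (0 : ℝ), deriv α t * H t = 0) : ∀ t, 0 ≤ t → H t = H 0 := by
  have hH' : ContinuousOn H (Ioi 0) := hH.mono Ioi_subset_Ici_self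
  -- a bump function on `(0, ∞)` with integral one; `C` will be the constant value of `H`
  let b : ContDiffBump (2 : ℝ) := ⟨1 / 2, 1, by norm_num, by norm_num⟩
  let b0 : ℝ → ℝ := b.normed volume
  have b0c : ContDiff ℝ (⊤ : ℕ∞) b0 := b.contDiff_normed
  have b0s : HasCompactSupport b0 := b.hasCompactSupport_normed
  have b0t : tsupport b0 ⊆ Ioi 0 := by
    rw [b.tsupport_normed_eq]
    intro x hx
    rw [Metric.mem_closedBall, Real.dist_eq, abs_le] at hx
    change 0 < x
    have : b.rOut = 1 := rfl
    linarith [hx.1]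
  have b0i : ∫ x, b0 x = 1 := b.integral_normed
  let C := ∫ t in Ioi (0 : ℝ), b0 t * H t
  have intg : ∀ g : ℝ → ℝ, Continuous g → HasCompactSupport g → tsupport g ⊆ Ioi 0 →
      IntegrableOn (fun t => g t * H t) (Ioi 0) := by
    intro g gc gs gt
    have : ContinuousOn (fun t => g t * H t) (tsupport g) := gc.continuousOn.mul (hH'.mono gt)
    have hi := this.integrableOn_compact (μ := volume) gs.isCompact
    rw [integrableOn_iff_integrable_of_support_subset] at hi
    · exact hi.integrableOn
    · intro x hx
      exact subset_tsupport _ fun h0 => hx (by simp [h0])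
  have key : ∀ g : ℝ → ℝ, ContDiff ℝ (⊤ : ℕ∞) g → HasCompactSupport g → tsupport g ⊆ Ioi 0 →
      ∫ x, g x • (H x - C) ∂(volume.restrict (Ioi 0)) = 0 := by
    intro g gc gs gt
    -- `g - I b0` has integral zero and is therefore the derivative of a test function `α`
    let I := ∫ x, g x
    let d : ℝ → ℝ := fun x => g x - I * b0 x
    have dc : ContDiff ℝ (⊤ : ℕ∞) d := gc.sub (contDiff_const.mul b0c)
    have ds : HasCompactSupport d := gs.sub (b0s.mul_left)
    have di : Integrable d := dc.continuous.integrable_of_hasCompactSupport ds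
    have dI : ∫ x, d x = 0 := by
      simp only [d]
      rw [integral_sub (gc.continuous.integrable_of_hasCompactSupport gs)
        ((b0c.continuous.integrable_of_hasCompactSupport b0s).const_mul I), integral_const_mul, b0i]
      simp [I]
    have dt : tsupport d ⊆ Ioi 0 := by
      refine (tsupport_sub _ _).trans (union_subset gt ?_)
      exact (tsupport_mul_subset_right).trans b0t
    let α : ℝ → ℝ := fun x => ∫ t in Iic x, d t
    have αd : ∀ x, HasDerivAt α (d x) x := fun x => by
      have h1 : ∀ y, α y = (∫ t in Iic (0 : ℝ), d t) + ∫ t in (0 : ℝ)..y, d t := fun y => by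
        rw [← intervalIntegral.integral_Iic_sub_Iic di.integrableOn di.integrableOn]; simp [α]
      rw [show α = fun y => (∫ t in Iic (0 : ℝ), d t) + ∫ t in (0 : ℝ)..y, d t from funext h1]
      exact (intervalIntegral.integral_hasDerivAt_right di.intervalIntegrable
        (dc.continuous.stronglyMeasurableAtFilter _ _) dc.continuous.continuousAt).const_add _
    have αderiv : deriv α = d := funext fun x => (αd x).deriv
    have αc : ContDiff ℝ (⊤ : ℕ∞) α := by
      rw [contDiff_infty_iff_deriv]
      exact ⟨fun x => (αd x).differentiableAt, by rw [αderiv]; exact dc⟩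
    -- the support of `α` lies between the bounds of the support of `d`
    obtain ⟨lo, hi, hlo, hd⟩ : ∃ lo hi : ℝ, 0 < lo ∧ ∀ x, d x ≠ 0 → x ∈ Icc lo hi := by
      rcases (tsupport d).eq_empty_or_nonempty with he | hne
      · refine ⟨1, 0, one_pos, fun x hx => ?_⟩
        have := subset_tsupport d hx
        rw [he] at this; exact this.elim
      · obtain ⟨lo, hlo, hl⟩ := ds.isCompact.exists_isLeast hne
        obtain ⟨hi, -, hh⟩ := ds.isCompact.exists_isGreatest hne
        exact ⟨lo, hi, dt hlo, fun x hx => ⟨hl (subset_tsupport _ hx), hh (subset_tsupport _ hx)⟩⟩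
    have αz : ∀ x, x ∉ Icc lo hi → α x = 0 := by
      intro x hx
      by_cases hxl : x < lo
      · refine setIntegral_eq_zero_of_forall_eq_zero fun t ht => ?_
        by_contra hne
        exact absurd ((hd t hne).1.trans ht) (not_le.2 hxl)
      · have hxh : hi < x := by
          by_contra hcon; exact hx ⟨not_lt.1 hxl, not_lt.1 hcon⟩
        simp only [α]
        rw [setIntegral_eq_integral_of_forall_compl_eq_zero, dI]
        intro t ht
        by_contra hne
        exact ht ((hd t hne).2.trans hxh.le)
    have αt : tsupport α ⊆ Icc lo hi :=
      closure_minimal (fun x hx => by_contra fun hcon => hx (αz x hcon)) isClosed_Icc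
    have hα := h α αc (HasCompactSupport.intro isCompact_Icc αz)
      (αt.trans fun x hx => hlo.trans_le hx.1)
    rw [αderiv] at hα
    have i1 := intg g gc.continuous gs gt
    have i2 := intg b0 b0c.continuous b0s b0t
    have e1 : ∫ t in Ioi (0 : ℝ), d t * H t = (∫ t in Ioi (0 : ℝ), g t * H t) - I * C := by
      simp only [d, sub_mul, mul_assoc]
      rw [integral_sub i1 (i2.const_mul I), integral_const_mul]
    have e2 : ∫ t in Ioi (0 : ℝ), g t = I := by
      refine setIntegral_eq_integral_of_forall_compl_eq_zero fun x hx => ?_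
      exact image_eq_zero_of_notMem_tsupport fun hx' => hx (gt hx')
    simp only [smul_eq_mul, mul_sub]
    rw [integral_sub i1 ((gc.continuous.integrable_of_hasCompactSupport gs).mul_const C).restrict,
      integral_mul_const, e2]
    linarith
  have hae : ∀ᵐ x ∂(volume.restrict (Ioi (0 : ℝ))), x ∈ Ioi (0 : ℝ) → H x - C = 0 := by
    have := IsOpen.ae_eq_zero_of_integral_contDiff_smul_eq_zero (U := Ioi (0 : ℝ))
      (f := fun x => H x - C) (μ := volume.restrict (Ioi 0)) isOpen_Ioi ?_ key
    · exact this
    · exact (hH'.sub continuousOn_const).locallyIntegrableOn measurableSet_Ioi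
  have hae2 : H =ᵐ[volume.restrict (Ioi (0 : ℝ))] fun _ => C := by
    filter_upwards [hae, ae_restrict_mem measurableSet_Ioi] with x h1 h2
    linarith [h1 h2]
  have heq : EqOn H (fun _ => C) (Ioi 0) :=
    Measure.eqOn_open_of_ae_eq hae2 isOpen_Ioi hH' continuousOn_const
  have heq' : EqOn H (fun _ => C) (Ici 0) := by
    refine heq.of_subset_closure hH continuousOn_const Ioi_subset_Ici_self ?_
    rw [closure_Ioi]
  intro t ht
  rw [heq' ht, heq' self_mem_Ici]

/-- A bounded measurable function is the almost everywhere limit of smooth functions with the same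
bound. -/
lemma exists_contDiff_tendsto_ae (hc : Measurable c) {L : ℝ} (hL : ∀ ξ, |c ξ| ≤ L) :
    ∃ u : ℕ → ℝ → ℝ, (∀ k, ContDiff ℝ (⊤ : ℕ∞) (u k)) ∧ (∀ k ξ, |u k ξ| ≤ L) ∧
      ∀ᵐ ξ, Tendsto (fun k => u k ξ) atTop (𝓝 (c ξ)) := by
  let b : ℕ → ContDiffBump (0 : ℝ) := fun k =>
    ⟨1 / (2 * ((k : ℝ) + 1)), 1 / ((k : ℝ) + 1), by positivity, by
      apply one_div_lt_one_div_of_lt <;> [positivity; linarith [(Nat.cast_nonneg k : (0:ℝ) ≤ k)]]⟩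
  have hloc : LocallyIntegrable c := by
    refine (locallyIntegrable_const L).mono hc.aestronglyMeasurable
      (Eventually.of_forall fun x => ?_)
    exact (hL x).trans (le_abs_self L)
  refine ⟨fun k => convolution ((b k).normed volume) c (ContinuousLinearMap.lsmul ℝ ℝ) volume,
    fun k => ?_, fun k ξ => ?_, ?_⟩
  · exact (b k).hasCompactSupport_normed.contDiff_convolution_left _ (b k).contDiff_normed hloc
  · simp only [convolution, ContinuousLinearMap.lsmul_apply, smul_eq_mul]
    rw [← Real.norm_eq_abs]
    refine (norm_integral_le_integral_norm _).trans ?_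
    calc ∫ t, ‖(b k).normed volume t * c (ξ - t)‖ ≤ ∫ t, (b k).normed volume t * L := by
          refine integral_mono_of_nonneg (Eventually.of_forall fun t => norm_nonneg _)
            ((b k).integrable_normed.mul_const L) (Eventually.of_forall fun t => ?_)
          dsimp only
          rw [norm_mul, Real.norm_of_nonneg ((b k).nonneg_normed t)]
          exact mul_le_mul_of_nonneg_left (hL _) ((b k).nonneg_normed t)
      _ = L := by rw [integral_mul_const, (b k).integral_normed, one_mul]
  · refine ContDiffBump.ae_convolution_tendsto_right_of_locallyIntegrable (K := 2) ?_ ?_ hloc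
    · exact tendsto_one_div_add_atTop_nhds_zero_nat
    · refine Eventually.of_forall fun k => le_of_eq ?_
      simp only [b]; field_simp

/-- For the test function `e^{lam t} α(t) ψ(x - t u(ξ), ξ)`, which moves with the velocity `u`
instead of `c`, the transport operator produces an error term proportional to `c - u`. -/
lemma transportOp_moving (ψ : ℝ × ℝ → ℝ) (hψ : ContDiff ℝ (⊤ : ℕ∞) ψ) (α : ℝ → ℝ)
    (hα : ContDiff ℝ (⊤ : ℕ∞) α) (u : ℝ → ℝ) (hu : ContDiff ℝ (⊤ : ℕ∞) u) (q : ℝ × ℝ × ℝ) :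
    transportOp c lam (fun q : ℝ × ℝ × ℝ => Real.exp (lam * q.1) * α q.1
        * ψ (shift u (-q.1) q.2)) q
      = Real.exp (lam * q.1) * (deriv α q.1 * ψ (shift u (-q.1) q.2)
        + α q.1 * ((c q.2.2 - u q.2.2) * fderiv ℝ ψ (shift u (-q.1) q.2) (1, 0))) := by
  obtain ⟨t, x, ξ⟩ := q
  let φ : ℝ × ℝ × ℝ → ℝ := fun q => Real.exp (lam * q.1) * α q.1 * ψ (shift u (-q.1) q.2)
  have hφ : ContDiff ℝ (⊤ : ℕ∞) φ := by
    have : ContDiff ℝ (⊤ : ℕ∞) fun q : ℝ × ℝ × ℝ => shift u (-q.1) q.2 := by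
      unfold shift; fun_prop
    exact ((by fun_prop : ContDiff ℝ (⊤ : ℕ∞) fun q : ℝ × ℝ × ℝ =>
      Real.exp (lam * q.1) * α q.1)).mul (hψ.comp this)
  have hline : HasDerivAt (fun s : ℝ => ((t + s, x + s * c ξ, ξ) : ℝ × ℝ × ℝ)) (1, c ξ, 0) 0 := by
    refine HasDerivAt.prodMk ?_ (HasDerivAt.prodMk ?_ (hasDerivAt_const _ _))
    · simpa using (hasDerivAt_id (0 : ℝ)).const_add t
    · simpa using ((hasDerivAt_id (0 : ℝ)).mul_const (c ξ)).const_add x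
  have d1 : HasDerivAt (fun s : ℝ => φ (t + s, x + s * c ξ, ξ))
      (fderiv ℝ φ (t, x, ξ) (1, c ξ, 0)) 0 := by
    have h := (hφ.differentiable (by simp)) (t + 0, x + 0 * c ξ, ξ)
    have h2 := h.hasFDerivAt.comp_hasDerivAt (0 : ℝ) hline
    simpa [Function.comp_def] using h2
  have d2 : HasDerivAt (fun s : ℝ => φ (t + s, x + s * c ξ, ξ))
      (Real.exp (lam * t) * lam * α t * ψ (x + -t * u ξ, ξ)
        + Real.exp (lam * t) * deriv α t * ψ (x + -t * u ξ, ξ)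
        + Real.exp (lam * t) * α t
          * ((c ξ - u ξ) * fderiv ℝ ψ (x + -t * u ξ, ξ) (1, 0))) 0 := by
    have e1 : HasDerivAt (fun s : ℝ => t + s) 1 0 := by
      simpa using (hasDerivAt_id (0 : ℝ)).const_add t
    have a1 : HasDerivAt (fun s : ℝ => Real.exp (lam * (t + s))) (Real.exp (lam * t) * lam) 0 := by
      simpa using (e1.const_mul lam).exp
    have a2 : HasDerivAt (fun s : ℝ => α (t + s)) (deriv α t) 0 := by
      have := ((hα.differentiable (by simp)) (t + 0)).hasDerivAt.comp (0 : ℝ) e1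
      simpa [Function.comp_def] using this
    have l2 : HasDerivAt (fun s : ℝ => ((x + s * c ξ + -(t + s) * u ξ, ξ) : ℝ × ℝ))
        ((c ξ - u ξ) • (1, 0)) 0 := by
      have : ((c ξ - u ξ) • ((1, 0) : ℝ × ℝ)) = (c ξ - u ξ, 0) := by simp
      rw [this]
      refine HasDerivAt.prodMk ?_ (hasDerivAt_const _ _)
      have f1 : HasDerivAt (fun s : ℝ => x + s * c ξ) (c ξ) 0 := by
        simpa using ((hasDerivAt_id (0 : ℝ)).mul_const (c ξ)).const_add x
      have f2 : HasDerivAt (fun s : ℝ => -(t + s) * u ξ) (-u ξ) 0 := by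
        simpa using (e1.neg).mul_const (u ξ)
      exact (f1.fun_add f2).congr_deriv (by ring)
    have a3 : HasDerivAt (fun s : ℝ => ψ (x + s * c ξ + -(t + s) * u ξ, ξ))
        ((c ξ - u ξ) * fderiv ℝ ψ (x + -t * u ξ, ξ) (1, 0)) 0 := by
      have h := (hψ.differentiable (by simp)) (x + 0 * c ξ + -(t + 0) * u ξ, ξ)
      have h2 := h.hasFDerivAt.comp_hasDerivAt (0 : ℝ) l2
      rw [map_smul] at h2
      simpa [Function.comp_def] using h2
    have h := (a1.mul a2).mul a3
    simp only [add_zero, zero_mul, Pi.mul_apply] at h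
    refine h.congr_deriv ?_
    ring
  have := d1.unique d2
  change fderiv ℝ φ (t, x, ξ) (1, c ξ, 0) - lam * φ (t, x, ξ) = _
  rw [this]
  simp only [φ, shift]
  ring

lemma tendsto_integral_of_continuousInL1 {W : ℝ × ℝ × ℝ → ℝ} (cW : ContinuousInL1 W)
    {ψ : ℝ × ℝ → ℝ} (hψ : Continuous ψ) {M : ℝ} (hM : ∀ p, |ψ p| ≤ M) (hc : Measurable c) :
    ContinuousOn (fun t => ∫ p, W (t, p) * ψ (shift c (-t) p)) (Ici 0) := by
  intro t₀ ht₀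
  have mψ : ∀ t, AEStronglyMeasurable (fun p => ψ (shift c (-t) p)) volume := fun t =>
    (hψ.measurable.comp (measurable_shift hc (-t))).aestronglyMeasurable
  have iW : ∀ t, 0 ≤ t → ∀ s, Integrable fun p => W (t, p) * ψ (shift c (-s) p) := fun t ht s =>
    (cW.1 t ht).mul_bdd (c := M) (mψ s) (Eventually.of_forall fun p => hM _)
  have l1 : Tendsto (fun t => ∫ p, (W (t, p) - W (t₀, p)) * ψ (shift c (-t) p))
      (𝓝[Ici 0] t₀) (𝓝 0) := by
    rw [tendsto_zero_iff_enorm_tendsto_zero]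
    have h := ENNReal.Tendsto.mul_const (cW.2 t₀ ht₀) (b := ENNReal.ofReal M)
      (Or.inr (by simp))
    rw [zero_mul] at h
    refine tendsto_of_tendsto_of_tendsto_of_le_of_le tendsto_const_nhds h
      (fun _ => zero_le) fun t => ?_
    refine (enorm_integral_le_lintegral_enorm _).trans ?_
    rw [← lintegral_mul_const' _ _ (by simp)]
    refine lintegral_mono fun p => ?_
    rw [enorm_mul]
    gcongr
    rw [Real.enorm_eq_ofReal_abs]
    exact ENNReal.ofReal_le_ofReal (hM _)
  have l2 : Tendsto (fun t => ∫ p, W (t₀, p) * ψ (shift c (-t) p))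
      (𝓝[Ici 0] t₀) (𝓝 (∫ p, W (t₀, p) * ψ (shift c (-t₀) p))) := by
    refine tendsto_integral_filter_of_dominated_convergence (fun p => ‖W (t₀, p)‖ * M) ?_ ?_ ?_ ?_
    · exact Eventually.of_forall fun t => (iW t₀ ht₀ t).aestronglyMeasurable
    · refine Eventually.of_forall fun t => Eventually.of_forall fun p => ?_
      rw [norm_mul]
      exact mul_le_mul_of_nonneg_left (hM _) (norm_nonneg _)
    · exact (cW.1 t₀ ht₀).norm.mul_const M
    · refine Eventually.of_forall fun p => ?_
      have : Continuous fun t => W (t₀, p) * ψ (shift c (-t) p) := by unfold shift; fun_prop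
      exact (this.tendsto t₀).mono_left nhdsWithin_le_nhds
  have l3 := l1.add l2
  rw [zero_add] at l3
  refine l3.congr' ?_
  filter_upwards [self_mem_nhdsWithin] with t ht
  have i1 : Integrable fun p => (W (t, p) - W (t₀, p)) * ψ (shift c (-t) p) := by
    simp only [sub_mul]; exact (iW t ht t).sub (iW t₀ ht₀ t)
  rw [← integral_add i1 (iW t₀ ht₀ t)]
  refine integral_congr_ae (Eventually.of_forall fun p => ?_)
  ring

/-- A weak solution of the homogeneous transport equation on the whole line that depends
continuously on time in `L¹` and vanishes initially is zero. The test functions move with the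
smooth velocities of `exists_contDiff_tendsto_ae` instead of `c`, which need not be smooth. -/
theorem eq_zero_of_weak (hc : Measurable c) {L : ℝ} (hL : ∀ ξ, |c ξ| ≤ L)
    {W : ℝ × ℝ × ℝ → ℝ} (mW : Measurable W) (bW : ∀ T, ∃ C, ∀ q, |q.1| ≤ T → |W q| ≤ C)
    (cW : ContinuousInL1 W) (h0 : ∀ᵐ p, W (0, p) = 0)
    (hw : ∀ φ : ℝ × ℝ × ℝ → ℝ, ContDiff ℝ (⊤ : ℕ∞) φ → HasCompactSupport φ →
      tsupport φ ⊆ Ioi (0 : ℝ) ×ˢ univ →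
      ∫ t in Ioi (0 : ℝ), ∫ p, W (t, p) * transportOp c lam φ (t, p) = 0) :
    ∀ t, 0 ≤ t → ∀ᵐ p, W (t, p) = 0 := by
  have hL0 : 0 ≤ L := (abs_nonneg _).trans (hL 0)
  obtain ⟨u, uc, uL, ut⟩ := exists_contDiff_tendsto_ae hc hL
  -- the pairing with a test function transported along the characteristics is conserved
  have main : ∀ ψ : ℝ × ℝ → ℝ, ContDiff ℝ (⊤ : ℕ∞) ψ → HasCompactSupport ψ → ∀ t, 0 ≤ t →
      ∫ p, W (t, p) * ψ (shift c (-t) p) = 0 := by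
    intro ψ hψ sψ
    obtain ⟨M, hM⟩ := hψ.continuous.bounded_above_of_compact_support sψ
    have hψx : Continuous fun p => fderiv ℝ ψ p (1, 0) :=
      (hψ.continuous_fderiv (by simp)).clm_apply continuous_const
    obtain ⟨M', hM'⟩ := hψx.bounded_above_of_compact_support (sψ.fderiv_apply (𝕜 := ℝ) (1, 0))
    obtain ⟨Rψ, hRψ⟩ := sψ.isCompact.isBounded.subset_closedBall (0 : ℝ × ℝ)
    have hM0 : 0 ≤ M := (norm_nonneg _).trans (hM 0)
    have hM0' : 0 ≤ M' := (norm_nonneg _).trans (hM' 0)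
    -- the factor `exp (lam * t)` compensates the damping
    let H : ℝ → ℝ := fun t => Real.exp (lam * t) * ∫ p, W (t, p) * ψ (shift c (-t) p)
    have cH : ContinuousOn H (Ici 0) :=
      (by fun_prop : Continuous fun t => Real.exp (lam * t)).continuousOn.mul
        (tendsto_integral_of_continuousInL1 cW hψ.continuous hM hc)
    have hconst := eqOn_const_of_integral_deriv_mul_eq_zero cH (fun α hα sα tα => ?_)
    · have hH0 : H 0 = 0 := by
        simp only [H]
        rw [integral_eq_zero_of_ae, mul_zero]
        filter_upwards [h0] with p hp
        simp [hp]
      intro t ht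
      have := hconst t ht
      rw [hH0] at this
      exact (mul_eq_zero.1 this).resolve_left (Real.exp_pos _).ne'
    have dα : Continuous (deriv α) := hα.continuous_deriv (by simp)
    obtain ⟨A, hA⟩ := hα.continuous.bounded_above_of_compact_support sα
    obtain ⟨A', hA'⟩ := dα.bounded_above_of_compact_support sα.deriv
    obtain ⟨Rα, hRα⟩ := sα.isCompact.isBounded.subset_closedBall (0 : ℝ)
    have hA0 : 0 ≤ A := (norm_nonneg _).trans (hA 0)
    have hA0' : 0 ≤ A' := (norm_nonneg _).trans (hA' 0)
    let R := max (max Rψ Rα) 0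
    have hR0 : 0 ≤ R := le_max_right _ _
    have suppα : ∀ t, t ∈ tsupport α → |t| ≤ R := fun t ht => by
      have := hRα ht
      rw [mem_closedBall_zero_iff] at this
      exact this.trans ((le_max_right _ _).trans (le_max_left _ _))
    have suppψ : ∀ p, p ∈ tsupport ψ → |p.1| ≤ R ∧ |p.2| ≤ R := fun p hp => by
      have := hRψ hp
      rw [mem_closedBall_zero_iff, Prod.norm_def, max_le_iff] at this
      have hle : Rψ ≤ R := (le_max_left _ _).trans (le_max_left _ _)
      exact ⟨this.1.trans hle, this.2.trans hle⟩
    have hbox : ∀ v : ℝ → ℝ, (∀ ξ, |v ξ| ≤ L) → ∀ q : ℝ × ℝ × ℝ, q.1 ∈ tsupport α →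
        shift v (-q.1) q.2 ∈ tsupport ψ →
        |q.1| ≤ R + R * L ∧ |q.2.1| ≤ R + R * L ∧ |q.2.2| ≤ R + R * L := by
      intro v hv q h1 h2
      have hRL : 0 ≤ R * L := by positivity
      have h1' := suppα _ h1
      obtain ⟨h3, h4⟩ := suppψ _ h2
      dsimp only [shift] at h3 h4
      refine ⟨by linarith, ?_, by linarith⟩
      have e2 : |-q.1 * v q.2.2| ≤ R * L := by
        rw [abs_mul, abs_neg]; exact mul_le_mul h1' (hv _) (abs_nonneg _) hR0
      have e : q.2.1 = (q.2.1 + -q.1 * v q.2.2) - -q.1 * v q.2.2 := by ring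
      rw [e]
      exact (abs_sub _ _).trans (add_le_add h3 e2)
    obtain ⟨CW, hCW⟩ := bW R
    let φ : ℕ → ℝ × ℝ × ℝ → ℝ := fun k q =>
      Real.exp (lam * q.1) * α q.1 * ψ (shift (u k) (-q.1) q.2)
    have hφ : ∀ k, ContDiff ℝ (⊤ : ℕ∞) (φ k) := fun k => by
      have huk := uc k
      have : ContDiff ℝ (⊤ : ℕ∞) fun q : ℝ × ℝ × ℝ => shift (u k) (-q.1) q.2 := by
        unfold shift; fun_prop
      exact ((by fun_prop : ContDiff ℝ (⊤ : ℕ∞) fun q : ℝ × ℝ × ℝ =>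
        Real.exp (lam * q.1) * α q.1)).mul (hψ.comp this)
    have sφ : ∀ k, HasCompactSupport (φ k) := fun k => by
      refine HasCompactSupport.intro (K := Icc (-(R + R * L)) (R + R * L)
        ×ˢ Icc (-(R + R * L)) (R + R * L) ×ˢ Icc (-(R + R * L)) (R + R * L))
        (isCompact_Icc.prod (isCompact_Icc.prod isCompact_Icc)) fun q hq => ?_
      by_contra hne
      simp only [φ, mul_ne_zero_iff] at hne
      obtain ⟨b1, b2, b3⟩ := hbox (u k) (uL k) q (subset_tsupport _ hne.1.2)
        (subset_tsupport _ hne.2)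
      exact hq ⟨abs_le.1 b1, abs_le.1 b2, abs_le.1 b3⟩
    have tφ : ∀ k, tsupport (φ k) ⊆ Ioi (0 : ℝ) ×ˢ univ := fun k => by
      have : tsupport (φ k) ⊆ Prod.fst ⁻¹' tsupport α := by
        refine closure_minimal (fun q hq => ?_)
          ((isClosed_tsupport α).preimage continuous_fst)
        refine subset_tsupport _ fun h => hq ?_
        simp [φ, h]
      exact fun q hq => ⟨tα (this hq), mem_univ _⟩
    let E := Real.exp (|lam| * R)
    let F : ℕ → ℝ × ℝ × ℝ → ℝ := fun k q => W q * transportOp c lam (φ k) q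
    let B : ℝ := CW * (E * (A' * M + A * ((L + L) * M')))
    let G : ℝ × ℝ × ℝ → ℝ := fun q =>
      W q * (Real.exp (lam * q.1) * (deriv α q.1 * ψ (shift c (-q.1) q.2)))
    have hop : ∀ k q, transportOp c lam (φ k) q = Real.exp (lam * q.1)
        * (deriv α q.1 * ψ (shift (u k) (-q.1) q.2) + α q.1 * ((c q.2.2 - u k q.2.2)
          * fderiv ℝ ψ (shift (u k) (-q.1) q.2) (1, 0))) := fun k q =>
      transportOp_moving ψ hψ α hα (u k) (uc k) q
    have hop0 : ∀ k q, transportOp c lam (φ k) q ≠ 0 →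
        q.1 ∈ tsupport α ∧ shift (u k) (-q.1) q.2 ∈ tsupport ψ := by
      intro k q hne
      rw [hop] at hne
      constructor
      · by_contra hcon
        have z1 : α q.1 = 0 := image_eq_zero_of_notMem_tsupport hcon
        have z2 : deriv α q.1 = 0 := by
          by_contra h2; exact hcon (support_deriv_subset h2)
        simp [z1, z2] at hne
      · by_contra hcon
        have z1 : ψ (shift (u k) (-q.1) q.2) = 0 := image_eq_zero_of_notMem_tsupport hcon
        have z2 : fderiv ℝ ψ (shift (u k) (-q.1) q.2) = 0 := by
          by_contra h2; exact hcon (support_fderiv_subset ℝ h2)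
        simp [z1, z2] at hne
    have hbd : ∀ k q, |F k q| ≤ B := by
      intro k q
      by_cases hz : transportOp c lam (φ k) q = 0
      · simp only [F, hz, mul_zero, abs_zero, B]
        have : 0 ≤ CW := (abs_nonneg _).trans (hCW 0 (by simpa using hR0))
        positivity
      · have ht := suppα _ (hop0 k q hz).1
        have hCq := hCW q ht
        simp only [F, B, abs_mul]
        refine mul_le_mul hCq ?_ (abs_nonneg _) ((abs_nonneg _).trans hCq)
        rw [hop, abs_mul, Real.abs_exp]
        refine mul_le_mul ?_ ?_ (abs_nonneg _) (Real.exp_pos _).le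
        · refine Real.exp_le_exp.2 ((le_abs_self _).trans ?_)
          rw [abs_mul]; gcongr
        · refine (abs_add_le _ _).trans (add_le_add ?_ ?_)
          · rw [abs_mul]; exact mul_le_mul (hA' _) (hM _) (abs_nonneg _) hA0'
          · rw [abs_mul, abs_mul]
            refine mul_le_mul (hA _) (mul_le_mul ?_ (hM' _) (abs_nonneg _) (by positivity))
              (by positivity) hA0
            exact (abs_sub _ _).trans (add_le_add (hL _) (uL k _))
    have hboxF : ∀ k q, F k q ≠ 0 → |q.1| ≤ R + R * L ∧ |q.2.1| ≤ R + R * L ∧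
        |q.2.2| ≤ R + R * L := by
      intro k q hne
      have hne' : transportOp c lam (φ k) q ≠ 0 := fun h => hne (by simp [F, h])
      obtain ⟨h1, h2⟩ := hop0 k q hne'
      exact hbox (u k) (uL k) q h1 h2
    have mF : ∀ k, Measurable (F k) := fun k =>
      mW.mul (measurable_transportOp hc ((hφ k).of_le (by simp)))
    have iF : ∀ k, Integrable (F k) := fun k =>
      integrable_of_bounded_of_box (mF k) (hbd k) (hboxF k)
    have hF0 : ∀ k, ∫ q in Ioi (0 : ℝ) ×ˢ univ, F k q = 0 := fun k => by
      rw [Measure.volume_eq_prod, setIntegral_prod _ (iF k).integrableOn]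
      simpa using hw (φ k) (hφ k) (sφ k) (tφ k)
    let Box : Set (ℝ × ℝ × ℝ) := Icc (-(R + R * L)) (R + R * L)
        ×ˢ Icc (-(R + R * L)) (R + R * L) ×ˢ Icc (-(R + R * L)) (R + R * L)
    have cBox : IsCompact Box := isCompact_Icc.prod (isCompact_Icc.prod isCompact_Icc)
    -- the error terms of `transportOp_moving` vanish in the limit of the smooth velocities
    have hlim_ae : ∀ᵐ q : ℝ × ℝ × ℝ, Tendsto (fun k => F k q) atTop (𝓝 (G q)) := by
      have hq : ∀ᵐ q : ℝ × ℝ × ℝ, Tendsto (fun k => u k q.2.2) atTop (𝓝 (c q.2.2)) := by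
        have e1 : Measure.QuasiMeasurePreserving (Prod.snd : ℝ × ℝ × ℝ → ℝ × ℝ) volume volume :=
          Measure.quasiMeasurePreserving_snd
        have e2 : Measure.QuasiMeasurePreserving (Prod.snd : ℝ × ℝ → ℝ) volume volume :=
          Measure.quasiMeasurePreserving_snd
        exact (e2.comp e1).ae ut
      filter_upwards [hq] with q hq
      have hsh : Tendsto (fun k => shift (u k) (-q.1) q.2) atTop (𝓝 (shift c (-q.1) q.2)) := by
        unfold shift
        exact (tendsto_const_nhds.add (tendsto_const_nhds.mul hq)).prodMk_nhds tendsto_const_nhds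
      have t1 := (hψ.continuous.tendsto _).comp hsh
      have t2 := (hψx.tendsto _).comp hsh
      have t3 : Tendsto (fun k => c q.2.2 - u k q.2.2) atTop (𝓝 0) := by
        simpa using (tendsto_const_nhds (x := c q.2.2)).sub hq
      have t4 := ((((t1.const_mul (deriv α q.1)).add ((t3.mul t2).const_mul (α q.1))).const_mul
        (Real.exp (lam * q.1))).const_mul (W q))
      simp only [zero_mul, mul_zero, add_zero] at t4
      refine t4.congr fun k => ?_
      simp only [F, hop, Function.comp_apply]
    have hlim : Tendsto (fun k => ∫ q in Ioi (0 : ℝ) ×ˢ univ, F k q) atTop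
        (𝓝 (∫ q in Ioi (0 : ℝ) ×ˢ univ, G q)) := by
      refine tendsto_integral_of_dominated_convergence (Box.indicator fun _ => B)
        (fun k => (mF k).aestronglyMeasurable) ?_ (fun k => Eventually.of_forall fun q => ?_)
        (ae_restrict_of_ae hlim_ae)
      · refine Integrable.restrict ?_
        rw [integrable_indicator_iff cBox.measurableSet]
        exact integrableOn_const cBox.measure_lt_top.ne
      · by_cases hz : F k q = 0
        · rw [hz, norm_zero]
          refine indicator_nonneg (fun _ _ => (abs_nonneg _).trans (hbd k q)) _
        · obtain ⟨b1, b2, b3⟩ := hboxF k q hz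
          rw [indicator_of_mem (show q ∈ Box from ⟨abs_le.1 b1, abs_le.1 b2, abs_le.1 b3⟩)]
          exact hbd k q
    simp only [hF0] at hlim
    have hG0 : ∫ q in Ioi (0 : ℝ) ×ˢ univ, G q = 0 := tendsto_nhds_unique hlim tendsto_const_nhds
    have iG : Integrable G := by
      have mG : Measurable G := by
        have msh : Measurable fun q : ℝ × ℝ × ℝ => shift c (-q.1) q.2 := by unfold shift; fun_prop
        exact mW.mul ((by fun_prop : Measurable fun q : ℝ × ℝ × ℝ => Real.exp (lam * q.1)).mul
          ((dα.measurable.comp measurable_fst).mul (hψ.continuous.measurable.comp msh)))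
      have hi : Integrable (Box.indicator fun _ => B) := by
        rw [integrable_indicator_iff cBox.measurableSet]
        exact integrableOn_const cBox.measure_lt_top.ne
      refine hi.mono' mG.aestronglyMeasurable ?_
      filter_upwards [hlim_ae] with q hq
      refine le_of_tendsto hq.norm (Eventually.of_forall fun k => ?_)
      by_cases hz : F k q = 0
      · rw [hz, norm_zero]
        refine indicator_nonneg (fun _ _ => (abs_nonneg _).trans (hbd k q)) _
      · obtain ⟨b1, b2, b3⟩ := hboxF k q hz
        rw [indicator_of_mem (show q ∈ Box from ⟨abs_le.1 b1, abs_le.1 b2, abs_le.1 b3⟩)]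
        exact hbd k q
    rw [Measure.volume_eq_prod, setIntegral_prod _ iG.integrableOn] at hG0
    refine Eq.trans ?_ hG0
    refine integral_congr_ae (Eventually.of_forall fun t => ?_)
    simp only [H, G, Measure.restrict_univ]
    rw [← integral_const_mul, ← integral_const_mul]
    refine integral_congr_ae (Eventually.of_forall fun p => ?_)
    ring
  intro t ht
  have iV : Integrable fun p => W (t, shift c t p) :=
    ((measurePreserving_shift hc t).integrable_comp_emb (measurableEmbedding_shift hc t)).2
      (cW.1 t ht)
  -- in Lagrangian coordinates the test functions are arbitrary
  have hz : ∀ᵐ p, W (t, shift c t p) = 0 := by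
    refine ae_eq_zero_of_integral_contDiff_smul_eq_zero iV.locallyIntegrable fun ψ hψ sψ => ?_
    rw [← main ψ hψ sψ t ht,
      ← integral_comp_shift hc t fun p => W (t, p) * ψ (shift c (-t) p)]
    refine integral_congr_ae (Eventually.of_forall fun p => ?_)
    simp only [shift_neg_shift, smul_eq_mul]
    ring
  have := (measurePreserving_shift hc (-t)).quasiMeasurePreserving.ae hz
  filter_upwards [this] with p hp
  rwa [shift_shift_neg] at hp

lemma abs_mild_le {U₀ : ℝ × ℝ → ℝ} {X : ℝ × ℝ × ℝ → ℝ} {β : ℝ × ℝ → ℝ} (h : IsData c U₀ X β)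
    (T : ℝ) : ∃ C, ∀ q : ℝ × ℝ × ℝ, |q.1| ≤ T → |mild c lam U₀ X β q.1 q.2| ≤ C := by
  obtain ⟨CU, bU⟩ := h.bdd_init
  obtain ⟨CX, bX⟩ := h.bdd_source
  obtain ⟨Cβ, bβ⟩ := h.bdd_cross
  refine ⟨Real.exp (|lam| * T) * (CU + Real.exp (|lam| * T) * CX * T + Real.exp (|lam| * T) * Cβ),
    fun q hq => ?_⟩
  rw [mild, abs_mul, Real.abs_exp]
  refine mul_le_mul (Real.exp_le_exp.2 ((neg_le_abs _).trans ?_))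
    (abs_lagrange_le bU bX bβ hq _) (abs_nonneg _) (Real.exp_pos _).le
  rw [abs_mul]; gcongr

/-- Every weak solution that depends continuously on time in `L¹` is the mild solution. -/
theorem ae_eq_mild_of_weak (hc : Measurable c) {L : ℝ} (hL : ∀ ξ, |c ξ| ≤ L)
    {U : ℝ × ℝ × ℝ → ℝ} (mU : Measurable U) (bU : ∀ T, ∃ C, ∀ q, |q.1| ≤ T → |U q| ≤ C)
    (cU : ContinuousInL1 U) {X : ℝ × ℝ × ℝ → ℝ} {β : ℝ × ℝ → ℝ}
    (h : IsData c (fun p => U (0, p)) X β)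
    (hw : ∀ φ : ℝ × ℝ × ℝ → ℝ, ContDiff ℝ (⊤ : ℕ∞) φ → HasCompactSupport φ →
      tsupport φ ⊆ Ioi (0 : ℝ) ×ˢ univ →
      (∫ t in Ioi (0 : ℝ), ∫ p, (U (t, p) * transportOp c lam φ (t, p) + X (t, p) * φ (t, p)))
        + ∫ t in Ioi (0 : ℝ), ∫ ξ, c ξ * β (t, ξ) * φ (t, 0, ξ) = 0) {t : ℝ} (ht : 0 ≤ t) :
    ∀ᵐ p, U (t, p) = mild c lam (fun p => U (0, p)) X β t p := by
  have mM := measurable_mild_uncurry (lam := lam) hc h.meas_init h.meas_source h.meas_cross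
  have cM := continuousInL1_mild (lam := lam) hc hL h
  obtain ⟨CX, bX⟩ := h.bdd_source
  have hz := eq_zero_of_weak (lam := lam) hc hL
    (W := fun q => U q - mild c lam (fun p => U (0, p)) X β q.1 q.2) (mU.sub mM)
    (fun T => by
      obtain ⟨C1, h1⟩ := bU T
      obtain ⟨C2, h2⟩ := abs_mild_le (lam := lam) h T
      exact ⟨C1 + C2, fun q hq => (abs_sub _ _).trans (add_le_add (h1 q hq) (h2 q hq))⟩)
    (cU.sub cM)
    (Eventually.of_forall fun p => by simp [mild, lagrange, sourceTerm, crossTerm])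
    (fun φ hφ sφ tφ => ?_) t ht
  · filter_upwards [hz] with p hp
    exact sub_eq_zero.1 hp
  have hφ1 : ContDiff ℝ 1 φ := hφ.of_le (by simp)
  obtain ⟨CU, bU0⟩ := h.bdd_init
  obtain ⟨Cβ, bβ⟩ := h.bdd_cross
  have e1 := hw φ hφ sφ tφ
  have e2 := mild_weak (lam := lam) hc hL h.meas_init bU0 h.meas_source bX h.meas_cross bβ hφ1 sφ tφ
  obtain ⟨M, R, hM0, hR0, bφ, bD, hbox⟩ := exists_testFunction_bounds (lam := lam) hφ1 sφ hL
  have gen : ∀ V : ℝ × ℝ × ℝ → ℝ, Measurable V → (∀ T, ∃ C, ∀ q, |q.1| ≤ T → |V q| ≤ C) →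
      Integrable fun q => V q * transportOp c lam φ q + X q * φ q := by
    intro V mV bV
    obtain ⟨C, hC⟩ := bV R
    have hC0 : 0 ≤ C := (abs_nonneg _).trans (hC 0 (by simpa using hR0))
    have hX0 : 0 ≤ CX := (abs_nonneg _).trans (bX 0)
    refine integrable_of_bounded_of_box (R := R) (M := C * M + CX * M)
      ((mV.mul (measurable_transportOp hc hφ1)).add
        (h.meas_source.mul hφ.continuous.measurable)) (fun q => ?_) fun q hq => hbox q ?_
    · by_cases h0 : φ q ≠ 0 ∨ transportOp c lam φ q ≠ 0
      · have := (hbox q h0).1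
        refine (abs_add_le _ _).trans (add_le_add ?_ ?_)
        · rw [abs_mul]; exact mul_le_mul (hC q this) (bD q) (abs_nonneg _) hC0
        · rw [abs_mul]; exact mul_le_mul (bX q) (bφ q) (abs_nonneg _) hX0
      · push Not at h0
        rw [h0.1, h0.2]; simp only [mul_zero, add_zero, abs_zero]; positivity
    · by_contra h0
      push Not at h0
      exact hq (by simp [h0.1, h0.2])
  have i1 := gen U mU bU
  have i2 := gen _ mM (abs_mild_le (lam := lam) h)
  have conv : ∀ F : ℝ × ℝ × ℝ → ℝ, Integrable F →
      ∫ t in Ioi (0 : ℝ), ∫ p, F (t, p) = ∫ q in Ioi (0 : ℝ) ×ˢ univ, F q := by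
    intro F hF
    rw [Measure.volume_eq_prod ℝ (ℝ × ℝ), setIntegral_prod _ hF.integrableOn]
    simp
  rw [conv _ i1] at e1
  rw [conv _ i2] at e2
  have i3 := i1.sub i2
  have e3 : ∀ q, U q * transportOp c lam φ q + X q * φ q
      - (mild c lam (fun p => U (0, p)) X β q.1 q.2 * transportOp c lam φ q + X q * φ q)
      = (U q - mild c lam (fun p => U (0, p)) X β q.1 q.2) * transportOp c lam φ q :=
    fun q => by ring
  simp only [Pi.sub_def, e3] at i3
  rw [conv _ i3]
  simp only [← e3]
  rw [integral_sub i1.integrableOn i2.integrableOn]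
  linarith

/-! ### The `L¹` balance on a half line -/

/-- The part of `β` carried by the velocities with `0 < σ * c ξ`; for a solution on the half line
`{x | σ * x < 0}` these are the particles that leave the domain through `x = 0`. -/
def exitPart (c : ℝ → ℝ) (σ : ℝ) (β : ℝ × ℝ → ℝ) (q : ℝ × ℝ) : ℝ :=
  if 0 < σ * c q.2 then β q else 0

lemma measurable_exitPart (hc : Measurable c) (σ : ℝ) {β : ℝ × ℝ → ℝ} (hβ : Measurable β) :
    Measurable (exitPart c σ β) :=
  Measurable.ite (measurableSet_lt measurable_const ((hc.comp measurable_snd).const_mul σ)) hβ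
    measurable_const

/-- The part of `β` carried by the remaining velocities. -/
def entryPart (c : ℝ → ℝ) (σ : ℝ) (β : ℝ × ℝ → ℝ) (q : ℝ × ℝ) : ℝ :=
  if 0 < σ * c q.2 then 0 else β q

lemma measurable_entryPart (hc : Measurable c) (σ : ℝ) {β : ℝ × ℝ → ℝ} (hβ : Measurable β) :
    Measurable (entryPart c σ β) :=
  Measurable.ite (measurableSet_lt measurable_const ((hc.comp measurable_snd).const_mul σ))
    measurable_const hβ

lemma exitPart_add_entryPart (σ : ℝ) (β : ℝ × ℝ → ℝ) (q : ℝ × ℝ) :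
    exitPart c σ β q + entryPart c σ β q = β q := by
  simp only [exitPart, entryPart]; split_ifs <;> simp

/-- The `L¹` balance for a mild solution that is supported in `{x | σ * x < 0}`: what is there at
time `t`, together with what has left through `x = 0`, is bounded by the initial mass, the
supply by the source and what has entered through `x = 0`. -/
lemma lintegral_mild_add_exit_le (hc : Measurable c) {U₀ : ℝ × ℝ → ℝ} {X : ℝ × ℝ × ℝ → ℝ}
    {β : ℝ × ℝ → ℝ} (mU : Measurable U₀) (mX : Measurable X) (mβ : Measurable β) {σ : ℝ}
    {W : ℝ × ℝ → ℝ} {t : ℝ} (hW : W =ᵐ[volume] mild c lam U₀ X β t)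
    (hsupp : ∀ p : ℝ × ℝ, 0 ≤ σ * p.1 → W p = 0) :
    ENNReal.ofReal (Real.exp (lam * t)) * (∫⁻ p, ‖W p‖ₑ)
        + ∫⁻ s in Ioo 0 t, ENNReal.ofReal (Real.exp (lam * s)) * crossFlux c (exitPart c σ β) s
      ≤ (∫⁻ p, ‖U₀ p‖ₑ)
        + (∫⁻ s in Ioo 0 t, ENNReal.ofReal (Real.exp (lam * s)) * ∫⁻ p, ‖X (s, p)‖ₑ)
        + ∫⁻ s in Ioo 0 t, ENNReal.ofReal (Real.exp (lam * s))
            * crossFlux c (entryPart c σ β) s := by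
  have m1 := measurable_exitPart hc σ mβ
  rw [← lintegral_crossTerm hc m1 measurableSet_Ioo,
    ← lintegral_crossTerm hc (measurable_entryPart hc σ mβ) measurableSet_Ioo]
  have e1 : ENNReal.ofReal (Real.exp (lam * t)) * (∫⁻ p, ‖W p‖ₑ)
      = ∫⁻ p, ‖Real.exp (lam * t) * W (shift c t p)‖ₑ := by
    simp only [enorm_mul]
    rw [lintegral_const_mul' _ _ (by simp), lintegral_comp_shift hc t fun p => ‖W p‖ₑ,
      Real.enorm_eq_ofReal (Real.exp_pos _).le]
  have hW' : ∀ᵐ p, Real.exp (lam * t) * W (shift c t p) = lagrange c lam U₀ X β t p := by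
    filter_upwards [(measurePreserving_shift hc t).quasiMeasurePreserving.ae hW] with p hp
    rw [hp, mild, shift_neg_shift, ← mul_assoc, ← Real.exp_add]; simp
  have pw : ∀ᵐ p, ‖Real.exp (lam * t) * W (shift c t p)‖ₑ
        + ‖crossTerm c lam (exitPart c σ β) (Ioo 0 t) p‖ₑ
      ≤ ‖U₀ p‖ₑ + ‖sourceTerm c lam X (Ioo 0 t) p‖ₑ
        + ‖crossTerm c lam (entryPart c σ β) (Ioo 0 t) p‖ₑ := by
    filter_upwards [hW'] with p hp
    have hsplit : crossTerm c lam β (Ioo 0 t) p = crossTerm c lam (exitPart c σ β) (Ioo 0 t) p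
        + crossTerm c lam (entryPart c σ β) (Ioo 0 t) p := by
      by_cases h : crossTime c p ∈ Ioo 0 t
      · simp only [crossTerm, indicator, h, if_true]
        rw [← exitPart_add_entryPart (c := c) σ β]; ring
      · simp only [crossTerm, indicator, h, if_false, add_zero]
    -- a particle that has left the road is outside the support of `W`, so that the two terms of the
    -- balance do not overlap and the triangle inequality is an equality
    have hdis : W (shift c t p) = 0 ∨ crossTerm c lam (exitPart c σ β) (Ioo 0 t) p = 0 := by
      by_contra hcon
      push Not at hcon
      obtain ⟨h1, h2⟩ := hcon
      have hmem : crossTime c p ∈ Ioo 0 t := by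
        by_contra h; exact h2 (by simp only [crossTerm, indicator, h, if_false])
      have hpos : 0 < σ * c p.2 := by
        by_contra h
        exact h2 (by simp only [crossTerm, exitPart, indicator, hmem, if_true, h, if_false,
          mul_zero])
      have hc0 : c p.2 ≠ 0 := fun h => by simp [h] at hpos
      refine h1 (hsupp _ ?_)
      have : σ * (shift c t p).1 = σ * c p.2 * (t - crossTime c p) := by
        simp only [shift, crossTime]; field_simp; ring
      rw [this]
      exact mul_nonneg hpos.le (sub_nonneg.2 hmem.2.le)
    have heq : ‖Real.exp (lam * t) * W (shift c t p)‖ₑ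
        + ‖crossTerm c lam (exitPart c σ β) (Ioo 0 t) p‖ₑ
        = ‖Real.exp (lam * t) * W (shift c t p)
          - crossTerm c lam (exitPart c σ β) (Ioo 0 t) p‖ₑ := by
      rcases hdis with h | h <;> simp [h]
    rw [heq, hp]
    have : lagrange c lam U₀ X β t p - crossTerm c lam (exitPart c σ β) (Ioo 0 t) p
        = U₀ p + sourceTerm c lam X (Ioo 0 t) p
        + crossTerm c lam (entryPart c σ β) (Ioo 0 t) p := by
      rw [lagrange, hsplit]; ring
    rw [this]
    exact (enorm_add_le _ _).trans (add_le_add_left (enorm_add_le _ _) _)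
  have ms := (measurable_sourceTerm (lam := lam) hc mX (Ioo 0 t)).enorm
  have mc1 := (measurable_crossTerm (lam := lam) hc m1 (measurableSet_Ioo (a := 0) (b := t))).enorm
  rw [e1, ← lintegral_add_right _ mc1]
  refine (lintegral_mono_ae pw).trans ?_
  have mUs : Measurable fun p => ‖U₀ p‖ₑ + ‖sourceTerm c lam X (Ioo 0 t) p‖ₑ := mU.enorm.add ms
  rw [lintegral_add_left mUs, lintegral_add_left mU.enorm]
  gcongr
  exact lintegral_sourceTerm_le hc mX _

lemma lintegral_exp_mul (hlam : 0 ≤ lam) {t : ℝ} (ht : 0 ≤ t) :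
    ∫⁻ s in Ioo 0 t, ENNReal.ofReal (Real.exp (lam * s)) * ENNReal.ofReal lam
      = ENNReal.ofReal (Real.exp (lam * t) - 1) := by
  have h1 : ∫ s in (0 : ℝ)..t, Real.exp (lam * s) * lam = Real.exp (lam * t) - 1 := by
    have : ∀ s ∈ uIcc 0 t, HasDerivAt (fun s => Real.exp (lam * s)) (Real.exp (lam * s) * lam) s :=
      fun s _ => by simpa using ((hasDerivAt_id s).const_mul lam).exp
    rw [intervalIntegral.integral_eq_sub_of_hasDerivAt this
      ((by fun_prop : Continuous fun s => Real.exp (lam * s) * lam).intervalIntegrable _ _)]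
    simp
  have hi : IntegrableOn (fun s => Real.exp (lam * s) * lam) (Ioo 0 t) :=
    ((by fun_prop : Continuous fun s => Real.exp (lam * s) * lam).integrableOn_Icc
      (a := 0) (b := t)).mono_set Ioo_subset_Icc_self
  simp only [← ENNReal.ofReal_mul (Real.exp_pos _).le]
  rw [← h1, intervalIntegral.integral_of_le ht, integral_Ioc_eq_integral_Ioo,
    ofReal_integral_eq_lintegral_ofReal hi (Eventually.of_forall fun s => by positivity)]

/-- The balances on all roads, when at every time no more enters than leaves in total. -/
theorem sum_lintegral_mild_le {ι : Type*} [Fintype ι] {c : ι → ℝ → ℝ} (hc : ∀ h, Measurable (c h))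
    {U₀ : ι → ℝ × ℝ → ℝ} {X : ι → ℝ × ℝ × ℝ → ℝ} {β : ι → ℝ × ℝ → ℝ}
    (hd : ∀ h, IsData (c h) (U₀ h) (X h) (β h)) {σ : ι → ℝ} {W : ι → ℝ × ℝ → ℝ}
    (hlam : 0 ≤ lam) {t : ℝ} (ht : 0 ≤ t)
    (hW : ∀ h, W h =ᵐ[volume] mild (c h) lam (U₀ h) (X h) (β h) t)
    (hsupp : ∀ h, ∀ p : ℝ × ℝ, 0 ≤ σ h * p.1 → W h p = 0)
    (hflux : ∀ᵐ s ∂(volume.restrict (Ioo 0 t)),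
      ∑ h, crossFlux (c h) (entryPart (c h) (σ h) (β h)) s
        ≤ ∑ h, crossFlux (c h) (exitPart (c h) (σ h) (β h)) s) {S : ℝ≥0∞}
    (hS : ∀ s ∈ Ioo 0 t, ∑ h, (∫⁻ p, ‖X h (s, p)‖ₑ) ≤ ENNReal.ofReal lam * S) :
    ENNReal.ofReal (Real.exp (lam * t)) * ∑ h, ∫⁻ p, ‖W h p‖ₑ
      ≤ (∑ h, ∫⁻ p, ‖U₀ h p‖ₑ) + ENNReal.ofReal (Real.exp (lam * t) - 1) * S := by
  let A : ι → ℝ≥0∞ := fun h => ∫⁻ p, ‖W h p‖ₑ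
  let E : ℝ → ℝ≥0∞ := fun s => ENNReal.ofReal (Real.exp (lam * s))
  have mE : Measurable E := by fun_prop
  let Out : ι → ℝ≥0∞ := fun h => ∫⁻ s in Ioo 0 t, E s *
    crossFlux (c h) (exitPart (c h) (σ h) (β h)) s
  let In : ι → ℝ≥0∞ := fun h => ∫⁻ s in Ioo 0 t, E s *
    crossFlux (c h) (entryPart (c h) (σ h) (β h)) s
  have mx : ∀ h, Measurable (exitPart (c h) (σ h) (β h)) := fun h =>
    measurable_exitPart (hc h) _ (hd h).meas_cross
  have mOut : ∀ h, Measurable (crossFlux (c h) (exitPart (c h) (σ h) (β h))) := fun h =>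
    measurable_crossFlux (hc h) (mx h)
  have mIn : ∀ h, Measurable (crossFlux (c h) (entryPart (c h) (σ h) (β h))) :=
    fun h => measurable_crossFlux (hc h) (measurable_entryPart (hc h) _ (hd h).meas_cross)
  have mXs : ∀ h, Measurable fun s => ∫⁻ p, ‖X h (s, p)‖ₑ := fun h =>
    (hd h).meas_source.enorm.lintegral_prod_right'
  have mEOut : ∀ h, Measurable fun s => E s * crossFlux (c h) (exitPart (c h) (σ h) (β h)) s :=
    fun h => mE.mul (mOut h)
  have mEIn : ∀ h, Measurable fun s => E s * crossFlux (c h) (entryPart (c h) (σ h) (β h)) s :=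
    fun h => mE.mul (mIn h)
  have mEX : ∀ h, Measurable fun s => E s * ∫⁻ p, ‖X h (s, p)‖ₑ := fun h => mE.mul (mXs h)
  have hsum := Finset.sum_le_sum fun h (_ : h ∈ Finset.univ) =>
    lintegral_mild_add_exit_le (lam := lam) (hc h) (hd h).meas_init (hd h).meas_source
      (hd h).meas_cross (hW h) (hsupp h)
  simp only [Finset.sum_add_distrib, ← Finset.mul_sum] at hsum
  have hOI : ∑ h, In h ≤ ∑ h, Out h := by
    simp only [In, Out]
    rw [← lintegral_finsetSum _ fun h _ => mEIn h,
      ← lintegral_finsetSum _ fun h _ => mEOut h]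
    refine lintegral_mono_ae ?_
    filter_upwards [hflux] with s hs
    simp only [← Finset.mul_sum]
    gcongr
  -- the outgoing fluxes are finite and can be cancelled against the incoming ones
  have hOfin : ∑ h, Out h ≠ ∞ := by
    refine (ENNReal.sum_lt_top.2 fun h _ => ?_).ne
    obtain ⟨C, hC⟩ := (hd h).mass t
    refine (setLIntegral_mono (g := fun _ => E t * C) measurable_const fun s hs =>
      mul_le_mul' (ENNReal.ofReal_le_ofReal (Real.exp_le_exp.2
        (mul_le_mul_of_nonneg_left hs.2.le hlam))) ?_).trans_lt ?_
    · refine le_trans (lintegral_mono fun ξ => ?_) (le_add_self.trans (hC s hs))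
      simp only [exitPart]
      split_ifs <;> simp
    · rw [setLIntegral_const]
      exact ENNReal.mul_lt_top (ENNReal.mul_lt_top (by simp [E]) (by simp)) (by simp)
  have hXS : ∑ h, (∫⁻ s in Ioo 0 t, E s * ∫⁻ p, ‖X h (s, p)‖ₑ)
      ≤ ENNReal.ofReal (Real.exp (lam * t) - 1) * S := by
    rw [← lintegral_finsetSum _ fun h _ => mEX h, ← lintegral_exp_mul hlam ht,
      ← lintegral_mul_const _ (by fun_prop)]
    refine setLIntegral_mono (by fun_prop) fun s hs => ?_
    rw [← Finset.mul_sum, mul_assoc]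
    gcongr
    exact hS s hs
  have hfin : ENNReal.ofReal (Real.exp (lam * t)) * (∑ h, A h) + ∑ h, Out h
      ≤ ((∑ h, ∫⁻ p, ‖U₀ h p‖ₑ) + ENNReal.ofReal (Real.exp (lam * t) - 1) * S) + ∑ h, Out h := by
    refine hsum.trans ?_
    gcongr
  exact (ENNReal.add_le_add_iff_right hOfin).1 hfin

lemma IsData.sub (hc : Measurable c) {U₁ U₂ : ℝ × ℝ → ℝ} {X₁ X₂ : ℝ × ℝ × ℝ → ℝ}
    {β₁ β₂ : ℝ × ℝ → ℝ} (h₁ : IsData c U₁ X₁ β₁) (h₂ : IsData c U₂ X₂ β₂) :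
    IsData c (fun p => U₁ p - U₂ p) (fun q => X₁ q - X₂ q) (fun q => β₁ q - β₂ q) where
  meas_init := h₁.meas_init.sub h₂.meas_init
  bdd_init := by
    obtain ⟨C₁, b₁⟩ := h₁.bdd_init
    obtain ⟨C₂, b₂⟩ := h₂.bdd_init
    exact ⟨C₁ + C₂, fun p => (abs_sub _ _).trans (add_le_add (b₁ p) (b₂ p))⟩
  int_init := by
    refine (lintegral_mono fun p => enorm_sub_le).trans_lt ?_
    rw [lintegral_add_left h₁.meas_init.enorm]
    exact ENNReal.add_lt_top.2 ⟨h₁.int_init, h₂.int_init⟩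
  meas_source := h₁.meas_source.sub h₂.meas_source
  bdd_source := by
    obtain ⟨C₁, b₁⟩ := h₁.bdd_source
    obtain ⟨C₂, b₂⟩ := h₂.bdd_source
    exact ⟨C₁ + C₂, fun p => (abs_sub _ _).trans (add_le_add (b₁ p) (b₂ p))⟩
  meas_cross := h₁.meas_cross.sub h₂.meas_cross
  bdd_cross := by
    obtain ⟨C₁, b₁⟩ := h₁.bdd_cross
    obtain ⟨C₂, b₂⟩ := h₂.bdd_cross
    exact ⟨C₁ + C₂, fun p => (abs_sub _ _).trans (add_le_add (b₁ p) (b₂ p))⟩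
  mass T := by
    obtain ⟨C₁, b₁⟩ := h₁.mass T
    obtain ⟨C₂, b₂⟩ := h₂.mass T
    refine ⟨C₁ + C₂, fun s hs => ?_⟩
    have m1 : Measurable fun p => ‖X₁ (s, p)‖ₑ :=
      (h₁.meas_source.comp measurable_prodMk_left).enorm
    have m2 : Measurable fun ξ => ‖c ξ * β₁ (s, ξ)‖ₑ :=
      (hc.mul (h₁.meas_cross.comp measurable_prodMk_left)).enorm
    have e1 : ∫⁻ p, ‖X₁ (s, p) - X₂ (s, p)‖ₑ
        ≤ (∫⁻ p, ‖X₁ (s, p)‖ₑ) + ∫⁻ p, ‖X₂ (s, p)‖ₑ := by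
      rw [← lintegral_add_left m1]
      exact lintegral_mono fun p => enorm_sub_le
    have e2 : crossFlux c (fun q => β₁ q - β₂ q) s ≤ crossFlux c β₁ s + crossFlux c β₂ s := by
      simp only [crossFlux]
      rw [← lintegral_add_left m2]
      refine lintegral_mono fun ξ => ?_
      rw [mul_sub]; exact enorm_sub_le
    calc _ ≤ ((∫⁻ p, ‖X₁ (s, p)‖ₑ) + ∫⁻ p, ‖X₂ (s, p)‖ₑ)
          + (crossFlux c β₁ s + crossFlux c β₂ s) := add_le_add e1 e2
      _ = ((∫⁻ p, ‖X₁ (s, p)‖ₑ) + crossFlux c β₁ s)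
          + ((∫⁻ p, ‖X₂ (s, p)‖ₑ) + crossFlux c β₂ s) := by ring
      _ ≤ _ := by push_cast; exact add_le_add (b₁ s hs) (b₂ s hs)

lemma mild_sub {U₁ U₂ : ℝ × ℝ → ℝ} {X₁ X₂ : ℝ × ℝ × ℝ → ℝ} {β₁ β₂ : ℝ × ℝ → ℝ}
    (h₁ : IsData c U₁ X₁ β₁) (h₂ : IsData c U₂ X₂ β₂) (t : ℝ) (p : ℝ × ℝ) :
    mild c lam (fun p => U₁ p - U₂ p) (fun q => X₁ q - X₂ q) (fun q => β₁ q - β₂ q) t p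
      = mild c lam U₁ X₁ β₁ t p - mild c lam U₂ X₂ β₂ t p := by
  have e1 : ∀ p, sourceTerm c lam (fun q => X₁ q - X₂ q) (Ioo 0 t) p
      = sourceTerm c lam X₁ (Ioo 0 t) p - sourceTerm c lam X₂ (Ioo 0 t) p := fun p => by
    simp only [sourceTerm, mul_sub]
    exact integral_sub (integrableOn_source h₁.meas_source h₁.bdd_source p t)
      (integrableOn_source h₂.meas_source h₂.bdd_source p t)
  have e2 : ∀ p, crossTerm c lam (fun q => β₁ q - β₂ q) (Ioo 0 t) p
      = crossTerm c lam β₁ (Ioo 0 t) p - crossTerm c lam β₂ (Ioo 0 t) p := fun p => by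
    by_cases h : crossTime c p ∈ Ioo 0 t
    · simp only [crossTerm, indicator, h, if_true]; ring
    · simp only [crossTerm, indicator, h, if_false, sub_zero]
  simp only [mild, lagrange, e1, e2]
  ring

/-! ### Jointly measurable representatives -/

/-- Approximation of a continuous curve in `L¹` by a jointly measurable function: at time `t` it
equals the first member of a dense sequence on the curve within distance `r` of the value there. -/
lemma exists_measurable_approx {α : Type*} [MeasurableSpace α] {μ : Measure α}
    (u : C(ℝ≥0, Lp ℝ 1 μ)) {r : ℝ} (hr : 0 < r) :
    ∃ V : ℝ≥0 × α → ℝ, Measurable V ∧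
      ∀ t, ∫⁻ p, ‖V (t, p) - u t p‖ₑ ∂μ ≤ ENNReal.ofReal r := by
  obtain ⟨idx, midx, hidx⟩ : ∃ idx : ℝ≥0 → ℕ, Measurable idx ∧
      ∀ t, ‖u (TopologicalSpace.denseSeq ℝ≥0 (idx t)) - u t‖ < r := by
    classical
    have hex : ∀ t : ℝ≥0, ∃ i, ‖u (TopologicalSpace.denseSeq ℝ≥0 i) - u t‖ < r := by
      intro t
      have ho : IsOpen {s : ℝ≥0 | ‖u s - u t‖ < r} :=
        isOpen_lt (u.continuous.sub continuous_const).norm continuous_const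
      obtain ⟨i, hi⟩ := (TopologicalSpace.denseRange_denseSeq ℝ≥0).exists_mem_open ho
        ⟨t, by simpa using hr⟩
      exact ⟨i, hi⟩
    exact ⟨fun t => Nat.find (hex t), measurable_find hex fun i =>
      (isOpen_lt (continuous_const.sub u.continuous).norm continuous_const).measurableSet,
      fun t => Nat.find_spec (hex t)⟩
  have key : ∀ i, ∃ e : α → ℝ, Measurable e ∧ u (TopologicalSpace.denseSeq ℝ≥0 i) =ᵐ[μ] e :=
    fun i => ⟨_, (Lp.aestronglyMeasurable _).stronglyMeasurable_mk.measurable,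
      (Lp.aestronglyMeasurable _).ae_eq_mk⟩
  choose e me ee using key
  have h1 : Measurable fun z : ℕ × α => e z.1 z.2 := measurable_from_prod_countable_right me
  refine ⟨fun q => e (idx q.1) q.2,
    h1.comp ((midx.comp measurable_fst).prodMk measurable_snd), fun t => ?_⟩
  have h2 : ∫⁻ p, ‖e (idx t) p - u t p‖ₑ ∂μ
      = ‖u (TopologicalSpace.denseSeq ℝ≥0 (idx t)) - u t‖ₑ := by
    rw [Lp.enorm_def, eLpNorm_one_eq_lintegral_enorm]
    refine lintegral_congr_ae ?_
    filter_upwards [ee (idx t), Lp.coeFn_sub (u (TopologicalSpace.denseSeq ℝ≥0 (idx t))) (u t)]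
      with p hp hq
    rw [hq, Pi.sub_apply, hp]
  rw [h2, ← ofReal_norm]
  exact ENNReal.ofReal_le_ofReal (hidx t).le

/-- A continuous curve in `L¹` has a representative that is jointly measurable in time and
space. -/
theorem exists_measurable_representative {α : Type*} [MeasurableSpace α] {μ : Measure α}
    (u : C(ℝ≥0, Lp ℝ 1 μ)) :
    ∃ G : ℝ≥0 × α → ℝ, Measurable G ∧ ∀ t, ∀ᵐ p ∂μ, G (t, p) = u t p := by
  choose V mV hdist using fun j : ℕ =>
    exists_measurable_approx u (r := (1 / 2 : ℝ) ^ j) (by positivity)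
  refine ⟨fun q => limsup (fun j => V j q) atTop, Measurable.limsup mV, fun t => ?_⟩
  have mm : ∀ j, AEMeasurable (fun p => ‖V j (t, p) - u t p‖ₑ) μ := fun j =>
    (((mV j).comp measurable_prodMk_left).aemeasurable.sub
      (Lp.aestronglyMeasurable (u t)).aemeasurable).enorm
  have hsum : ∫⁻ p, ∑' j, ‖V j (t, p) - u t p‖ₑ ∂μ < ∞ := by
    rw [lintegral_tsum mm]
    refine (ENNReal.tsum_le_tsum fun j => hdist j t).trans_lt ?_
    rw [← ENNReal.ofReal_tsum_of_nonneg (fun j => by positivity)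
      (summable_geometric_of_lt_one (by norm_num) (by norm_num))]
    exact ENNReal.ofReal_lt_top
  have hfin := ae_lt_top' (AEMeasurable.tsum mm) hsum.ne
  filter_upwards [hfin] with p hp
  have h0 := ENNReal.tendsto_atTop_zero_of_tsum_ne_top hp.ne
  have h1 : Tendsto (fun j => V j (t, p)) atTop (𝓝 (u t p)) := by
    rw [← tendsto_sub_nhds_zero_iff, tendsto_zero_iff_enorm_tendsto_zero]
    exact h0
  exact h1.limsup_eq

end KineticTransport

/-! ### The equilibrium function -/

lemma mem_kinSet_of_pos {ξ g : ℝ} (hξ : 0 < ξ) : g ∈ kinSet ξ ↔ 0 ≤ g ∧ g ≤ 1 := by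
  simp only [kinSet, mem_ofPred_eq, Real.sign_of_pos hξ, one_mul, abs_le]
  constructor
  · rintro ⟨h1, h2⟩
    exact ⟨by rw [h1]; exact abs_nonneg g, h2.2⟩
  · rintro ⟨h1, h2⟩
    exact ⟨(abs_of_nonneg h1).symm, by linarith, h2⟩

lemma mem_kinSet_of_neg {ξ g : ℝ} (hξ : ξ < 0) : g ∈ kinSet ξ ↔ -1 ≤ g ∧ g ≤ 0 := by
  simp only [kinSet, mem_ofPred_eq, Real.sign_of_neg hξ, abs_le]
  constructor
  · rintro ⟨h1, h2⟩
    exact ⟨h2.1, by linarith [abs_nonneg g]⟩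
  · rintro ⟨h1, h2⟩
    exact ⟨by rw [abs_of_nonpos h2]; ring, h1, by linarith⟩

lemma mem_kinSet_zero {g : ℝ} : g ∈ kinSet 0 ↔ g = 0 := by
  simp only [kinSet, mem_ofPred_eq, Real.sign_zero, zero_mul]
  constructor
  · rintro ⟨h1, -⟩
    exact abs_eq_zero.1 h1.symm
  · rintro rfl; simp

lemma mem_kinSet_iff {ξ g : ℝ} :
    g ∈ kinSet ξ ↔ (0 < ξ → 0 ≤ g) ∧ (ξ < 0 → g ≤ 0) ∧ (ξ = 0 → g = 0) ∧ |g| ≤ 1 := by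
  rcases lt_trichotomy ξ 0 with h | h | h
  · rw [mem_kinSet_of_neg h, abs_le]
    exact ⟨fun ⟨h1, h2⟩ => ⟨fun h' => by linarith, fun _ => h2, fun h' => by linarith, h1,
      by linarith⟩, fun ⟨_, h2, _, h4⟩ => ⟨h4.1, h2 h⟩⟩
  · subst h
    rw [mem_kinSet_zero]
    exact ⟨by rintro rfl; simp, fun ⟨_, _, h3, _⟩ => h3 rfl⟩
  · rw [mem_kinSet_of_pos h, abs_le]
    exact ⟨fun ⟨h1, h2⟩ => ⟨fun _ => h1, fun h' => by linarith, fun h' => by linarith,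
      by linarith, h2⟩, fun ⟨h1, _, _, h4⟩ => ⟨h1 h, h4.2⟩⟩

lemma zero_mem_kinSet (ξ : ℝ) : (0 : ℝ) ∈ kinSet ξ := by simp [mem_kinSet_iff]

lemma abs_le_one_of_mem_kinSet {ξ g : ℝ} (h : g ∈ kinSet ξ) : |g| ≤ 1 := h.2

lemma chi_mem_kinSet (ρ ξ : ℝ) : chi ρ ξ ∈ kinSet ξ := by
  rw [mem_kinSet_iff, chi]
  split_ifs with h1 h2
  · exact ⟨fun _ => zero_le_one, fun h => by linarith [h1.1], fun h => by linarith [h1.1], by simp⟩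
  · exact ⟨fun h => by linarith [h2.2], fun _ => by norm_num, fun h => by linarith [h2.2], by simp⟩
  · simp

lemma abs_chi_le_one (ρ ξ : ℝ) : |chi ρ ξ| ≤ 1 := abs_le_one_of_mem_kinSet (chi_mem_kinSet ρ ξ)

lemma chi_mono {ρ ρ' : ℝ} (h : ρ ≤ ρ') (ξ : ℝ) : chi ρ ξ ≤ chi ρ' ξ := by
  unfold chi
  split_ifs <;> first | (exfalso; grind) | norm_num

lemma le_chi_of_lt {ρ ξ g : ℝ} (hg : g ∈ kinSet ξ) (h : ξ < ρ) : g ≤ chi ρ ξ := by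
  obtain ⟨h1, h2, h3, h4⟩ := mem_kinSet_iff.1 hg
  rw [abs_le] at h4
  unfold chi
  split_ifs with c1 c2
  · exact h4.2
  · linarith
  · rcases lt_trichotomy ξ 0 with h' | h' | h'
    · exact h2 h'
    · exact (h3 h').le
    · exact absurd ⟨h', h⟩ c1

lemma chi_le_of_lt {ρ ξ g : ℝ} (hg : g ∈ kinSet ξ) (h : ρ < ξ) : chi ρ ξ ≤ g := by
  obtain ⟨h1, h2, h3, h4⟩ := mem_kinSet_iff.1 hg
  rw [abs_le] at h4
  unfold chi
  split_ifs with c1 c2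
  · linarith
  · exact h4.1
  · rcases lt_trichotomy ξ 0 with h' | h' | h'
    · exact absurd ⟨h, h'⟩ c2
    · exact (h3 h').ge
    · exact h1 h'

lemma measurable_chi : Measurable fun z : ℝ × ℝ => chi z.1 z.2 := by
  unfold chi
  refine Measurable.ite ?_ measurable_const (Measurable.ite ?_ measurable_const measurable_const)
  · exact (measurableSet_lt measurable_const measurable_snd).inter
      (measurableSet_lt measurable_snd measurable_fst)
  · exact (measurableSet_lt measurable_fst measurable_snd).inter
      (measurableSet_lt measurable_snd measurable_const)

lemma measurable_chi_right (ρ : ℝ) : Measurable (chi ρ) :=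
  measurable_chi.comp measurable_prodMk_left

lemma abs_chi_sub_le (ρ ρ' ξ : ℝ) (h : ρ ≤ ρ') :
    |chi ρ ξ - chi ρ' ξ| ≤ (Icc ρ ρ').indicator (fun _ => 1) ξ := by
  by_cases hm : ξ ∈ Icc ρ ρ'
  · rw [indicator_of_mem hm, abs_sub_comm, abs_of_nonneg (sub_nonneg.2 (chi_mono h ξ))]
    unfold chi
    split_ifs <;> first | (exfalso; grind) | norm_num
  · rw [indicator_of_notMem hm]
    have : chi ρ ξ = chi ρ' ξ := by
      unfold chi
      rw [mem_Icc, not_and_or, not_le, not_le] at hm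
      split_ifs <;> first | rfl | (exfalso; grind)
    simp [this]

lemma lintegral_chi_sub_le (ρ ρ' : ℝ) : ∫⁻ ξ, ‖chi ρ ξ - chi ρ' ξ‖ₑ ≤ ‖ρ - ρ'‖ₑ := by
  wlog h : ρ ≤ ρ' generalizing ρ ρ'
  · rw [enorm_sub_rev]
    simp only [enorm_sub_rev (chi ρ _)]
    exact this ρ' ρ (le_of_not_ge h)
  calc ∫⁻ ξ, ‖chi ρ ξ - chi ρ' ξ‖ₑ ≤ ∫⁻ ξ, (Icc ρ ρ').indicator (fun _ => 1) ξ := by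
        refine lintegral_mono fun ξ => ?_
        rw [Real.enorm_eq_ofReal_abs]
        refine (ENNReal.ofReal_le_ofReal (abs_chi_sub_le ρ ρ' ξ h)).trans ?_
        by_cases hm : ξ ∈ Icc ρ ρ' <;> simp [hm, indicator]
    _ = ENNReal.ofReal (ρ' - ρ) := by
        rw [lintegral_indicator measurableSet_Icc, setLIntegral_const, one_mul, Real.volume_Icc]
    _ = ‖ρ - ρ'‖ₑ := by
        rw [enorm_sub_rev, Real.enorm_eq_ofReal (sub_nonneg.2 h)]

lemma chi_of_nonneg {ρ : ℝ} (h : 0 ≤ ρ) (ξ : ℝ) :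
    chi ρ ξ = (Ioo 0 ρ).indicator (fun _ => 1) ξ := by
  unfold chi indicator
  split_ifs <;> first | rfl | (exfalso; grind)

lemma chi_of_nonpos {ρ : ℝ} (h : ρ ≤ 0) (ξ : ℝ) :
    chi ρ ξ = (Ioo ρ 0).indicator (fun _ => -1) ξ := by
  unfold chi indicator
  split_ifs <;> first | rfl | (exfalso; grind)

lemma setIntegral_mul_chi {a b ρ : ℝ} (h0 : (0 : ℝ) ∈ Icc a b) (hρ : ρ ∈ Icc a b) (F : ℝ → ℝ) :
    ∫ ξ in Icc a b, F ξ * chi ρ ξ = ∫ ξ in (0 : ℝ)..ρ, F ξ := by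
  rcases le_total 0 ρ with h | h
  · have : ∀ ξ, F ξ * chi ρ ξ = (Ioo 0 ρ).indicator F ξ := fun ξ => by
      by_cases hξ : ξ ∈ Ioo 0 ρ <;> simp [chi_of_nonneg h, hξ]
    simp only [this]
    rw [setIntegral_indicator measurableSet_Ioo, inter_eq_right.2 (show Ioo 0 ρ ⊆ Icc a b from
      fun x hx => ⟨h0.1.trans hx.1.le, hx.2.le.trans hρ.2⟩), intervalIntegral.integral_of_le h,
      integral_Ioc_eq_integral_Ioo]
  · have : ∀ ξ, F ξ * chi ρ ξ = (Ioo ρ 0).indicator (fun ξ => -F ξ) ξ := fun ξ => by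
      by_cases hξ : ξ ∈ Ioo ρ 0 <;> simp [chi_of_nonpos h, hξ]
    simp only [this]
    rw [setIntegral_indicator measurableSet_Ioo, inter_eq_right.2 (show Ioo ρ 0 ⊆ Icc a b from
      fun x hx => ⟨hρ.1.trans hx.1.le, hx.2.le.trans h0.2⟩), intervalIntegral.integral_of_ge h,
      integral_Ioc_eq_integral_Ioo, integral_neg]

lemma integral_chi {a b ρ : ℝ} (h0 : (0 : ℝ) ∈ Icc a b) (hρ : ρ ∈ Icc a b) :
    ∫ ξ in Icc a b, chi ρ ξ = ρ := by
  simpa using setIntegral_mul_chi h0 hρ fun _ => 1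

/-- The densities of admissible kinetic functions lie in the state interval. -/
lemma integral_mem_Icc_of_kinSet {a b : ℝ} (h0 : (0 : ℝ) ∈ Icc a b) {g : ℝ → ℝ}
    (mg : AEStronglyMeasurable g (volume.restrict (Icc a b)))
    (hg : ∀ᵐ ξ ∂(volume.restrict (Icc a b)), g ξ ∈ kinSet ξ) :
    ∫ ξ in Icc a b, g ξ ∈ Icc a b := by
  have ig : Integrable g (volume.restrict (Icc a b)) := by
    refine Integrable.of_bound mg 1 ?_
    filter_upwards [hg] with ξ h using h.2
  have ichi : ∀ ρ, Integrable (chi ρ) (volume.restrict (Icc a b)) := fun ρ =>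
    Integrable.of_bound (measurable_chi_right ρ).aestronglyMeasurable 1
      (Eventually.of_forall fun ξ => abs_chi_le_one ρ ξ)
  have ha : a ∈ Icc a b := ⟨le_rfl, h0.1.trans h0.2⟩
  have hb : b ∈ Icc a b := ⟨h0.1.trans h0.2, le_rfl⟩
  have hna : ∀ᵐ ξ ∂(volume.restrict (Icc a b)), ξ ≠ a := ae_restrict_of_ae (by simp [ae_iff])
  have hnb : ∀ᵐ ξ ∂(volume.restrict (Icc a b)), ξ ≠ b := ae_restrict_of_ae (by simp [ae_iff])
  constructor
  · refine (integral_chi h0 ha).ge.trans (integral_mono_ae (ichi a) ig ?_)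
    filter_upwards [hg, hna, ae_restrict_mem measurableSet_Icc] with ξ h1 h2 h3
    exact chi_le_of_lt h1 (lt_of_le_of_ne h3.1 (Ne.symm h2))
  · have e := integral_chi h0 hb
    refine le_trans (integral_mono_ae ig (ichi b) ?_) e.le
    filter_upwards [hg, hnb, ae_restrict_mem measurableSet_Icc] with ξ h1 h2 h3
    exact le_chi_of_lt h1 (lt_of_le_of_ne h3.2 h2)

/-! ### The priority functions -/

namespace Junction

variable {n m : ℕ} {N : Junction n m}

lemma leftDeriv_le_rightDeriv (hN : N.Admissible) (h : Fin n ⊕ Fin m) (x : ℝ) :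
    derivWithin (N.η h) (Iio x) x ≤ derivWithin (N.η h) (Ioi x) x :=
  (hN.entropy_convex h).leftDeriv_le_rightDeriv_of_mem_interior (by simp)

lemma rightDeriv_le_leftDeriv (hN : N.Admissible) (h : Fin n ⊕ Fin m) {x y : ℝ} (hxy : x < y) :
    derivWithin (N.η h) (Ioi x) x ≤ derivWithin (N.η h) (Iio y) y :=
  ((hN.entropy_convex h).rightDeriv_le_slope_of_mem_interior (by simp) (mem_univ y) hxy).trans
    ((hN.entropy_convex h).slope_le_leftDeriv_of_mem_interior (mem_univ x) (by simp) hxy)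

/-- By convexity of the entropy, one-sided derivatives at distinct points are ordered, so states
that belong to a smaller `M` lie below those that belong to a larger one. -/
lemma levelSet_mono (hN : N.Admissible) {h : Fin n ⊕ Fin m} {M M' ρ ρ' : ℝ} (hM : M < M')
    (hρ : ρ ∈ N.levelSet h M) (hρ' : ρ' ∈ N.levelSet h M') : ρ ≤ ρ' := by
  by_contra! hlt
  have h1 := hρ.2.1.resolve_left (fun e => by linarith [hρ'.1.1])
  have h2 := hρ'.2.2.resolve_left (fun e => by linarith [hρ.1.2])
  linarith [rightDeriv_le_leftDeriv hN h hlt]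

lemma ordConnected_levelSet (hN : N.Admissible) (h : Fin n ⊕ Fin m) (M : ℝ) :
    (N.levelSet h M).OrdConnected := by
  refine ⟨fun x hx z hz y hy => ?_⟩
  have hK : y ∈ N.K h := ⟨hx.1.1.trans hy.1, hy.2.trans hz.1.2⟩
  refine ⟨hK, ?_, ?_⟩
  · rcases hy.2.eq_or_lt with rfl | hlt
    · exact hz.2.1
    · refine Or.inr ?_
      have h1 := hz.2.1.resolve_left (fun e => by linarith [hK.1])
      linarith [rightDeriv_le_leftDeriv hN h hlt, leftDeriv_le_rightDeriv hN h y]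
  · rcases hy.1.eq_or_lt with rfl | hlt
    · exact hx.2.2
    · refine Or.inr ?_
      have h1 := hx.2.2.resolve_left (fun e => by linarith [hK.2])
      linarith [rightDeriv_le_leftDeriv hN h hlt, leftDeriv_le_rightDeriv hN h y]

lemma prio_mem_levelSet (hN : N.Admissible) (h : Fin n ⊕ Fin m) (M : ℝ) {z : ℝ}
    (hz : z ∈ Icc (0 : ℝ) 1) : N.prio h M z ∈ N.levelSet h M :=
  hN.prio_surj h M ▸ mem_image_of_mem _ hz

lemma prio_mem_K (hN : N.Admissible) (h : Fin n ⊕ Fin m) (M : ℝ) {z : ℝ}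
    (hz : z ∈ Icc (0 : ℝ) 1) : N.prio h M z ∈ N.K h := (prio_mem_levelSet hN h M hz).1

lemma prio_zero_le (hN : N.Admissible) {h : Fin n ⊕ Fin m} {M ρ : ℝ} (hρ : ρ ∈ N.levelSet h M) :
    N.prio h M 0 ≤ ρ := by
  rw [← hN.prio_surj h M] at hρ
  obtain ⟨z, hz, rfl⟩ := hρ
  exact hN.prio_mono h M ⟨le_rfl, zero_le_one⟩ hz hz.1

lemma le_prio_one (hN : N.Admissible) {h : Fin n ⊕ Fin m} {M ρ : ℝ} (hρ : ρ ∈ N.levelSet h M) :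
    ρ ≤ N.prio h M 1 := by
  rw [← hN.prio_surj h M] at hρ
  obtain ⟨z, hz, rfl⟩ := hρ
  exact hN.prio_mono h M hz ⟨zero_le_one, le_rfl⟩ hz.2

/-- An increasing surjection onto an interval is continuous. -/
lemma continuousOn_prio (hN : N.Admissible) (h : Fin n ⊕ Fin m) (M : ℝ) :
    ContinuousOn (N.prio h M) (Icc 0 1) := by
  have := ordConnected_levelSet hN h M
  let F : Icc (0 : ℝ) 1 → N.levelSet h M := fun z => ⟨N.prio h M z, prio_mem_levelSet hN h M z.2⟩
  have hF : Continuous F := by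
    refine Monotone.continuous_of_surjective (fun x y hxy => hN.prio_mono h M x.2 y.2 hxy) ?_
    rintro ⟨ρ, hρ⟩
    obtain ⟨z, hz, e⟩ : ρ ∈ N.prio h M '' Icc 0 1 := by rwa [hN.prio_surj h M]
    exact ⟨⟨z, hz⟩, Subtype.ext e⟩
  rw [continuousOn_iff_continuous_domRestrict]
  exact continuous_subtype_val.comp hF

/-- For very negative `M`, the only admissible state is the left end point. -/
lemma exists_forall_prio_eq_left (hN : N.Admissible) :
    ∃ M₀, ∀ M < M₀, ∀ h, ∀ z ∈ Icc (0 : ℝ) 1, N.prio h M z = N.a h := by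
  obtain ⟨M₀, hM₀⟩ := (finite_range fun h => derivWithin (N.η h) (Ioi (N.a h)) (N.a h)).bddBelow
  refine ⟨M₀, fun M hM h z hz => ?_⟩
  have hρ := prio_mem_levelSet hN h M hz
  by_contra hne
  have h1 := hρ.2.1.resolve_left hne
  have h2 := rightDeriv_le_leftDeriv hN h (lt_of_le_of_ne hρ.1.1 (Ne.symm hne))
  linarith [hM₀ (mem_range_self h)]

lemma exists_forall_prio_eq_right (hN : N.Admissible) :
    ∃ M₀, ∀ M > M₀, ∀ h, ∀ z ∈ Icc (0 : ℝ) 1, N.prio h M z = N.b h := by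
  obtain ⟨M₀, hM₀⟩ := (finite_range fun h => derivWithin (N.η h) (Iio (N.b h)) (N.b h)).bddAbove
  refine ⟨M₀, fun M hM h z hz => ?_⟩
  have hρ := prio_mem_levelSet hN h M hz
  by_contra hne
  have h1 := hρ.2.2.resolve_left hne
  have h2 := rightDeriv_le_leftDeriv hN h (lt_of_le_of_ne hρ.1.2 hne)
  linarith [hM₀ (mem_range_self h)]

/-- The least admissible state depends left continuously on `M`. -/
lemma tendsto_prio_left (hN : N.Admissible) (h : Fin n ⊕ Fin m) (M : ℝ) :
    Tendsto (fun M' => N.prio h M' 0) (𝓝[<] M) (𝓝 (N.prio h M 0)) := by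
  have z0 : (0 : ℝ) ∈ Icc (0 : ℝ) 1 := ⟨le_rfl, zero_le_one⟩
  have hr := prio_mem_levelSet hN h M z0
  refine tendsto_order.2 ⟨fun x' hx' => ?_, fun x hx => ?_⟩
  · rcases lt_or_ge x' (N.a h) with hxa | hxa
    · exact Eventually.of_forall fun M' => hxa.trans_le (prio_mem_K hN h M' z0).1
    obtain ⟨x, hx'x, hx⟩ := exists_between hx'
    have hxb : x < N.b h := hx.trans_le hr.1.2
    have hR : derivWithin (N.η h) (Ioi x) x < M := by
      by_contra! hge
      refine absurd (prio_zero_le hN (ρ := x) ⟨⟨(hxa.trans_lt hx'x).le, hxb.le⟩, Or.inr ?_,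
        Or.inr hge⟩) (not_le.2 hx)
      have h1 := hr.2.1.resolve_left (fun e => by linarith)
      linarith [rightDeriv_le_leftDeriv hN h hx, leftDeriv_le_rightDeriv hN h x]
    filter_upwards [Ioo_mem_nhdsLT hR] with M' hM'
    have hy := prio_mem_levelSet hN h M' z0
    by_contra! hle
    have h1 := hy.2.2.resolve_left (fun e => by linarith)
    rcases (hle.trans hx'x.le).eq_or_lt with e | hlt
    · rw [e] at h1; linarith [hM'.1]
    · linarith [rightDeriv_le_leftDeriv hN h hlt, leftDeriv_le_rightDeriv hN h x, hM'.1]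
  · filter_upwards [self_mem_nhdsWithin] with M' hM'
    exact (levelSet_mono hN hM' (prio_mem_levelSet hN h M' z0) hr).trans_lt hx

/-- Seen from the right, the least admissible state tends to the greatest one. -/
lemma tendsto_prio_right (hN : N.Admissible) (h : Fin n ⊕ Fin m) (M : ℝ) :
    Tendsto (fun M' => N.prio h M' 0) (𝓝[>] M) (𝓝 (N.prio h M 1)) := by
  have z0 : (0 : ℝ) ∈ Icc (0 : ℝ) 1 := ⟨le_rfl, zero_le_one⟩
  have hr := prio_mem_levelSet hN h M (z := 1) ⟨zero_le_one, le_rfl⟩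
  refine tendsto_order.2 ⟨fun x hx => ?_, fun x' hx' => ?_⟩
  · filter_upwards [self_mem_nhdsWithin] with M' hM'
    exact hx.trans_le (levelSet_mono hN hM' hr (prio_mem_levelSet hN h M' z0))
  · rcases lt_or_ge (N.b h) x' with hxb | hxb
    · exact Eventually.of_forall fun M' => (prio_mem_K hN h M' z0).2.trans_lt hxb
    obtain ⟨x, hx, hxx'⟩ := exists_between hx'
    have hxa : N.a h < x := hr.1.1.trans_lt hx
    have hL : M < derivWithin (N.η h) (Iio x) x := by
      by_contra! hge
      refine absurd (le_prio_one hN (ρ := x) ⟨⟨hxa.le, (hxx'.trans_le hxb).le⟩, Or.inr hge,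
        Or.inr ?_⟩) (not_le.2 hx)
      have h1 := hr.2.2.resolve_left (fun e => by linarith)
      linarith [rightDeriv_le_leftDeriv hN h hx, leftDeriv_le_rightDeriv hN h x]
    filter_upwards [Ioo_mem_nhdsGT hL] with M' hM'
    have hy := prio_mem_levelSet hN h M' z0
    by_contra! hle
    have h1 := hy.2.1.resolve_left (fun e => by linarith)
    rcases (hxx'.le.trans hle).eq_or_lt with e | hlt
    · rw [← e] at h1; linarith [hM'.2]
    · linarith [rightDeriv_le_leftDeriv hN h hlt, leftDeriv_le_rightDeriv hN h x, hM'.2]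

/-- Along the lexicographic order of the parameters `(M, z)` all states increase. -/
lemma prio_le_or_ge (hN : N.Admissible) {p p' : ℝ × ℝ} (hp : p.2 ∈ Icc (0 : ℝ) 1)
    (hp' : p'.2 ∈ Icc (0 : ℝ) 1) :
    (∀ h, N.prio h p.1 p.2 ≤ N.prio h p'.1 p'.2) ∨
      ∀ h, N.prio h p'.1 p'.2 ≤ N.prio h p.1 p.2 := by
  obtain ⟨M, z⟩ := p
  obtain ⟨M', z'⟩ := p'
  rcases lt_trichotomy M M' with hM | rfl | hM
  · exact Or.inl fun h =>
      levelSet_mono hN hM (prio_mem_levelSet hN h M hp) (prio_mem_levelSet hN h M' hp')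
  · rcases le_total z z' with hz | hz
    · exact Or.inl fun h => hN.prio_mono h M hp hp' hz
    · exact Or.inr fun h => hN.prio_mono h M hp' hp hz
  · exact Or.inr fun h =>
      levelSet_mono hN hM (prio_mem_levelSet hN h M' hp') (prio_mem_levelSet hN h M hp)

/-- The intermediate value theorem along the lexicographic order of the parameters: a sum of
continuous increasing functions of the states attains every value between its extreme values. -/
lemma exists_param (hN : N.Admissible) {O : Fin n ⊕ Fin m → ℝ → ℝ} (hO : ∀ h, Continuous (O h))
    (mO : ∀ h, Monotone (O h)) {Q : ℝ} (hQa : ∑ h, O h (N.a h) ≤ Q)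
    (hQb : Q ≤ ∑ h, O h (N.b h)) :
    ∃ p : ℝ × ℝ, p.2 ∈ Icc (0 : ℝ) 1 ∧ ∑ h, O h (N.prio h p.1 p.2) = Q := by
  have z0 : (0 : ℝ) ∈ Icc (0 : ℝ) 1 := ⟨le_rfl, zero_le_one⟩
  have z1 : (1 : ℝ) ∈ Icc (0 : ℝ) 1 := ⟨zero_le_one, le_rfl⟩
  obtain ⟨Ml, hMl⟩ := exists_forall_prio_eq_left hN
  obtain ⟨Mr, hMr⟩ := exists_forall_prio_eq_right hN
  -- the largest `M` whose least states do not exceed the prescribed value; one-sided limits at this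
  -- `M` put the value between those for `z = 0` and `z = 1`
  set S : Set ℝ := {M | ∑ h, O h (N.prio h M 0) ≤ Q} with hS
  have lower : ∀ M M', M' < M → M ∈ S → M' ∈ S := fun M M' hM hMS =>
    (Finset.sum_le_sum fun h _ => mO h (levelSet_mono hN hM (prio_mem_levelSet hN h M' z0)
      (prio_mem_levelSet hN h M z0))).trans hMS
  have hne : S.Nonempty := ⟨Ml - 1, by
    change ∑ h, O h (N.prio h (Ml - 1) 0) ≤ Q
    simpa only [hMl (Ml - 1) (by linarith) _ 0 z0] using hQa⟩
  by_cases hb : Mr + 1 ∈ S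
  · refine ⟨(Mr + 1, 0), z0, le_antisymm hb ?_⟩
    simpa only [hMr (Mr + 1) (by linarith) _ 0 z0] using hQb
  have hbdd : BddAbove S := ⟨Mr + 1, fun M hM => by
    by_contra! hlt
    exact hb (lower M _ hlt hM)⟩
  set M := sSup S with hMdef
  have h0 : ∑ h, O h (N.prio h M 0) ≤ Q := by
    refine le_of_tendsto (tendsto_finsetSum _ fun h _ =>
      ((hO h).tendsto _).comp (tendsto_prio_left hN h M)) ?_
    filter_upwards [self_mem_nhdsWithin] with M' hM'
    obtain ⟨M'', h1, h2⟩ := exists_lt_of_lt_csSup hne hM'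
    exact lower M'' M' h2 h1
  have h1 : Q ≤ ∑ h, O h (N.prio h M 1) := by
    refine ge_of_tendsto (tendsto_finsetSum _ fun h _ =>
      ((hO h).tendsto _).comp (tendsto_prio_right hN h M)) ?_
    filter_upwards [self_mem_nhdsWithin] with M' hM'
    by_contra! hlt
    exact absurd (le_csSup hbdd (show M' ∈ S from hlt.le)) (not_le.2 hM')
  have hc : ContinuousOn (fun z => ∑ h, O h (N.prio h M z)) (Icc 0 1) :=
    continuousOn_finsetSum _ fun h _ => (hO h).comp_continuousOn (continuousOn_prio hN h M)
  obtain ⟨z, hz, e⟩ := intermediate_value_Icc zero_le_one hc ⟨h0, h1⟩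
  exact ⟨(M, z), hz, e⟩

end Junction

/-! ### The flux through the junction -/

lemma roadSign_mul_self {n m : ℕ} (h : Fin n ⊕ Fin m) : roadSign h * roadSign h = 1 := by
  cases h <;> simp [roadSign]

lemma abs_roadSign {n m : ℕ} (h : Fin n ⊕ Fin m) : |roadSign h| = 1 := by
  cases h <;> simp [roadSign]

lemma mem_roadDomain {n m : ℕ} (h : Fin n ⊕ Fin m) (x : ℝ) :
    x ∈ roadDomain h ↔ roadSign h * x < 0 := by
  cases h <;> simp [roadSign, roadDomain]

lemma measurableSet_roadDomain {n m : ℕ} (h : Fin n ⊕ Fin m) : MeasurableSet (roadDomain h) := by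
  cases h
  · exact measurableSet_Iio
  · exact measurableSet_Ioi

namespace Junction

variable {n m : ℕ} {N : Junction n m}

lemma measurableSet_K (N : Junction n m) (h : Fin n ⊕ Fin m) : MeasurableSet (N.K h) :=
  measurableSet_Icc

instance isFiniteMeasure_restrict_K (N : Junction n m) (h : Fin n ⊕ Fin m) :
    IsFiniteMeasure (volume.restrict (N.K h)) := by
  unfold K; infer_instance

/-- The characteristic speed `f_h'`, extended from `K_h` to the real line by its boundary
values. -/
def speed (N : Junction n m) (h : Fin n ⊕ Fin m) (ξ : ℝ) : ℝ :=
  N.df h (max (N.a h) (min (N.b h) ξ))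

lemma speed_eq {h : Fin n ⊕ Fin m} {ξ : ℝ} (hξ : ξ ∈ N.K h) : N.speed h ξ = N.df h ξ := by
  rw [speed, min_eq_right hξ.2, max_eq_right hξ.1]

lemma clamp_mem (hN : N.Admissible) (h : Fin n ⊕ Fin m) (ξ : ℝ) :
    max (N.a h) (min (N.b h) ξ) ∈ N.K h :=
  ⟨le_max_left _ _, max_le (hN.lt h).le (min_le_left _ _)⟩

lemma antitone_speed (hN : N.Admissible) (h : Fin n ⊕ Fin m) : Antitone (N.speed h) :=
  fun _ _ hxy => hN.df_antitone h (clamp_mem hN h _) (clamp_mem hN h _)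
    (max_le_max le_rfl (min_le_min le_rfl hxy))

lemma measurable_speed (hN : N.Admissible) (h : Fin n ⊕ Fin m) : Measurable (N.speed h) :=
  (antitone_speed hN h).measurable

lemma exists_abs_speed_le (hN : N.Admissible) : ∃ L, 0 ≤ L ∧ ∀ h ξ, |N.speed h ξ| ≤ L := by
  have key : ∀ h, ∀ ξ, |N.speed h ξ| ≤ |N.df h (N.a h)| + |N.df h (N.b h)| := fun h ξ => by
    have hc := clamp_mem hN h ξ
    have h1 := hN.df_antitone h ⟨le_rfl, (hN.lt h).le⟩ hc hc.1
    have h2 := hN.df_antitone h hc ⟨(hN.lt h).le, le_rfl⟩ hc.2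
    rw [speed, abs_le]
    constructor
    · linarith [neg_abs_le (N.df h (N.b h)), abs_nonneg (N.df h (N.a h))]
    · linarith [le_abs_self (N.df h (N.a h)), abs_nonneg (N.df h (N.b h))]
  refine ⟨∑ h, (|N.df h (N.a h)| + |N.df h (N.b h)|), by positivity, fun h ξ => (key h ξ).trans ?_⟩
  exact Finset.single_le_sum (f := fun h => |N.df h (N.a h)| + |N.df h (N.b h)|)
    (fun i _ => by positivity) (Finset.mem_univ h)

lemma ordConnected_speed_neg (hN : N.Admissible) (h : Fin n ⊕ Fin m) :
    {ξ | ξ ∈ N.K h ∧ roadSign h * N.speed h ξ < 0}.OrdConnected := by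
  refine ⟨fun x hx z hz y hy => ⟨⟨hx.1.1.trans hy.1, hy.2.trans hz.1.2⟩, ?_⟩⟩
  have h1 := antitone_speed hN h hy.1
  have h2 := antitone_speed hN h hy.2
  have h3 := hx.2
  have h4 := hz.2
  rcases h with i | j <;> simp only [roadSign] at * <;> linarith

lemma ordConnected_speed_nonneg (hN : N.Admissible) (h : Fin n ⊕ Fin m) :
    {ξ | ξ ∈ N.K h ∧ 0 ≤ roadSign h * N.speed h ξ}.OrdConnected := by
  refine ⟨fun x hx z hz y hy => ⟨⟨hx.1.1.trans hy.1, hy.2.trans hz.1.2⟩, ?_⟩⟩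
  have h1 := antitone_speed hN h hy.1
  have h2 := antitone_speed hN h hy.2
  have h3 := hx.2
  have h4 := hz.2
  rcases h with i | j <;> simp only [roadSign] at * <;> linarith

lemma Gout_ae_eq (hN : N.Admissible) (h : Fin n ⊕ Fin m) :
    N.Gout h =ᵐ[volume] {ξ | ξ ∈ N.K h ∧ roadSign h * N.speed h ξ < 0} := by
  have e : N.Gout h = closure {ξ | ξ ∈ N.K h ∧ roadSign h * N.speed h ξ < 0} := by
    rw [Gout]
    congr 1
    ext ξ
    exact and_congr_right fun hξ => by rw [speed_eq hξ]
  rw [e]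
  have hnull := (ordConnected_speed_neg hN h).convex.addHaar_frontier volume
  exact closure_ae_eq_of_null_frontier hnull

lemma Gin_ae_eq (hN : N.Admissible) (h : Fin n ⊕ Fin m) :
    N.Gin h =ᵐ[volume] {ξ | ξ ∈ N.K h ∧ 0 ≤ roadSign h * N.speed h ξ} := by
  have hnull := (ordConnected_speed_nonneg hN h).convex.addHaar_frontier volume
  have hsub : interior {ξ | ξ ∈ N.K h ∧ 0 ≤ roadSign h * N.speed h ξ} ⊆ N.Gin h := fun ξ hξ => by
    refine ⟨(interior_subset hξ).1, mem_nhdsWithin_of_mem_nhds ?_⟩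
    filter_upwards [mem_interior_iff_mem_nhds.1 hξ] with y hy
    rw [← speed_eq hy.1]; exact hy.2
  have hsup : N.Gin h ⊆ {ξ | ξ ∈ N.K h ∧ 0 ≤ roadSign h * N.speed h ξ} := fun ξ hξ =>
    ⟨hξ.1, by rw [speed_eq hξ.1]; exact hξ.2.self_of_nhdsWithin hξ.1⟩
  have h1 := interior_ae_eq_of_null_frontier hnull
  exact hsup.eventuallyLE.antisymm (h1.symm.le.trans hsub.eventuallyLE)

/-- The weight of the state `ξ` in the mass flux from the road `h` into the junction. -/
def inRate (N : Junction n m) (h : Fin n ⊕ Fin m) (ξ : ℝ) : ℝ :=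
  (N.K h).indicator (fun ξ => max (roadSign h * N.speed h ξ) 0) ξ

/-- The weight of the state `ξ` in the mass flux from the junction into the road `h`. -/
def outRate (N : Junction n m) (h : Fin n ⊕ Fin m) (ξ : ℝ) : ℝ :=
  (N.K h).indicator (fun ξ => max (-(roadSign h * N.speed h ξ)) 0) ξ

lemma inRate_nonneg (N : Junction n m) (h : Fin n ⊕ Fin m) (ξ : ℝ) : 0 ≤ N.inRate h ξ :=
  indicator_nonneg (fun _ _ => le_max_right _ _) ξ

lemma outRate_nonneg (N : Junction n m) (h : Fin n ⊕ Fin m) (ξ : ℝ) : 0 ≤ N.outRate h ξ :=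
  indicator_nonneg (fun _ _ => le_max_right _ _) ξ

lemma measurable_inRate (hN : N.Admissible) (h : Fin n ⊕ Fin m) : Measurable (N.inRate h) :=
  ((((measurable_speed hN h).const_mul _).max measurable_const)).indicator (N.measurableSet_K h)

lemma measurable_outRate (hN : N.Admissible) (h : Fin n ⊕ Fin m) : Measurable (N.outRate h) :=
  ((((measurable_speed hN h).const_mul _).neg.max measurable_const)).indicator
    (N.measurableSet_K h)

lemma inRate_le {L : ℝ} (hL0 : 0 ≤ L) {h : Fin n ⊕ Fin m} (hL : ∀ ξ, |N.speed h ξ| ≤ L) (ξ : ℝ) :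
    N.inRate h ξ ≤ L := by
  refine indicator_le_self' (fun _ _ => le_max_right _ _) ξ |>.trans (max_le ?_ hL0)
  refine (le_abs_self _).trans ?_
  rw [abs_mul, abs_roadSign, one_mul]; exact hL ξ

lemma outRate_le {L : ℝ} (hL0 : 0 ≤ L) {h : Fin n ⊕ Fin m} (hL : ∀ ξ, |N.speed h ξ| ≤ L) (ξ : ℝ) :
    N.outRate h ξ ≤ L := by
  refine indicator_le_self' (fun _ _ => le_max_right _ _) ξ |>.trans (max_le ?_ hL0)
  refine (neg_le_abs _).trans ?_
  rw [abs_mul, abs_roadSign, one_mul]; exact hL ξ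

lemma inRate_sub_outRate (N : Junction n m) (h : Fin n ⊕ Fin m) (ξ : ℝ) :
    N.inRate h ξ - N.outRate h ξ = (N.K h).indicator (fun ξ => roadSign h * N.speed h ξ) ξ := by
  by_cases hξ : ξ ∈ N.K h
  · simp only [inRate, outRate, indicator_of_mem hξ]
    rcases le_total 0 (roadSign h * N.speed h ξ) with h1 | h1
    · rw [max_eq_left h1, max_eq_right (by linarith)]; ring
    · rw [max_eq_right h1, max_eq_left (by linarith)]; ring
  · simp [inRate, outRate, hξ]

/-- A bounded weight supported in `K_h` times a kinetic function is integrable. -/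
lemma integrable_rate_mul {h : Fin n ⊕ Fin m} {r : ℝ → ℝ} (mr : Measurable r) {L : ℝ}
    (hr0 : ∀ ξ, 0 ≤ r ξ) (hr : ∀ ξ, r ξ ≤ L) (hrK : ∀ ξ ∉ N.K h, r ξ = 0) {g : ℝ → ℝ}
    (mg : Measurable g) (hg : ∀ᵐ ξ ∂(volume.restrict (N.K h)), |g ξ| ≤ 1) :
    Integrable fun ξ => r ξ * g ξ := by
  have h1 : IntegrableOn (fun ξ => r ξ * g ξ) (N.K h) := by
    refine Integrable.of_bound (mr.mul mg).aestronglyMeasurable L ?_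
    filter_upwards [hg] with ξ h2
    rw [Real.norm_eq_abs, abs_mul, abs_of_nonneg (hr0 ξ)]
    calc r ξ * |g ξ| ≤ r ξ * 1 := by gcongr; exact hr0 ξ
      _ ≤ L := by rw [mul_one]; exact hr ξ
  refine h1.integrable_of_forall_notMem_eq_zero fun ξ hξ => ?_
  rw [hrK ξ hξ, zero_mul]

lemma integrable_inRate_mul (hN : N.Admissible) (h : Fin n ⊕ Fin m) {g : ℝ → ℝ}
    (mg : Measurable g) (hg : ∀ᵐ ξ ∂(volume.restrict (N.K h)), |g ξ| ≤ 1) :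
    Integrable fun ξ => N.inRate h ξ * g ξ := by
  obtain ⟨L, hL0, hL⟩ := exists_abs_speed_le hN
  exact integrable_rate_mul (measurable_inRate hN h) (N.inRate_nonneg h)
    (inRate_le hL0 (hL h)) (fun ξ hξ => indicator_of_notMem hξ _) mg hg

lemma integrable_outRate_mul (hN : N.Admissible) (h : Fin n ⊕ Fin m) {g : ℝ → ℝ}
    (mg : Measurable g) (hg : ∀ᵐ ξ ∂(volume.restrict (N.K h)), |g ξ| ≤ 1) :
    Integrable fun ξ => N.outRate h ξ * g ξ := by
  obtain ⟨L, hL0, hL⟩ := exists_abs_speed_le hN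
  exact integrable_rate_mul (measurable_outRate hN h) (N.outRate_nonneg h)
    (outRate_le hL0 (hL h)) (fun ξ hξ => indicator_of_notMem hξ _) mg hg

/-- The mass flux from the road `h` into the junction carried by the kinetic values `g`. -/
def inflow (N : Junction n m) (h : Fin n ⊕ Fin m) (g : ℝ → ℝ) : ℝ := ∫ ξ, N.inRate h ξ * g ξ

/-- The mass flux from the junction into the road `h` carried by the equilibrium `χ(ρ, ·)`. -/
def outflow (N : Junction n m) (h : Fin n ⊕ Fin m) (ρ : ℝ) : ℝ := ∫ ξ, N.outRate h ξ * chi ρ ξ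

lemma integrable_outRate_mul_chi (hN : N.Admissible) (h : Fin n ⊕ Fin m) (ρ : ℝ) :
    Integrable fun ξ => N.outRate h ξ * chi ρ ξ :=
  integrable_outRate_mul hN h (measurable_chi_right ρ) (Eventually.of_forall (abs_chi_le_one ρ))

lemma monotone_outflow (hN : N.Admissible) (h : Fin n ⊕ Fin m) : Monotone (N.outflow h) :=
  fun _ _ hρ => integral_mono (integrable_outRate_mul_chi hN h _)
    (integrable_outRate_mul_chi hN h _)
    fun ξ => mul_le_mul_of_nonneg_left (chi_mono hρ ξ) (N.outRate_nonneg h ξ)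

lemma continuous_outflow (hN : N.Admissible) (h : Fin n ⊕ Fin m) : Continuous (N.outflow h) := by
  obtain ⟨L, hL0, hL⟩ := exists_abs_speed_le hN
  refine (LipschitzWith.of_dist_le_mul (K := L.toNNReal) fun ρ ρ' => ?_).continuous
  rw [Real.coe_toNNReal L hL0, dist_eq_norm, dist_eq_norm, outflow, outflow,
    ← integral_sub (integrable_outRate_mul_chi hN h _) (integrable_outRate_mul_chi hN h _)]
  rw [← ENNReal.ofReal_le_ofReal_iff (by positivity), ENNReal.ofReal_mul hL0, ofReal_norm,
    ofReal_norm]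
  refine (enorm_integral_le_lintegral_enorm _).trans ?_
  calc ∫⁻ ξ, ‖N.outRate h ξ * chi ρ ξ - N.outRate h ξ * chi ρ' ξ‖ₑ
      ≤ ∫⁻ ξ, ENNReal.ofReal L * ‖chi ρ ξ - chi ρ' ξ‖ₑ := by
        refine lintegral_mono fun ξ => ?_
        rw [← mul_sub, enorm_mul]
        gcongr
        rw [Real.enorm_eq_ofReal (N.outRate_nonneg h ξ)]
        exact ENNReal.ofReal_le_ofReal (outRate_le hL0 (hL h) ξ)
    _ ≤ ENNReal.ofReal L * ‖ρ - ρ'‖ₑ := by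
        rw [lintegral_const_mul' _ _ ENNReal.ofReal_ne_top]
        gcongr
        exact lintegral_chi_sub_le ρ ρ'

lemma setIntegral_Gout (hN : N.Admissible) (h : Fin n ⊕ Fin m) (F : ℝ → ℝ) :
    ∫ ξ in N.Gout h, N.df h ξ * F ξ = -(roadSign h * ∫ ξ, N.outRate h ξ * F ξ) := by
  have mA : MeasurableSet {ξ | ξ ∈ N.K h ∧ roadSign h * N.speed h ξ < 0} :=
    (N.measurableSet_K h).inter
      (measurableSet_lt ((measurable_speed hN h).const_mul _) measurable_const)
  rw [setIntegral_congr_set (Gout_ae_eq hN h), ← integral_indicator mA, ← integral_const_mul,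
    ← integral_neg]
  refine integral_congr_ae (Eventually.of_forall fun ξ => ?_)
  have hs := roadSign_mul_self h
  by_cases hK : ξ ∈ N.K h
  · by_cases hξ : roadSign h * N.speed h ξ < 0
    · have hm : ξ ∈ {ξ | ξ ∈ N.K h ∧ roadSign h * N.speed h ξ < 0} := ⟨hK, hξ⟩
      simp only [indicator_of_mem hm, outRate, indicator_of_mem hK]
      rw [max_eq_left (by linarith), ← speed_eq hK]
      linear_combination (-(N.speed h ξ * F ξ)) * hs
    · have hm : ξ ∉ {ξ | ξ ∈ N.K h ∧ roadSign h * N.speed h ξ < 0} := fun hm => hξ hm.2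
      simp only [indicator_of_notMem hm, outRate, indicator_of_mem hK]
      rw [max_eq_right (by linarith)]; ring
  · have hm : ξ ∉ {ξ | ξ ∈ N.K h ∧ roadSign h * N.speed h ξ < 0} := fun hm => hK hm.1
    simp only [indicator_of_notMem hm, outRate, indicator_of_notMem hK]; ring

lemma setIntegral_Gin (hN : N.Admissible) (h : Fin n ⊕ Fin m) (F : ℝ → ℝ) :
    ∫ ξ in N.Gin h, N.df h ξ * F ξ = roadSign h * ∫ ξ, N.inRate h ξ * F ξ := by
  have mA : MeasurableSet {ξ | ξ ∈ N.K h ∧ 0 ≤ roadSign h * N.speed h ξ} :=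
    (N.measurableSet_K h).inter
      (measurableSet_le measurable_const ((measurable_speed hN h).const_mul _))
  rw [setIntegral_congr_set (Gin_ae_eq hN h), ← integral_indicator mA, ← integral_const_mul]
  refine integral_congr_ae (Eventually.of_forall fun ξ => ?_)
  have hs := roadSign_mul_self h
  by_cases hK : ξ ∈ N.K h
  · by_cases hξ : 0 ≤ roadSign h * N.speed h ξ
    · have hm : ξ ∈ {ξ | ξ ∈ N.K h ∧ 0 ≤ roadSign h * N.speed h ξ} := ⟨hK, hξ⟩
      simp only [indicator_of_mem hm, inRate, indicator_of_mem hK]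
      rw [max_eq_left hξ, ← speed_eq hK]
      linear_combination (-(N.speed h ξ * F ξ)) * hs
    · have hm : ξ ∉ {ξ | ξ ∈ N.K h ∧ 0 ≤ roadSign h * N.speed h ξ} := fun hm => hξ hm.2
      simp only [indicator_of_notMem hm, inRate, indicator_of_mem hK]
      rw [max_eq_right (by linarith)]; ring
  · have hm : ξ ∉ {ξ | ξ ∈ N.K h ∧ 0 ≤ roadSign h * N.speed h ξ} := fun hm => hK hm.1
    simp only [indicator_of_notMem hm, inRate, indicator_of_notMem hK]; ring

/-- With the signs of the roads absorbed into the rates, the coupling condition says that the total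
outflow of the equilibria equals the total inflow of the data. -/
lemma isCouplingParam_iff (hN : N.Admissible) {g : Fin n ⊕ Fin m → ℝ → ℝ} {p : ℝ × ℝ} :
    N.IsCouplingParam g p ↔ p.2 ∈ Icc (0 : ℝ) 1 ∧
      ∑ h, N.outflow h (N.prio h p.1 p.2) = ∑ h, N.inflow h (g h) := by
  refine and_congr_right fun _ => ?_
  simp only [setIntegral_Gout hN, setIntegral_Gin hN, Fintype.sum_sum_type, roadSign, outflow,
    inflow, Finset.sum_add_distrib, one_mul, neg_mul, neg_neg, Finset.sum_neg_distrib]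
  constructor <;> intro h <;> linarith

lemma intervalIntegral_speed (hN : N.Admissible) (h : Fin n ⊕ Fin m) {ρ : ℝ} (hρ : ρ ∈ N.K h) :
    ∫ ξ in (0 : ℝ)..ρ, N.speed h ξ = N.f h ρ - N.f h 0 := by
  have hsub : uIcc 0 ρ ⊆ N.K h := uIcc_subset_Icc (hN.zero_mem h) hρ
  obtain ⟨L, hL⟩ := hN.flux_lipschitz h
  rw [← (hL.mono hsub).absolutelyContinuousOnInterval.integral_deriv_eq_sub]
  refine intervalIntegral.integral_congr_ae ?_
  filter_upwards [(ae_restrict_iff' (N.measurableSet_K h)).1 (hN.df_deriv h)] with ξ h1 h2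
  have hK := hsub (uIoc_subset_uIcc h2)
  rw [speed_eq hK, (h1 hK).deriv]

/-- The difference between the flux into and out of the junction in an equilibrium state. -/
lemma inflow_chi_sub_outflow (hN : N.Admissible) (h : Fin n ⊕ Fin m) {ρ : ℝ} (hρ : ρ ∈ N.K h) :
    N.inflow h (chi ρ) - N.outflow h ρ = roadSign h * (N.f h ρ - N.f h 0) := by
  rw [inflow, outflow, ← integral_sub (integrable_inRate_mul hN h (measurable_chi_right ρ)
    (Eventually.of_forall (abs_chi_le_one ρ))) (integrable_outRate_mul_chi hN h ρ),
    ← intervalIntegral_speed hN h hρ, ← setIntegral_mul_chi (hN.zero_mem h) hρ,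
    ← integral_const_mul, ← integral_indicator measurableSet_Icc]
  refine integral_congr_ae (Eventually.of_forall fun ξ => ?_)
  simp only [← sub_mul, inRate_sub_outRate, K]
  by_cases hξ : ξ ∈ Icc (N.a h) (N.b h) <;> simp [hξ, mul_assoc]

/-- The total inflow of admissible data lies between the outflows of the extreme states `a_h` and
`b_h`. The kinetic values lie between `χ(a_h, ·)` and `χ(b_h, ·)`, and for these two equilibria
inflow and outflow agree in total, because the flux vanishes at the end points and balances at the
state `0`. -/
lemma sum_inflow_mem (hN : N.Admissible) {g : Fin n ⊕ Fin m → ℝ → ℝ} (mg : ∀ h, Measurable (g h))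
    (hg : ∀ h, ∀ᵐ ξ ∂(volume.restrict (N.K h)), g h ξ ∈ kinSet ξ) :
    ∑ h, N.inflow h (g h) ∈ Icc (∑ h, N.outflow h (N.a h)) (∑ h, N.outflow h (N.b h)) := by
  have bal : ∑ h, roadSign h * N.f h 0 = 0 := by
    simp only [Fintype.sum_sum_type, roadSign, one_mul, neg_mul, Finset.sum_neg_distrib]
    linarith [hN.flux_balance]
  have ha : ∀ h, N.a h ∈ N.K h := fun h => ⟨le_rfl, (hN.lt h).le⟩
  have hb : ∀ h, N.b h ∈ N.K h := fun h => ⟨(hN.lt h).le, le_rfl⟩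
  have ig : ∀ h, Integrable fun ξ => N.inRate h ξ * g h ξ := fun h =>
    integrable_inRate_mul hN h (mg h) ((hg h).mono fun ξ => abs_le_one_of_mem_kinSet)
  have ichi : ∀ h ρ, Integrable fun ξ => N.inRate h ξ * chi ρ ξ := fun h ρ =>
    integrable_inRate_mul hN h (measurable_chi_right ρ) (Eventually.of_forall (abs_chi_le_one ρ))
  have ea : ∑ h, N.outflow h (N.a h) = ∑ h, N.inflow h (chi (N.a h)) := by
    rw [← sub_eq_zero, ← neg_eq_zero, neg_sub, ← Finset.sum_sub_distrib]
    simp only [fun h => inflow_chi_sub_outflow hN h (ha h), hN.flux_left, zero_sub, mul_neg,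
      Finset.sum_neg_distrib, bal, neg_zero]
  have eb : ∑ h, N.outflow h (N.b h) = ∑ h, N.inflow h (chi (N.b h)) := by
    rw [← sub_eq_zero, ← neg_eq_zero, neg_sub, ← Finset.sum_sub_distrib]
    simp only [fun h => inflow_chi_sub_outflow hN h (hb h), hN.flux_right, zero_sub, mul_neg,
      Finset.sum_neg_distrib, bal, neg_zero]
  have hne : ∀ y : ℝ, ∀ᵐ ξ : ℝ, ξ ≠ y := fun y => by simp [ae_iff]
  rw [ea, eb]
  constructor <;> refine Finset.sum_le_sum fun h _ => ?_
  · refine integral_mono_ae (ichi h _) (ig h) ?_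
    filter_upwards [(ae_restrict_iff' (N.measurableSet_K h)).1 (hg h), hne (N.a h)] with ξ h1 h2
    by_cases hξ : ξ ∈ N.K h
    · exact mul_le_mul_of_nonneg_left (chi_le_of_lt (h1 hξ) (lt_of_le_of_ne hξ.1 h2.symm))
        (N.inRate_nonneg h ξ)
    · simp [inRate, hξ]
  · refine integral_mono_ae (ig h) (ichi h _) ?_
    filter_upwards [(ae_restrict_iff' (N.measurableSet_K h)).1 (hg h), hne (N.b h)] with ξ h1 h2
    by_cases hξ : ξ ∈ N.K h
    · exact mul_le_mul_of_nonneg_left (le_chi_of_lt (h1 hξ) (lt_of_le_of_ne hξ.2 h2))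
        (N.inRate_nonneg h ξ)
    · simp [inRate, hξ]

/-- The coupling is an `L¹` contraction with respect to the fluxes: the states of all roads are
ordered in the same way, so that no cancellation occurs in the difference of the outflows. -/
lemma coupling_contraction (hN : N.Admissible) {g g' : Fin n ⊕ Fin m → ℝ → ℝ} {p p' : ℝ × ℝ}
    (mg : ∀ h, Measurable (g h)) (hg : ∀ h, ∀ᵐ ξ ∂(volume.restrict (N.K h)), g h ξ ∈ kinSet ξ)
    (mg' : ∀ h, Measurable (g' h))
    (hg' : ∀ h, ∀ᵐ ξ ∂(volume.restrict (N.K h)), g' h ξ ∈ kinSet ξ)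
    (hp : N.IsCouplingParam g p) (hp' : N.IsCouplingParam g' p') :
    ∑ h, ∫⁻ ξ, ‖N.outRate h ξ * (chi (N.prio h p.1 p.2) ξ - chi (N.prio h p'.1 p'.2) ξ)‖ₑ
      ≤ ∑ h, ∫⁻ ξ, ‖N.inRate h ξ * (g h ξ - g' h ξ)‖ₑ := by
  rw [isCouplingParam_iff hN] at hp hp'
  wlog hle : ∀ h, N.prio h p'.1 p'.2 ≤ N.prio h p.1 p.2 generalizing p p' g g'
  · have := this mg' hg' mg hg hp' hp ((prio_le_or_ge hN hp.1 hp'.1).resolve_right hle)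
    simpa only [← neg_sub (g' _ _), ← neg_sub (chi (N.prio _ p'.1 p'.2) _), mul_neg, enorm_neg]
      using this
  have ig : ∀ h, Integrable fun ξ => N.inRate h ξ * g h ξ := fun h =>
    integrable_inRate_mul hN h (mg h) ((hg h).mono fun ξ => abs_le_one_of_mem_kinSet)
  have ig' : ∀ h, Integrable fun ξ => N.inRate h ξ * g' h ξ := fun h =>
    integrable_inRate_mul hN h (mg' h) ((hg' h).mono fun ξ => abs_le_one_of_mem_kinSet)
  have io := integrable_outRate_mul_chi hN
  calc ∑ h, ∫⁻ ξ, ‖N.outRate h ξ * (chi (N.prio h p.1 p.2) ξ - chi (N.prio h p'.1 p'.2) ξ)‖ₑ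
      = ∑ h, ENNReal.ofReal (N.outflow h (N.prio h p.1 p.2)
          - N.outflow h (N.prio h p'.1 p'.2)) := by
        refine Finset.sum_congr rfl fun h _ => ?_
        have hnn : ∀ ξ, 0 ≤ N.outRate h ξ * chi (N.prio h p.1 p.2) ξ
            - N.outRate h ξ * chi (N.prio h p'.1 p'.2) ξ := fun ξ => by
          rw [← mul_sub]
          exact mul_nonneg (N.outRate_nonneg h ξ) (sub_nonneg.2 (chi_mono (hle h) ξ))
        rw [outflow, outflow, ← integral_sub (io h _) (io h _),
          ofReal_integral_eq_lintegral_ofReal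
            (f := fun ξ => N.outRate h ξ * chi (N.prio h p.1 p.2) ξ
              - N.outRate h ξ * chi (N.prio h p'.1 p'.2) ξ)
            ((io h _).sub (io h _)) (Eventually.of_forall hnn)]
        refine lintegral_congr fun ξ => ?_
        rw [mul_sub, Real.enorm_eq_ofReal (hnn ξ)]
    _ = ENNReal.ofReal (∑ h, (N.inflow h (g h) - N.inflow h (g' h))) := by
        rw [← ENNReal.ofReal_sum_of_nonneg fun h _ =>
          sub_nonneg.2 (monotone_outflow hN h (hle h)), Finset.sum_sub_distrib,
          Finset.sum_sub_distrib, hp.2, hp'.2]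
    _ ≤ ∑ h, ‖N.inflow h (g h) - N.inflow h (g' h)‖ₑ := by
        refine (Real.ofReal_le_enorm _).trans (enorm_sum_le _ _)
    _ ≤ ∑ h, ∫⁻ ξ, ‖N.inRate h ξ * (g h ξ - g' h ξ)‖ₑ := by
        refine Finset.sum_le_sum fun h _ => ?_
        rw [inflow, inflow, ← integral_sub (ig h) (ig' h)]
        refine (enorm_integral_le_lintegral_enorm _).trans_eq ?_
        simp only [mul_sub]

/-- The states selected by the coupling can be chosen as increasing, and therefore measurable,
functions of the total flux. -/
lemma exists_monotone_state (hN : N.Admissible) :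
    ∃ R : Fin n ⊕ Fin m → ℝ → ℝ, (∀ h, Monotone (R h)) ∧
      ∀ Q ∈ Icc (∑ h, N.outflow h (N.a h)) (∑ h, N.outflow h (N.b h)),
        ∃ p : ℝ × ℝ, p.2 ∈ Icc (0 : ℝ) 1 ∧ ∑ h, N.outflow h (N.prio h p.1 p.2) = Q ∧
          ∀ h, N.prio h p.1 p.2 = R h Q := by
  set J := Icc (∑ h, N.outflow h (N.a h)) (∑ h, N.outflow h (N.b h))
  -- outside `J` the choice of the parameter is immaterial
  have hex : ∀ Q : ℝ, ∃ p : ℝ × ℝ, p.2 ∈ Icc (0 : ℝ) 1 ∧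
      (Q ∈ J → ∑ h, N.outflow h (N.prio h p.1 p.2) = Q) := fun Q => by
    by_cases hQ : Q ∈ J
    · obtain ⟨p, h1, h2⟩ := exists_param hN (continuous_outflow hN) (monotone_outflow hN) hQ.1 hQ.2
      exact ⟨p, h1, fun _ => h2⟩
    · exact ⟨0, ⟨le_rfl, zero_le_one⟩, fun h => absurd h hQ⟩
  choose P hP1 hP2 using hex
  -- a larger flux cannot be obtained from parameters all of whose states are smaller
  have hmono : ∀ h, MonotoneOn (fun Q => N.prio h (P Q).1 (P Q).2) J := by
    intro h Q hQ Q' hQ' hle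
    rcases hle.eq_or_lt with rfl | hlt
    · exact le_rfl
    refine (prio_le_or_ge hN (hP1 Q) (hP1 Q')).resolve_right (fun hge => ?_) h
    have := Finset.sum_le_sum fun h (_ : h ∈ Finset.univ) => monotone_outflow hN h (hge h)
    rw [hP2 Q hQ, hP2 Q' hQ'] at this
    exact this.not_gt hlt
  have hbd : ∀ h, (fun Q => N.prio h (P Q).1 (P Q).2) '' J ⊆ N.K h := by
    rintro h _ ⟨Q, -, rfl⟩
    exact prio_mem_K hN h _ (hP1 Q)
  choose R hR1 hR2 using fun h => (hmono h).exists_monotone_extension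
    (bddBelow_Icc.mono (hbd h)) (bddAbove_Icc.mono (hbd h))
  exact ⟨R, hR1, fun Q hQ => ⟨P Q, hP1 Q, hP2 Q hQ, fun h => hR2 h hQ⟩⟩

end Junction

/-! ### Kinetic functions and their densities -/

lemma measurableSet_kinSet : MeasurableSet {z : ℝ × ℝ | z.2 ∈ kinSet z.1} := by
  have hs : Measurable Real.sign :=
    Measurable.ite measurableSet_Iio measurable_const
      (Measurable.ite measurableSet_Ioi measurable_const measurable_const)
  exact (measurableSet_eq_fun ((hs.comp measurable_fst).mul measurable_snd)
    (measurable_snd.norm)).inter (measurableSet_le measurable_snd.norm measurable_const)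

/-- The density `∫ U(t, x, ξ) dξ` of a function on the whole space. -/
def dens (U : ℝ × ℝ × ℝ → ℝ) (z : ℝ × ℝ) : ℝ := ∫ ξ, U (z.1, z.2, ξ)

/-- The equilibrium `χ(ρ_U(t, x), ξ)` belonging to `U`. -/
def equil (U : ℝ × ℝ × ℝ → ℝ) (q : ℝ × ℝ × ℝ) : ℝ := chi (dens U (q.1, q.2.1)) q.2.2

lemma measurable_dens {U : ℝ × ℝ × ℝ → ℝ} (mU : Measurable U) : Measurable (dens U) := by
  have : StronglyMeasurable fun w : (ℝ × ℝ) × ℝ => U (w.1.1, w.1.2, w.2) :=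
    (mU.comp (by fun_prop)).stronglyMeasurable
  exact this.integral_prod_right'.measurable

lemma measurable_equil {U : ℝ × ℝ × ℝ → ℝ} (mU : Measurable U) : Measurable (equil U) :=
  measurable_chi.comp (((measurable_dens mU).comp (by fun_prop :
    Measurable fun q : ℝ × ℝ × ℝ => (q.1, q.2.1))).prodMk (by fun_prop))

namespace Junction

open KineticTransport

variable {n m : ℕ} {N : Junction n m} {h : Fin n ⊕ Fin m}

/-- A measurable function of `(t, x, ξ)` with values in `D_ξ` that vanishes for
`(x, ξ) ∉ Ω_h × K_h`. -/
structure IsKinetic (N : Junction n m) (h : Fin n ⊕ Fin m) (U : ℝ × ℝ × ℝ → ℝ) : Prop where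
  meas : Measurable U
  mem_kinSet : ∀ q, U q ∈ kinSet q.2.2
  support : ∀ q : ℝ × ℝ × ℝ, q.2 ∉ roadDomain h ×ˢ N.K h → U q = 0

lemma IsKinetic.abs_le {U : ℝ × ℝ × ℝ → ℝ} (hU : N.IsKinetic h U) (q : ℝ × ℝ × ℝ) : |U q| ≤ 1 :=
  abs_le_one_of_mem_kinSet (hU.mem_kinSet q)

lemma IsKinetic.integrable_slice {U : ℝ × ℝ × ℝ → ℝ} (hU : N.IsKinetic h U) (t x : ℝ) :
    Integrable fun ξ => U (t, x, ξ) := by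
  have h1 : IntegrableOn (fun ξ => U (t, x, ξ)) (N.K h) :=
    Integrable.of_bound (hU.meas.comp (by fun_prop)).aestronglyMeasurable 1
      (Eventually.of_forall fun _ => hU.abs_le _)
  exact h1.integrable_of_forall_notMem_eq_zero fun _ hξ => hU.support _ fun hm => hξ hm.2

lemma IsKinetic.setIntegral_eq_dens {U : ℝ × ℝ × ℝ → ℝ} (hU : N.IsKinetic h U) (t x : ℝ) :
    ∫ ξ in N.K h, U (t, x, ξ) = dens U (t, x) :=
  setIntegral_eq_integral_of_forall_compl_eq_zero fun _ hξ => hU.support _ fun hm => hξ hm.2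

lemma IsKinetic.dens_mem (hN : N.Admissible) {U : ℝ × ℝ × ℝ → ℝ} (hU : N.IsKinetic h U)
    (z : ℝ × ℝ) : dens U z ∈ N.K h := by
  rw [← Prod.mk.eta (p := z), ← hU.setIntegral_eq_dens z.1 z.2]
  exact integral_mem_Icc_of_kinSet (hN.zero_mem h) (hU.meas.comp (by fun_prop)).aestronglyMeasurable
    (Eventually.of_forall fun ξ => hU.mem_kinSet (z.1, z.2, ξ))

lemma IsKinetic.isKinetic_equil (hN : N.Admissible) {U : ℝ × ℝ × ℝ → ℝ} (hU : N.IsKinetic h U) :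
    N.IsKinetic h (equil U) := by
  refine ⟨measurable_equil hU.meas, fun q => chi_mem_kinSet _ _, fun q hq => ?_⟩
  by_cases hx : q.2.1 ∈ roadDomain h
  · have hξ : q.2.2 ∉ N.K h := fun hξ => hq ⟨hx, hξ⟩
    have h1 := hU.dens_mem hN (q.1, q.2.1)
    have h0 := hN.zero_mem h
    simp only [K, mem_Icc, not_and_or, not_le] at h1 hξ h0
    unfold equil chi
    split_ifs <;> first | rfl | (exfalso; grind)
  · have : dens U (q.1, q.2.1) = 0 := by
      rw [dens, ← integral_zero ℝ ℝ]
      exact integral_congr_ae (Eventually.of_forall fun ξ => hU.support _ fun hm => hx hm.1)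
    unfold equil
    rw [this]
    unfold chi
    split_ifs <;> first | rfl | (exfalso; grind)

lemma lintegral_dens_sub_le {U V : ℝ × ℝ × ℝ → ℝ} (hU : N.IsKinetic h U) (hV : N.IsKinetic h V)
    (t s : ℝ) :
    ∫⁻ x, ‖dens U (t, x) - dens V (s, x)‖ₑ ≤ ∫⁻ p, ‖U (t, p) - V (s, p)‖ₑ := by
  have mm : Measurable fun p : ℝ × ℝ => ‖U (t, p) - V (s, p)‖ₑ :=
    ((hU.meas.comp (by fun_prop)).sub (hV.meas.comp (by fun_prop))).enorm
  rw [Measure.volume_eq_prod, lintegral_prod _ mm.aemeasurable]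
  refine lintegral_mono fun x => ?_
  rw [dens, dens, ← integral_sub (hU.integrable_slice t x) (hV.integrable_slice s x)]
  exact enorm_integral_le_lintegral_enorm _

/-- The map from a kinetic function to its equilibrium is nonexpansive in `L¹`. -/
lemma lintegral_equil_sub_le {U V : ℝ × ℝ × ℝ → ℝ} (hU : N.IsKinetic h U) (hV : N.IsKinetic h V)
    (t s : ℝ) :
    ∫⁻ p, ‖equil U (t, p) - equil V (s, p)‖ₑ ≤ ∫⁻ p, ‖U (t, p) - V (s, p)‖ₑ := by
  have mm : Measurable fun p : ℝ × ℝ => ‖equil U (t, p) - equil V (s, p)‖ₑ :=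
    (((measurable_equil hU.meas).comp (by fun_prop)).sub
      ((measurable_equil hV.meas).comp (by fun_prop))).enorm
  refine le_trans ?_ (lintegral_dens_sub_le hU hV t s)
  rw [Measure.volume_eq_prod, lintegral_prod _ mm.aemeasurable]
  exact lintegral_mono fun x => lintegral_chi_sub_le _ _

lemma isKinetic_zero (N : Junction n m) (h : Fin n ⊕ Fin m) : N.IsKinetic h fun _ => 0 :=
  ⟨measurable_const, fun _ => zero_mem_kinSet _, fun _ _ => rfl⟩

lemma equil_zero (q : ℝ × ℝ × ℝ) : equil (fun _ => 0) q = 0 := by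
  simp only [equil, dens, integral_zero]
  unfold chi
  split_ifs <;> first | rfl | (exfalso; grind)

lemma lintegral_equil_le {U : ℝ × ℝ × ℝ → ℝ} (hU : N.IsKinetic h U) (t : ℝ) :
    ∫⁻ p, ‖equil U (t, p)‖ₑ ≤ ∫⁻ p, ‖U (t, p)‖ₑ := by
  simpa only [equil_zero, sub_zero] using lintegral_equil_sub_le hU (N.isKinetic_zero h) t 0

lemma exists_lintegral_le_of_continuousInL1 {U : ℝ × ℝ × ℝ → ℝ} (cU : ContinuousInL1 U) (T : ℝ) :
    ∃ C : ℝ≥0, ∀ t ∈ Icc 0 T, ∫⁻ p, ‖U (t, p)‖ₑ ≤ C := by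
  refine IsCompact.induction_on (p := fun s => ∃ C : ℝ≥0, ∀ t ∈ s, ∫⁻ p, ‖U (t, p)‖ₑ ≤ C)
    isCompact_Icc ⟨0, fun t ht => ht.elim⟩ (fun s t hst ⟨C, hC⟩ => ⟨C, fun r hr => hC r (hst hr)⟩)
    ?_ fun t₀ ht₀ => ?_
  · rintro s t ⟨C, hC⟩ ⟨D, hD⟩
    refine ⟨C + D, ?_⟩
    rintro r (hr | hr)
    · exact (hC r hr).trans (by simp)
    · exact (hD r hr).trans (by simp)
  · have h1 : ∫⁻ p, ‖U (t₀, p)‖ₑ < ∞ := (cU.1 t₀ ht₀.1).2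
    have h2 : ∀ᶠ t in 𝓝[Icc 0 T] t₀, ∫⁻ p, ‖U (t, p) - U (t₀, p)‖ₑ ≤ 1 :=
      ((cU.2 t₀ ht₀.1).mono_left (nhdsWithin_mono _ fun t ht => ht.1)).eventually_le_const
        one_pos
    refine ⟨_, inter_mem h2 self_mem_nhdsWithin, (∫⁻ p, ‖U (t₀, p)‖ₑ).toNNReal + 1,
      fun t ht => ?_⟩
    rw [ENNReal.coe_add, ENNReal.coe_toNNReal h1.ne, ENNReal.coe_one]
    have m0 : AEMeasurable fun p => ‖U (t₀, p)‖ₑ := (cU.1 t₀ ht₀.1).aestronglyMeasurable.enorm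
    calc ∫⁻ p, ‖U (t, p)‖ₑ ≤ ∫⁻ p, (‖U (t₀, p)‖ₑ + ‖U (t, p) - U (t₀, p)‖ₑ) := by
          refine lintegral_mono fun p => ?_
          calc ‖U (t, p)‖ₑ = ‖U (t₀, p) + (U (t, p) - U (t₀, p))‖ₑ := by congr 1; ring
            _ ≤ _ := enorm_add_le _ _
      _ = (∫⁻ p, ‖U (t₀, p)‖ₑ) + ∫⁻ p, ‖U (t, p) - U (t₀, p)‖ₑ := lintegral_add_left' m0 _
      _ ≤ _ := by gcongr; exact ht.1

/-- Boundary values `γ` on the road `h`, written as a source at `x = 0` of the transport equation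
on the whole line for the extension of the solution by zero. -/
def crossData (N : Junction n m) (h : Fin n ⊕ Fin m) (γ : ℝ × ℝ → ℝ) (q : ℝ × ℝ) : ℝ :=
  (N.K h).indicator (fun ξ => -(roadSign h * γ (q.1, ξ))) q.2

lemma measurable_crossData {γ : ℝ × ℝ → ℝ} (mγ : Measurable γ) :
    Measurable (N.crossData h γ) := by
  have : N.crossData h γ = ((Prod.snd : ℝ × ℝ → ℝ) ⁻¹' N.K h).indicator
      fun q => -(roadSign h * γ q) := by
    ext q
    by_cases hq : q.2 ∈ N.K h
    · rw [crossData, indicator_of_mem hq, indicator_of_mem (show q ∈ Prod.snd ⁻¹' N.K h from hq)]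
    · rw [crossData, indicator_of_notMem hq,
        indicator_of_notMem (show q ∉ Prod.snd ⁻¹' N.K h from hq)]
  rw [this]
  exact (mγ.const_mul _).neg.indicator (measurable_snd (N.measurableSet_K h))

lemma abs_crossData_le {γ : ℝ × ℝ → ℝ} (bγ : ∀ q, |γ q| ≤ 1) (q : ℝ × ℝ) :
    |N.crossData h γ q| ≤ 1 := by
  by_cases hq : q.2 ∈ N.K h
  · rw [crossData, indicator_of_mem hq, abs_neg, abs_mul, abs_roadSign, one_mul]; exact bγ _
  · simp [crossData, hq]

/-- Boundary values bounded by one supply mass at a bounded rate, since `K_h` is bounded. -/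
lemma isData_crossData (hN : N.Admissible) {U₀ : ℝ × ℝ → ℝ} (mU₀ : Measurable U₀)
    (bU₀ : ∀ p, |U₀ p| ≤ 1) (iU₀ : ∫⁻ p, ‖U₀ p‖ₑ < ∞) {X : ℝ × ℝ × ℝ → ℝ} (mX : Measurable X)
    (bX : ∃ C, ∀ q, |X q| ≤ C)
    (iX : ∀ T : ℝ, ∃ C : ℝ≥0, ∀ s ∈ Ioo 0 T, ∫⁻ p, ‖X (s, p)‖ₑ ≤ C)
    {γ : ℝ × ℝ → ℝ} (mγ : Measurable γ) (bγ : ∀ q, |γ q| ≤ 1) :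
    IsData (N.speed h) U₀ X (N.crossData h γ) := by
  obtain ⟨L, hL0, hL⟩ := exists_abs_speed_le hN
  refine ⟨mU₀, ⟨1, bU₀⟩, iU₀, mX, bX, measurable_crossData mγ, ⟨1, abs_crossData_le bγ⟩,
    fun T => ?_⟩
  obtain ⟨C, hC⟩ := iX T
  refine ⟨C + L.toNNReal * (volume (N.K h)).toNNReal, fun s hs => ?_⟩
  push_cast
  refine add_le_add (hC s hs) ?_
  have hfin : volume (N.K h) ≠ ∞ := by simp [K]
  rw [ENNReal.coe_toNNReal hfin, crossFlux]
  calc ∫⁻ ξ, ‖N.speed h ξ * N.crossData h γ (s, ξ)‖ₑ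
      ≤ ∫⁻ ξ, (N.K h).indicator (fun _ => (L.toNNReal : ℝ≥0∞)) ξ := by
        refine lintegral_mono fun ξ => ?_
        by_cases hξ : ξ ∈ N.K h
        · rw [indicator_of_mem hξ, Real.enorm_eq_ofReal_abs, abs_mul]
          refine ENNReal.ofReal_le_ofReal ?_
          calc |N.speed h ξ| * |N.crossData h γ (s, ξ)| ≤ L * 1 :=
              mul_le_mul (hL h ξ) (abs_crossData_le bγ _) (abs_nonneg _) hL0
            _ = L := mul_one L
        · simp [crossData, hξ]
    _ = _ := by rw [lintegral_indicator (N.measurableSet_K h), setLIntegral_const]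

/-! ### Representatives of curves in `L¹` -/

lemma phase_eq_prod (N : Junction n m) (h : Fin n ⊕ Fin m) :
    N.phase h = (volume.restrict (roadDomain h)).prod (volume.restrict (N.K h)) := by
  rw [phase, Measure.volume_eq_prod, Measure.prod_restrict]

lemma lintegral_sub_eq_of_ae_eq {f g : ℝ × ℝ → ℝ} {u v : N.Kin h}
    (hf : ∀ p ∉ roadDomain h ×ˢ N.K h, f p = 0) (hg : ∀ p ∉ roadDomain h ×ˢ N.K h, g p = 0)
    (hfu : ∀ᵐ p ∂(N.phase h), f p = u p) (hgv : ∀ᵐ p ∂(N.phase h), g p = v p) :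
    ∫⁻ p, ‖f p - g p‖ₑ = ‖u - v‖ₑ := by
  have mS : MeasurableSet (roadDomain h ×ˢ N.K h) :=
    (measurableSet_roadDomain h).prod (N.measurableSet_K h)
  rw [Lp.enorm_def, eLpNorm_one_eq_lintegral_enorm]
  calc ∫⁻ p, ‖f p - g p‖ₑ
      = ∫⁻ p, (roadDomain h ×ˢ N.K h).indicator (fun p => ‖f p - g p‖ₑ) p := by
        refine lintegral_congr fun p => ?_
        by_cases hp : p ∈ roadDomain h ×ˢ N.K h
        · rw [indicator_of_mem hp]
        · rw [indicator_of_notMem hp, hf p hp, hg p hp, sub_zero, enorm_zero]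
    _ = ∫⁻ p, ‖f p - g p‖ₑ ∂(N.phase h) := lintegral_indicator mS _
    _ = _ := by
        refine lintegral_congr_ae ?_
        filter_upwards [hfu, hgv, Lp.coeFn_sub u v] with p h1 h2 h3
        rw [h1, h2, h3, Pi.sub_apply]

/-- `U` is a kinetic function that represents the curve `u`. -/
structure Represents (N : Junction n m) (h : Fin n ⊕ Fin m) (u : C(ℝ≥0, N.Kin h))
    (U : ℝ × ℝ × ℝ → ℝ) : Prop extends N.IsKinetic h U where
  ae_eq : ∀ t : ℝ≥0, ∀ᵐ p ∂(N.phase h), U (t, p) = u t p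

/-- A curve with admissible values has a jointly measurable representative; the values that are not
admissible, or not on the road, are replaced by zero. -/
lemma exists_represents {u : C(ℝ≥0, N.Kin h)} (hu : ∀ t, N.TakesKinValues h (u t)) :
    ∃ U, N.Represents h u U := by
  classical
  obtain ⟨G, mG, hG⟩ := exists_measurable_representative u
  have mG' : Measurable fun q : ℝ × ℝ × ℝ => G (q.1.toNNReal, q.2) := mG.comp
    ((measurable_real_toNNReal.comp measurable_fst).prodMk measurable_snd)
  have mS : MeasurableSet {q : ℝ × ℝ × ℝ | q.2 ∈ roadDomain h ×ˢ N.K h} :=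
    measurable_snd ((measurableSet_roadDomain h).prod (N.measurableSet_K h))
  have mk : MeasurableSet {q : ℝ × ℝ × ℝ | G (q.1.toNNReal, q.2) ∈ kinSet q.2.2} :=
    (measurable_snd.snd.prodMk mG') measurableSet_kinSet
  refine ⟨fun q => if q.2 ∈ roadDomain h ×ˢ N.K h ∧ G (q.1.toNNReal, q.2) ∈ kinSet q.2.2 then
    G (q.1.toNNReal, q.2) else 0, ⟨⟨Measurable.ite (mS.inter mk) mG' measurable_const,
    fun q => ?_, fun q hq => if_neg fun hh => hq hh.1⟩, fun t => ?_⟩⟩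
  · split_ifs with hq
    · exact hq.2
    · exact zero_mem_kinSet _
  · filter_upwards [hG t, hu t, ae_restrict_mem
      ((measurableSet_roadDomain h).prod (N.measurableSet_K h))] with p h1 h2 h3
    rw [← h1] at h2 ⊢
    simp only [Real.toNNReal_coe, if_pos (And.intro h3 h2)]

lemma Represents.lintegral_sub {u v : C(ℝ≥0, N.Kin h)} {U V : ℝ × ℝ × ℝ → ℝ}
    (hU : N.Represents h u U) (hV : N.Represents h v V) (t s : ℝ≥0) :
    ∫⁻ p, ‖U (t, p) - V (s, p)‖ₑ = ‖u t - v s‖ₑ :=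
  lintegral_sub_eq_of_ae_eq (fun p hp => hU.support (t, p) hp) (fun p hp => hV.support (s, p) hp)
    (hU.ae_eq t) (hV.ae_eq s)

lemma Represents.lintegral_eq {u : C(ℝ≥0, N.Kin h)} {U : ℝ × ℝ × ℝ → ℝ}
    (hU : N.Represents h u U) (t : ℝ≥0) : ∫⁻ p, ‖U (t, p)‖ₑ = ‖u t‖ₑ := by
  have := lintegral_sub_eq_of_ae_eq (g := fun _ => 0) (v := 0)
    (fun p hp => hU.support (t, p) hp) (fun p hp => rfl) (hU.ae_eq t)
    ((Lp.coeFn_zero ℝ 1 (N.phase h)).mono fun p hp => hp.symm)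
  simpa only [sub_zero] using this

lemma Represents.continuousInL1 {u : C(ℝ≥0, N.Kin h)} {U : ℝ × ℝ × ℝ → ℝ}
    (hU : N.Represents h u U) : ContinuousInL1 U := by
  refine ⟨fun t ht => ⟨(hU.meas.comp measurable_prodMk_left).aestronglyMeasurable, ?_⟩,
    fun t₀ ht₀ => ?_⟩
  · lift t to ℝ≥0 using ht
    rw [HasFiniteIntegral, hU.lintegral_eq]
    exact enorm_lt_top
  · lift t₀ to ℝ≥0 using ht₀
    have h1 : Tendsto (fun t : ℝ => ‖u t.toNNReal - u t₀‖ₑ) (𝓝[Ici 0] (t₀ : ℝ)) (𝓝 0) := by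
      have : Continuous fun t : ℝ => ‖u t.toNNReal - u t₀‖ₑ := by fun_prop
      simpa using (this.tendsto (t₀ : ℝ)).mono_left nhdsWithin_le_nhds
    refine h1.congr' ?_
    filter_upwards [self_mem_nhdsWithin] with t ht
    lift t to ℝ≥0 using ht
    rw [hU.lintegral_sub hU, Real.toNNReal_coe]

lemma Represents.density_eq {u : C(ℝ≥0, N.Kin h)} {U : ℝ × ℝ × ℝ → ℝ}
    (hU : N.Represents h u U) (t : ℝ≥0) :
    ∀ᵐ x ∂(volume.restrict (roadDomain h)), N.density h (u t) x = dens U (t, x) := by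
  have h1 : ∀ᵐ p ∂((volume.restrict (roadDomain h)).prod (volume.restrict (N.K h))),
      U (t, p) = u t p := by
    rw [← phase_eq_prod]; exact hU.ae_eq t
  filter_upwards [Measure.ae_ae_of_ae_prod h1] with x hx
  rw [density, ← hU.setIntegral_eq_dens]
  refine integral_congr_ae ?_
  filter_upwards [hx] with ξ hξ using hξ.symm

end Junction

/-! ### From the weak formulation to mild solutions -/

namespace Junction

open KineticTransport

variable {n m : ℕ} {N : Junction n m} {h : Fin n ⊕ Fin m}

lemma Represents.relax_ae_eq {u : C(ℝ≥0, N.Kin h)} {U : ℝ × ℝ × ℝ → ℝ}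
    (hU : N.Represents h u U) (ε : ℝ) {t : ℝ} (ht : 0 ≤ t) :
    ∀ᵐ p ∂(N.phase h), N.relax ε h (u t.toNNReal) p = ε⁻¹ * (equil U (t, p) - U (t, p)) := by
  have hdens := Measure.quasiMeasurePreserving_fst (μ := volume.restrict (roadDomain h))
    (ν := volume.restrict (N.K h)) |>.ae (hU.density_eq t.toNNReal)
  rw [← phase_eq_prod] at hdens
  filter_upwards [hU.ae_eq t.toNNReal, hdens] with p h1 h2
  rw [Real.coe_toNNReal t ht] at h1 h2
  rw [relax, h2, ← h1, equil]; ring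

/-- The spatial part of the weak formulation, rewritten for the extension by zero. The source `X`
and the damping `lam` may be chosen freely as long as `X - lam * U` is the relaxation term. -/
lemma Represents.integral_weak {u : C(ℝ≥0, N.Kin h)} {U : ℝ × ℝ × ℝ → ℝ}
    (hN : N.Admissible) (hU : N.Represents h u U) {ε lam : ℝ} {X : ℝ × ℝ × ℝ → ℝ}
    (hX : ∀ q, X q - lam * U q = ε⁻¹ * (equil U q - U q)) {φ : ℝ × ℝ × ℝ → ℝ}
    (hφ : ContDiff ℝ (⊤ : ℕ∞) φ) {t : ℝ} (ht : 0 ≤ t) :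
    ∫ p, (u t.toNNReal p * (deriv (fun s => φ (s, p.1, p.2)) t
          + N.df h p.2 * deriv (fun y => φ (t, y, p.2)) p.1)
        + N.relax ε h (u t.toNNReal) p * φ (t, p.1, p.2)) ∂(N.phase h)
      = ∫ p, (U (t, p) * transportOp (N.speed h) lam φ (t, p) + X (t, p) * φ (t, p)) := by
  have hd : Differentiable ℝ φ := hφ.differentiable (by simp)
  have hzero : ∀ p, p ∉ roadDomain h ×ˢ N.K h →
      U (t, p) * transportOp (N.speed h) lam φ (t, p) + X (t, p) * φ (t, p) = 0 := fun p hp => by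
    have h1 := hU.support (t, p) hp
    have h2 := (hU.toIsKinetic.isKinetic_equil hN).support (t, p) hp
    have h3 := hX (t, p)
    rw [h1, h2, mul_zero, sub_zero, sub_zero, mul_zero] at h3
    rw [h1, h3]; ring
  rw [← setIntegral_eq_integral_of_forall_compl_eq_zero hzero]
  refine integral_congr_ae ?_
  filter_upwards [hU.ae_eq t.toNNReal, hU.relax_ae_eq ε ht, ae_restrict_mem
    ((measurableSet_roadDomain h).prod (N.measurableSet_K h))] with p h1 h2 h3
  rw [Real.coe_toNNReal t ht] at h1
  have d1 : deriv (fun s => φ (s, p.1, p.2)) t = fderiv ℝ φ (t, p) (1, 0, 0) := by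
    have e : HasDerivAt (fun s : ℝ => ((s, p.1, p.2) : ℝ × ℝ × ℝ)) (1, 0, 0) t :=
      (hasDerivAt_id t).prodMk ((hasDerivAt_const _ _).prodMk (hasDerivAt_const _ _))
    exact ((hd (t, p)).hasFDerivAt.comp_hasDerivAt t e).deriv
  have d2 : deriv (fun y => φ (t, y, p.2)) p.1 = fderiv ℝ φ (t, p) (0, 1, 0) := by
    have e : HasDerivAt (fun y : ℝ => ((t, y, p.2) : ℝ × ℝ × ℝ)) (0, 1, 0) p.1 :=
      (hasDerivAt_const _ _).prodMk ((hasDerivAt_id _).prodMk (hasDerivAt_const _ _))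
    exact ((hd (t, p)).hasFDerivAt.comp_hasDerivAt p.1 e).deriv
  rw [d1, d2, h2, ← hX, transportOp_eq, ← h1, speed_eq h3.2]
  ring

lemma integral_trace (N : Junction n m) (h : Fin n ⊕ Fin m) {γ γ' : ℝ × ℝ → ℝ}
    (hγ : ∀ᵐ t ∂(volume.restrict (Ioi (0 : ℝ))), ∀ᵐ ξ ∂(volume.restrict (N.K h)),
      γ (t, ξ) = γ' (t, ξ)) (φ : ℝ × ℝ × ℝ → ℝ) :
    -(roadSign h * ∫ t in Ioi (0 : ℝ), ∫ ξ in N.K h, N.df h ξ * γ (t, ξ) * φ (t, 0, ξ))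
      = ∫ t in Ioi (0 : ℝ), ∫ ξ, N.speed h ξ * N.crossData h γ' (t, ξ) * φ (t, 0, ξ) := by
  rw [← integral_const_mul, ← integral_neg]
  refine integral_congr_ae ?_
  filter_upwards [hγ] with t ht
  rw [← integral_const_mul, ← integral_neg, ← integral_indicator (N.measurableSet_K h)]
  refine integral_congr_ae ?_
  filter_upwards [(ae_restrict_iff' (N.measurableSet_K h)).1 ht] with ξ hξ
  by_cases hK : ξ ∈ N.K h
  · rw [indicator_of_mem hK, crossData, indicator_of_mem hK, hξ hK, speed_eq hK]; ring
  · rw [indicator_of_notMem hK, crossData, indicator_of_notMem hK]; ring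

/-- The pair `(U, γ)` of kinetic functions and boundary values solves the problem at the junction
in the mild sense. The relaxation equation is used in two forms, with the loss term `-U / ε`
treated as a damping and as a part of the source. -/
structure IsKineticSolution (N : Junction n m) (ε : ℝ) (U : Fin n ⊕ Fin m → ℝ × ℝ × ℝ → ℝ)
    (γ : Fin n ⊕ Fin m → ℝ × ℝ → ℝ) : Prop where
  kinetic : ∀ h, N.IsKinetic h (U h)
  cont : ∀ h, ContinuousInL1 (U h)
  meas_trace : ∀ h, Measurable (γ h)
  trace_mem : ∀ h q, γ h q ∈ kinSet q.2
  mild_damped : ∀ h, ∀ t ≥ 0, ∀ᵐ p, U h (t, p) = mild (N.speed h) ε⁻¹ (fun p => U h (0, p))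
    (fun q => ε⁻¹ * equil (U h) q) (N.crossData h (γ h)) t p
  mild_free : ∀ h, ∀ t ≥ 0, ∀ᵐ p, U h (t, p) = mild (N.speed h) 0 (fun p => U h (0, p))
    (fun q => ε⁻¹ * (equil (U h) q - U h q)) (N.crossData h (γ h)) t p
  coupling : ∀ᵐ t ∂(volume.restrict (Ioi (0 : ℝ))), ∃ p : ℝ × ℝ,
    N.IsCouplingParam (fun k ξ => γ k (t, ξ)) p ∧ ∀ h, ∀ᵐ ξ ∂(volume.restrict (N.K h)),
      roadSign h * N.speed h ξ < 0 → γ h (t, ξ) = chi (N.prio h p.1 p.2) ξ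

lemma exists_lintegral_source_le {U : ℝ × ℝ × ℝ → ℝ} (hU : N.IsKinetic h U)
    (cU : ContinuousInL1 U) (ε T : ℝ) :
    ∃ C : ℝ≥0, ∀ s ∈ Icc 0 T, ∫⁻ p, ‖ε⁻¹ * equil U (s, p)‖ₑ ≤ C := by
  obtain ⟨C, hC⟩ := exists_lintegral_le_of_continuousInL1 cU T
  refine ⟨‖ε⁻¹‖₊ * C, fun s hs => ?_⟩
  simp only [enorm_mul]
  rw [lintegral_const_mul' _ _ enorm_ne_top, ENNReal.coe_mul]
  exact mul_le_mul' le_rfl ((lintegral_equil_le hU s).trans (hC s hs))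

lemma abs_equil_le (U : ℝ × ℝ × ℝ → ℝ) (q : ℝ × ℝ × ℝ) : |equil U q| ≤ 1 := abs_chi_le_one _ _

lemma IsKinetic.isData_damped (hN : N.Admissible) {U : ℝ × ℝ × ℝ → ℝ} (hU : N.IsKinetic h U)
    (cU : ContinuousInL1 U) {γ : ℝ × ℝ → ℝ} (mγ : Measurable γ) (bγ : ∀ q, γ q ∈ kinSet q.2)
    (ε : ℝ) : IsData (N.speed h) (fun p => U (0, p)) (fun q => ε⁻¹ * equil U q)
      (N.crossData h γ) := by
  refine isData_crossData hN (hU.meas.comp measurable_prodMk_left) (fun p => hU.abs_le _)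
    (cU.1 0 le_rfl).2 ((measurable_equil hU.meas).const_mul _) ⟨|ε⁻¹|, fun q => ?_⟩
    (fun T => ?_) mγ (fun q => abs_le_one_of_mem_kinSet (bγ q))
  · rw [abs_mul]
    exact mul_le_of_le_one_right (abs_nonneg _) (abs_equil_le U q)
  · obtain ⟨C, hC⟩ := exists_lintegral_source_le hU cU ε T
    exact ⟨C, fun s hs => hC s ⟨hs.1.le, hs.2.le⟩⟩

lemma IsKinetic.isData_free (hN : N.Admissible) {U : ℝ × ℝ × ℝ → ℝ} (hU : N.IsKinetic h U)
    (cU : ContinuousInL1 U) {γ : ℝ × ℝ → ℝ} (mγ : Measurable γ) (bγ : ∀ q, γ q ∈ kinSet q.2)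
    (ε : ℝ) : IsData (N.speed h) (fun p => U (0, p)) (fun q => ε⁻¹ * (equil U q - U q))
      (N.crossData h γ) := by
  refine isData_crossData hN (hU.meas.comp measurable_prodMk_left) (fun p => hU.abs_le _)
    (cU.1 0 le_rfl).2 (((measurable_equil hU.meas).sub hU.meas).const_mul _)
    ⟨|ε⁻¹| * 2, fun q => ?_⟩ (fun T => ?_) mγ (fun q => abs_le_one_of_mem_kinSet (bγ q))
  · rw [abs_mul]
    refine mul_le_mul_of_nonneg_left ((abs_sub _ _).trans ?_) (abs_nonneg _)
    linarith [abs_equil_le U q, hU.abs_le q]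
  · obtain ⟨C, hC⟩ := exists_lintegral_le_of_continuousInL1 cU T
    refine ⟨‖ε⁻¹‖₊ * (C + C), fun s hs => ?_⟩
    have hs' : s ∈ Icc 0 T := ⟨hs.1.le, hs.2.le⟩
    simp only [enorm_mul]
    rw [lintegral_const_mul' _ _ enorm_ne_top, ENNReal.coe_mul, ENNReal.coe_add]
    refine mul_le_mul' le_rfl ?_
    calc ∫⁻ p, ‖equil U (s, p) - U (s, p)‖ₑ ≤ ∫⁻ p, (‖equil U (s, p)‖ₑ + ‖U (s, p)‖ₑ) :=
          lintegral_mono fun p => enorm_sub_le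
      _ = (∫⁻ p, ‖equil U (s, p)‖ₑ) + ∫⁻ p, ‖U (s, p)‖ₑ :=
          lintegral_add_right _ (hU.meas.comp measurable_prodMk_left).enorm
      _ ≤ C + C := add_le_add ((lintegral_equil_le hU s).trans (hC s hs')) (hC s hs')

/-- Couplings only depend on the kinetic values up to null sets. -/
lemma isCouplingParam_congr (hN : N.Admissible) {g g' : Fin n ⊕ Fin m → ℝ → ℝ}
    (hg : ∀ h, ∀ᵐ ξ ∂(volume.restrict (N.K h)), g h ξ = g' h ξ) {p : ℝ × ℝ} :
    N.IsCouplingParam g p ↔ N.IsCouplingParam g' p := by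
  have : ∀ h, N.inflow h (g h) = N.inflow h (g' h) := fun h => by
    refine integral_congr_ae ?_
    filter_upwards [(ae_restrict_iff' (N.measurableSet_K h)).1 (hg h)] with ξ hξ
    by_cases hK : ξ ∈ N.K h
    · rw [hξ hK]
    · simp [inRate, hK]
  simp only [isCouplingParam_iff hN, this]

/-- For admissible data there is a pair of parameters that balances the flux. -/
lemma exists_isCouplingParam (hN : N.Admissible) {g : Fin n ⊕ Fin m → ℝ → ℝ}
    (mg : ∀ h, Measurable (g h))
    (hg : ∀ h, ∀ᵐ ξ ∂(volume.restrict (N.K h)), g h ξ ∈ kinSet ξ) :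
    ∃ p, N.IsCouplingParam g p := by
  obtain ⟨h1, h2⟩ := sum_inflow_mem hN mg hg
  obtain ⟨p, hp, e⟩ := exists_param hN (continuous_outflow hN) (monotone_outflow hN) h1 h2
  exact ⟨p, (isCouplingParam_iff hN).2 ⟨hp, e⟩⟩

lemma ae_restrict_Gout_iff (hN : N.Admissible) {P : ℝ → Prop} :
    (∀ᵐ ξ ∂(volume.restrict (N.Gout h)), P ξ) ↔
      ∀ᵐ ξ ∂(volume.restrict (N.K h)), roadSign h * N.speed h ξ < 0 → P ξ := by
  rw [Measure.restrict_congr_set (Gout_ae_eq hN h), ae_restrict_iff', ae_restrict_iff'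
    (N.measurableSet_K h)]
  · simp only [mem_ofPred_eq, and_imp]
  · exact (N.measurableSet_K h).inter
      (measurableSet_lt ((measurable_speed hN h).const_mul _) measurable_const)

/-- Every distributional solution is represented by a mild solution. -/
theorem IsBGKSolution.exists_kineticSolution (hN : N.Admissible) {ε : ℝ} {g0 : ∀ h, N.Kin h}
    {g : ∀ h, C(ℝ≥0, N.Kin h)} (hg : N.IsBGKSolution ε g0 g) :
    ∃ U γ, N.IsKineticSolution ε U γ ∧ ∀ h, N.Represents h (g h) (U h) := by
  classical
  choose U hU using fun h => exists_represents (hg.values h)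
  obtain ⟨γ₀, mγ₀, kγ₀, hw, hc⟩ := hg.equation
  -- the trace, redefined on a null set so that all its values are admissible
  let γ : Fin n ⊕ Fin m → ℝ × ℝ → ℝ := fun h q =>
    if γ₀ h q.1 q.2 ∈ kinSet q.2 then γ₀ h q.1 q.2 else 0
  have mγ : ∀ h, Measurable (γ h) := fun h =>
    Measurable.ite ((measurable_snd.prodMk (mγ₀ h)) measurableSet_kinSet) (mγ₀ h) measurable_const
  have kγ : ∀ h q, γ h q ∈ kinSet q.2 := fun h q => by
    simp only [γ]
    split_ifs with hq
    · exact hq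
    · exact zero_mem_kinSet _
  have eγ : ∀ h, ∀ᵐ t ∂(volume.restrict (Ioi (0 : ℝ))), ∀ᵐ ξ ∂(volume.restrict (N.K h)),
      γ₀ h t ξ = γ h (t, ξ) := fun h => by
    have h1 := kγ₀ h
    rw [Measure.volume_eq_prod, ← Measure.prod_restrict] at h1
    filter_upwards [Measure.ae_ae_of_ae_prod h1] with t ht
    filter_upwards [ht] with ξ hξ
    exact (if_pos hξ).symm
  have cU := fun h => (hU h).continuousInL1
  have kU := fun h => (hU h).toIsKinetic
  obtain ⟨L, -, hL⟩ := exists_abs_speed_le hN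
  -- both forms of the equation at once: any splitting of the relaxation term into damping and
  -- source
  have key : ∀ h lam X, (∀ q, X q - lam * U h q = ε⁻¹ * (equil (U h) q - U h q)) →
      IsData (N.speed h) (fun p => U h (0, p)) X (N.crossData h (γ h)) → ∀ t ≥ 0,
      ∀ᵐ p, U h (t, p) = mild (N.speed h) lam (fun p => U h (0, p)) X
        (N.crossData h (γ h)) t p := by
    intro h lam X hX hd t ht
    refine ae_eq_mild_of_weak (measurable_speed hN h) (hL h) (kU h).meas
      (fun T => ⟨1, fun q _ => (kU h).abs_le q⟩) (cU h) hd (fun φ hφ sφ tφ => ?_) ht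
    rw [← integral_trace N h (γ := fun q => γ₀ h q.1 q.2) (eγ h) φ, ← sub_eq_add_neg]
    refine Eq.trans ?_ (hw h φ hφ sφ tφ)
    refine congrArg₂ _ (setIntegral_congr_fun measurableSet_Ioi fun t ht => ?_) rfl
    exact ((hU h).integral_weak hN hX hφ (le_of_lt ht)).symm
  refine ⟨U, γ, ⟨kU, cU, mγ, kγ, fun h => key h _ _ (fun q => by ring)
    ((kU h).isData_damped hN (cU h) (mγ h) (kγ h) ε), fun h => key h _ _ (fun q => by ring)
    ((kU h).isData_free hN (cU h) (mγ h) (kγ h) ε), ?_⟩, hU⟩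
  filter_upwards [hc, ae_all_iff.2 eγ] with t h1 h2
  have hex : ∃ p, N.IsCouplingParam (fun k => γ₀ k t) p := by
    simp only [isCouplingParam_congr hN h2]
    exact exists_isCouplingParam hN (fun h => (mγ h).comp measurable_prodMk_left)
      fun h => Eventually.of_forall fun ξ => kγ h (t, ξ)
  refine ⟨hex.choose, (isCouplingParam_congr hN h2).1 hex.choose_spec, fun h => ?_⟩
  have h3 := (ae_restrict_Gout_iff hN).1 (h1 h)
  filter_upwards [h2 h, h3] with ξ e1 e2 hξ
  rw [← e1, ← e2 hξ, Psi, dif_pos hex]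

end Junction

/-! ### Contraction in `L¹` -/

/-- One step of the Gronwall argument: the damping beats the growth by the factor
`1 - exp (-lam * t)`. -/
lemma le_ofReal_of_exp_mul_le {lam r t x₀ D : ℝ} {x : ℝ≥0∞} (hlam : 0 ≤ lam) (hr : 0 ≤ r)
    (hrt : r ≤ t) (hx₀ : 0 ≤ x₀) (hD : 0 ≤ D)
    (h : ENNReal.ofReal (Real.exp (lam * r)) * x ≤ ENNReal.ofReal x₀
      + ENNReal.ofReal (Real.exp (lam * r) - 1) * ENNReal.ofReal (x₀ + D)) :
    x ≤ ENNReal.ofReal (x₀ + (1 - Real.exp (-(lam * t))) * D) := by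
  have he1 : 0 ≤ Real.exp (lam * r) - 1 := by
    have := Real.add_one_le_exp (lam * r)
    nlinarith [mul_nonneg hlam hr]
  have hee : Real.exp (-(lam * r)) * Real.exp (lam * r) = 1 := by
    rw [← Real.exp_add]; simp
  have hmono : Real.exp (-(lam * t)) ≤ Real.exp (-(lam * r)) :=
    Real.exp_le_exp.2 (by nlinarith)
  calc x = ENNReal.ofReal (Real.exp (-(lam * r))) * (ENNReal.ofReal (Real.exp (lam * r)) * x) := by
        rw [← mul_assoc, ← ENNReal.ofReal_mul (Real.exp_pos _).le, hee, ENNReal.ofReal_one, one_mul]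
    _ ≤ ENNReal.ofReal (Real.exp (-(lam * r))) * (ENNReal.ofReal x₀
          + ENNReal.ofReal (Real.exp (lam * r) - 1) * ENNReal.ofReal (x₀ + D)) := by gcongr
    _ = ENNReal.ofReal (Real.exp (-(lam * r)) * (x₀ + (Real.exp (lam * r) - 1) * (x₀ + D))) := by
        rw [← ENNReal.ofReal_mul he1, ← ENNReal.ofReal_add hx₀ (by positivity),
          ← ENNReal.ofReal_mul (Real.exp_pos _).le]
    _ ≤ _ := by
        refine ENNReal.ofReal_le_ofReal ?_
        have e : Real.exp (-(lam * r)) * (x₀ + (Real.exp (lam * r) - 1) * (x₀ + D))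
            = x₀ + (1 - Real.exp (-(lam * r))) * D := by linear_combination (x₀ + D) * hee
        rw [e]
        nlinarith

namespace Junction

open KineticTransport

variable {n m : ℕ} {N : Junction n m} {h : Fin n ⊕ Fin m}

/-- `U` is the response to the driver `V`: it solves the linear problem with damping `1 / ε`, source
`χ(ρ_V, ξ) / ε` and boundary values `γ` that satisfy the coupling condition. -/
structure IsResponse (N : Junction n m) (ε : ℝ) (V U : Fin n ⊕ Fin m → ℝ × ℝ × ℝ → ℝ)
    (γ : Fin n ⊕ Fin m → ℝ × ℝ → ℝ) : Prop where
  driver : ∀ h, N.IsKinetic h (V h)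
  cont_driver : ∀ h, ContinuousInL1 (V h)
  kinetic : ∀ h, N.IsKinetic h (U h)
  cont : ∀ h, ContinuousInL1 (U h)
  meas_trace : ∀ h, Measurable (γ h)
  trace_mem : ∀ h q, γ h q ∈ kinSet q.2
  mild_damped : ∀ h, ∀ t ≥ 0, ∀ᵐ p, U h (t, p) = mild (N.speed h) ε⁻¹ (fun p => U h (0, p))
    (fun q => ε⁻¹ * equil (V h) q) (N.crossData h (γ h)) t p
  coupling : ∀ᵐ t ∂(volume.restrict (Ioi (0 : ℝ))), ∃ p : ℝ × ℝ,
    N.IsCouplingParam (fun k ξ => γ k (t, ξ)) p ∧ ∀ h, ∀ᵐ ξ ∂(volume.restrict (N.K h)),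
      roadSign h * N.speed h ξ < 0 → γ h (t, ξ) = chi (N.prio h p.1 p.2) ξ

lemma IsKineticSolution.isResponse {ε : ℝ} {U : Fin n ⊕ Fin m → ℝ × ℝ × ℝ → ℝ}
    {γ : Fin n ⊕ Fin m → ℝ × ℝ → ℝ} (hU : N.IsKineticSolution ε U γ) : N.IsResponse ε U U γ :=
  ⟨hU.kinetic, hU.cont, hU.kinetic, hU.cont, hU.meas_trace, hU.trace_mem, hU.mild_damped,
    hU.coupling⟩

lemma IsResponse.isData (hN : N.Admissible) {ε : ℝ} {V U : Fin n ⊕ Fin m → ℝ × ℝ × ℝ → ℝ}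
    {γ : Fin n ⊕ Fin m → ℝ × ℝ → ℝ} (hU : N.IsResponse ε V U γ) (h : Fin n ⊕ Fin m) :
    IsData (N.speed h) (fun p => U h (0, p)) (fun q => ε⁻¹ * equil (V h) q)
      (N.crossData h (γ h)) := by
  have h1 := (hU.driver h).isData_damped hN (hU.cont_driver h) (hU.meas_trace h) (hU.trace_mem h) ε
  exact ⟨(hU.kinetic h).meas.comp measurable_prodMk_left, ⟨1, fun p => (hU.kinetic h).abs_le _⟩,
    ((hU.cont h).1 0 le_rfl).2, h1.meas_source, h1.bdd_source, h1.meas_cross, h1.bdd_cross,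
    h1.mass⟩

/-- The difference of two solutions carries no more into the roads than it carries out of them. -/
lemma sum_crossFlux_entryPart_le (hN : N.Admissible) {γ₁ γ₂ : Fin n ⊕ Fin m → ℝ × ℝ → ℝ}
    (m₁ : ∀ h, Measurable (γ₁ h)) (m₂ : ∀ h, Measurable (γ₂ h))
    (k₁ : ∀ h q, γ₁ h q ∈ kinSet q.2) (k₂ : ∀ h q, γ₂ h q ∈ kinSet q.2) {t : ℝ} {p₁ p₂ : ℝ × ℝ}
    (hp₁ : N.IsCouplingParam (fun k ξ => γ₁ k (t, ξ)) p₁)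
    (hp₂ : N.IsCouplingParam (fun k ξ => γ₂ k (t, ξ)) p₂)
    (e₁ : ∀ h, ∀ᵐ ξ ∂(volume.restrict (N.K h)),
      roadSign h * N.speed h ξ < 0 → γ₁ h (t, ξ) = chi (N.prio h p₁.1 p₁.2) ξ)
    (e₂ : ∀ h, ∀ᵐ ξ ∂(volume.restrict (N.K h)),
      roadSign h * N.speed h ξ < 0 → γ₂ h (t, ξ) = chi (N.prio h p₂.1 p₂.2) ξ) :
    ∑ h, crossFlux (N.speed h) (entryPart (N.speed h) (roadSign h)
        fun q => N.crossData h (γ₁ h) q - N.crossData h (γ₂ h) q) t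
      ≤ ∑ h, crossFlux (N.speed h) (exitPart (N.speed h) (roadSign h)
        fun q => N.crossData h (γ₁ h) q - N.crossData h (γ₂ h) q) t := by
  have en : ∀ h, crossFlux (N.speed h) (entryPart (N.speed h) (roadSign h)
      fun q => N.crossData h (γ₁ h) q - N.crossData h (γ₂ h) q) t
      = ∫⁻ ξ, ‖N.outRate h ξ
          * (chi (N.prio h p₁.1 p₁.2) ξ - chi (N.prio h p₂.1 p₂.2) ξ)‖ₑ := fun h => by
    refine lintegral_congr_ae ?_
    filter_upwards [(ae_restrict_iff' (N.measurableSet_K h)).1 (e₁ h),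
      (ae_restrict_iff' (N.measurableSet_K h)).1 (e₂ h)] with ξ h1 h2
    by_cases hK : ξ ∈ N.K h
    · simp only [entryPart, crossData, outRate, indicator_of_mem hK]
      rcases lt_trichotomy (roadSign h * N.speed h ξ) 0 with hs | hs | hs
      · rw [if_neg hs.not_gt, max_eq_left (by linarith), ← h1 hK hs, ← h2 hK hs]
        congr 1; ring
      · have hc : N.speed h ξ = 0 := by
          have := roadSign_mul_self h
          linear_combination (-N.speed h ξ) * this + roadSign h * hs
        rw [hs, hc]; simp
      · rw [if_pos hs, max_eq_right (by linarith)]; simp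
    · simp [entryPart, crossData, outRate, hK]
  have ex : ∀ h, crossFlux (N.speed h) (exitPart (N.speed h) (roadSign h)
      fun q => N.crossData h (γ₁ h) q - N.crossData h (γ₂ h) q) t
      = ∫⁻ ξ, ‖N.inRate h ξ * (γ₁ h (t, ξ) - γ₂ h (t, ξ))‖ₑ := fun h => by
    refine lintegral_congr fun ξ => ?_
    by_cases hK : ξ ∈ N.K h
    · simp only [exitPart, crossData, inRate, indicator_of_mem hK]
      rcases lt_or_ge 0 (roadSign h * N.speed h ξ) with hs | hs
      · rw [if_pos hs, max_eq_left hs.le, ← enorm_neg]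
        congr 1; ring
      · rw [if_neg hs.not_gt, max_eq_right hs]; simp
    · simp [exitPart, crossData, inRate, hK]
  simp only [en, ex]
  exact coupling_contraction hN (fun h => (m₁ h).comp measurable_prodMk_left)
    (fun h => Eventually.of_forall fun ξ => k₁ h (t, ξ))
    (fun h => (m₂ h).comp measurable_prodMk_left)
    (fun h => Eventually.of_forall fun ξ => k₂ h (t, ξ)) hp₁ hp₂

/-- The distance of two responses in terms of the distance of their drivers. -/
theorem IsResponse.exp_mul_sum_le (hN : N.Admissible) {ε : ℝ} (hε : 0 < ε)
    {V₁ U₁ V₂ U₂ : Fin n ⊕ Fin m → ℝ × ℝ × ℝ → ℝ} {γ₁ γ₂ : Fin n ⊕ Fin m → ℝ × ℝ → ℝ}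
    (h₁ : N.IsResponse ε V₁ U₁ γ₁) (h₂ : N.IsResponse ε V₂ U₂ γ₂) {t : ℝ} (ht : 0 ≤ t) {S : ℝ≥0∞}
    (hS : ∀ s ∈ Ioo 0 t, ∑ h, ∫⁻ p, ‖V₁ h (s, p) - V₂ h (s, p)‖ₑ ≤ S) :
    ENNReal.ofReal (Real.exp (ε⁻¹ * t)) * ∑ h, ∫⁻ p, ‖U₁ h (t, p) - U₂ h (t, p)‖ₑ
      ≤ (∑ h, ∫⁻ p, ‖U₁ h (0, p) - U₂ h (0, p)‖ₑ)
        + ENNReal.ofReal (Real.exp (ε⁻¹ * t) - 1) * S := by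
  refine sum_lintegral_mild_le (measurable_speed hN)
    (fun h => (h₁.isData hN h).sub (measurable_speed hN h) (h₂.isData hN h))
    (σ := roadSign) (W := fun h p => U₁ h (t, p) - U₂ h (t, p)) (inv_nonneg.2 hε.le) ht
    (fun h => ?_) (fun h p hp => ?_) ?_ fun s hs => ?_
  · filter_upwards [h₁.mild_damped h t ht, h₂.mild_damped h t ht] with p e1 e2
    rw [e1, e2, ← mild_sub (h₁.isData hN h) (h₂.isData hN h)]
  · have hp' : p ∉ roadDomain h ×ˢ N.K h := fun hm => by
      have := (mem_roadDomain h p.1).1 hm.1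
      linarith
    rw [(h₁.kinetic h).support (t, p) hp', (h₂.kinetic h).support (t, p) hp', sub_zero]
  · filter_upwards [ae_restrict_of_ae_restrict_of_subset Ioo_subset_Ioi_self h₁.coupling,
      ae_restrict_of_ae_restrict_of_subset Ioo_subset_Ioi_self h₂.coupling]
      with s ⟨p₁, hp₁, e₁⟩ ⟨p₂, hp₂, e₂⟩
    exact sum_crossFlux_entryPart_le hN h₁.meas_trace h₂.meas_trace h₁.trace_mem h₂.trace_mem
      hp₁ hp₂ e₁ e₂
  · calc ∑ h, ∫⁻ p, ‖ε⁻¹ * equil (V₁ h) (s, p) - ε⁻¹ * equil (V₂ h) (s, p)‖ₑ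
        = ENNReal.ofReal ε⁻¹ * ∑ h, ∫⁻ p, ‖equil (V₁ h) (s, p) - equil (V₂ h) (s, p)‖ₑ := by
          rw [Finset.mul_sum]
          refine Finset.sum_congr rfl fun h _ => ?_
          rw [← lintegral_const_mul' _ _ ENNReal.ofReal_ne_top]
          refine lintegral_congr fun p => ?_
          rw [← mul_sub, enorm_mul, Real.enorm_eq_ofReal (inv_nonneg.2 hε.le)]
      _ ≤ ENNReal.ofReal ε⁻¹ * S := by
          gcongr
          exact (Finset.sum_le_sum fun h _ =>
            lintegral_equil_sub_le (h₁.driver h) (h₂.driver h) s s).trans (hS s hs)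

/-- The `L¹` distance of two kinetic solutions is at most the distance of their initial values: the
estimate for responses, applied to solutions as their own drivers, is iterated. -/
theorem IsKineticSolution.contraction (hN : N.Admissible) {ε : ℝ} (hε : 0 < ε)
    {U₁ U₂ : Fin n ⊕ Fin m → ℝ × ℝ × ℝ → ℝ} {γ₁ γ₂ : Fin n ⊕ Fin m → ℝ × ℝ → ℝ}
    (h₁ : N.IsKineticSolution ε U₁ γ₁) (h₂ : N.IsKineticSolution ε U₂ γ₂) {t : ℝ} (ht : 0 ≤ t) :
    ∑ h, ∫⁻ p, ‖U₁ h (t, p) - U₂ h (t, p)‖ₑ ≤ ∑ h, ∫⁻ p, ‖U₁ h (0, p) - U₂ h (0, p)‖ₑ := by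
  set F : ℝ → ℝ≥0∞ := fun s => ∑ h, ∫⁻ p, ‖U₁ h (s, p) - U₂ h (s, p)‖ₑ
  choose C hC using fun h =>
    exists_lintegral_le_of_continuousInL1 ((h₁.cont h).sub (h₂.cont h)) t
  have hfin : F 0 ≠ ∞ := by
    refine ne_top_of_le_ne_top (ENNReal.sum_ne_top.2 fun h (_ : h ∈ Finset.univ) =>
      (ENNReal.coe_ne_top : (C h : ℝ≥0∞) ≠ ∞))
      (Finset.sum_le_sum fun h _ => hC h 0 ⟨le_rfl, ht⟩)
  set D : ℝ := ∑ h, (C h : ℝ)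
  have hD : 0 ≤ D := by positivity
  have hq0 : 0 ≤ 1 - Real.exp (-(ε⁻¹ * t)) := by
    have : Real.exp (-(ε⁻¹ * t)) ≤ 1 := Real.exp_le_one_iff.2 (by
      have := mul_nonneg (inv_nonneg.2 hε.le) ht; linarith)
    linarith
  -- the excess of `F r` over `F 0` shrinks geometrically when the estimate is applied to itself
  have key : ∀ k : ℕ, ∀ r ∈ Icc 0 t,
      F r ≤ ENNReal.ofReal ((F 0).toReal + (1 - Real.exp (-(ε⁻¹ * t))) ^ k * D) := by
    intro k
    induction k with
    | zero =>
      intro r hr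
      refine (Finset.sum_le_sum fun h _ => hC h r hr).trans ?_
      rw [pow_zero, one_mul]
      calc ∑ h, (C h : ℝ≥0∞) = ENNReal.ofReal D := by
            rw [ENNReal.ofReal_sum_of_nonneg fun _ _ => NNReal.coe_nonneg _]
            simp
        _ ≤ _ := ENNReal.ofReal_le_ofReal (le_add_of_nonneg_left ENNReal.toReal_nonneg)
    | succ k ih =>
      intro r hr
      rw [pow_succ', mul_assoc]
      refine le_ofReal_of_exp_mul_le (inv_nonneg.2 hε.le) hr.1 hr.2 ENNReal.toReal_nonneg
        (mul_nonneg (pow_nonneg hq0 k) hD) ?_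
      rw [ENNReal.ofReal_toReal hfin]
      exact h₁.isResponse.exp_mul_sum_le hN hε h₂.isResponse hr.1
        fun s hs => ih s ⟨hs.1.le, hs.2.le.trans hr.2⟩
  have hlim : Tendsto (fun k : ℕ =>
      ENNReal.ofReal ((F 0).toReal + (1 - Real.exp (-(ε⁻¹ * t))) ^ k * D)) atTop
      (𝓝 (ENNReal.ofReal ((F 0).toReal + 0 * D))) :=
    (ENNReal.continuous_ofReal.tendsto _).comp (((tendsto_pow_atTop_nhds_zero_of_lt_one hq0
      (by linarith [Real.exp_pos (-(ε⁻¹ * t))])).mul_const D).const_add _)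
  rw [zero_mul, add_zero, ENNReal.ofReal_toReal hfin] at hlim
  exact ge_of_tendsto' hlim fun k => key k t ⟨ht, le_rfl⟩

end Junction

/-! ### Moments, conservation of mass and the entropy defect -/

/-- Integration by parts for the primitive of an integrable function. -/
lemma integral_integral_Iio_mul_deriv {G : ℝ → ℝ} (iG : Integrable G) {φ : ℝ → ℝ}
    (hφ : ContDiff ℝ 1 φ) (sφ : HasCompactSupport φ) :
    ∫ ξ, (∫ η in Iio ξ, G η) * deriv φ ξ = -∫ η, G η * φ η := by
  have hd : Integrable (deriv φ) :=
    (hφ.continuous_deriv le_rfl).integrable_of_hasCompactSupport sφ.deriv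
  have mS : MeasurableSet {z : ℝ × ℝ | z.2 < z.1} := measurableSet_lt measurable_snd measurable_fst
  have hint : Integrable (fun z : ℝ × ℝ => {z : ℝ × ℝ | z.2 < z.1}.indicator
      (fun z => deriv φ z.1 * G z.2) z) (volume.prod volume) := (hd.mul_prod iG).indicator mS
  calc ∫ ξ, (∫ η in Iio ξ, G η) * deriv φ ξ
      = ∫ ξ, ∫ η, {z : ℝ × ℝ | z.2 < z.1}.indicator (fun z => deriv φ z.1 * G z.2) (ξ, η) := by
        refine integral_congr_ae (Eventually.of_forall fun ξ => ?_)
        dsimp only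
        rw [← integral_indicator measurableSet_Iio, mul_comm, ← integral_const_mul]
        refine integral_congr_ae (Eventually.of_forall fun η => ?_)
        by_cases hη : η < ξ <;> simp [indicator, hη]
    _ = ∫ η, ∫ ξ, {z : ℝ × ℝ | z.2 < z.1}.indicator (fun z => deriv φ z.1 * G z.2) (ξ, η) :=
        integral_integral_swap hint
    _ = ∫ η, -(G η * φ η) := by
        refine integral_congr_ae (Eventually.of_forall fun η => ?_)
        dsimp only
        rw [← mul_neg, ← sφ.integral_Ioi_deriv_eq hφ, ← integral_indicator measurableSet_Ioi,
          ← integral_const_mul]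
        refine integral_congr_ae (Eventually.of_forall fun ξ => ?_)
        by_cases hη : η < ξ <;> simp [indicator, hη, mul_comm]
    _ = _ := integral_neg _

namespace Junction

open KineticTransport

variable {n m : ℕ} {N : Junction n m} {h : Fin n ⊕ Fin m}

/-- The relaxation term, as a function on the whole space. -/
def relaxTerm (ε : ℝ) (U : ℝ × ℝ × ℝ → ℝ) (q : ℝ × ℝ × ℝ) : ℝ := ε⁻¹ * (equil U q - U q)

lemma measurable_relaxTerm (ε : ℝ) {U : ℝ × ℝ × ℝ → ℝ} (mU : Measurable U) :
    Measurable (relaxTerm ε U) := ((measurable_equil mU).sub mU).const_mul _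

lemma dens_equil (hN : N.Admissible) {U : ℝ × ℝ × ℝ → ℝ} (hU : N.IsKinetic h U) (z : ℝ × ℝ) :
    dens (equil U) z = dens U z := by
  rw [← Prod.mk.eta (p := z), ← (hU.isKinetic_equil hN).setIntegral_eq_dens]
  exact integral_chi (hN.zero_mem h) (hU.dens_mem hN z)

lemma integrable_slice_relaxTerm (hN : N.Admissible) (ε : ℝ) {U : ℝ × ℝ × ℝ → ℝ}
    (hU : N.IsKinetic h U) (t x : ℝ) : Integrable fun ξ => relaxTerm ε U (t, x, ξ) :=
  (((hU.isKinetic_equil hN).integrable_slice t x).sub (hU.integrable_slice t x)).const_mul _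

lemma integral_slice_relaxTerm (hN : N.Admissible) (ε : ℝ) {U : ℝ × ℝ × ℝ → ℝ}
    (hU : N.IsKinetic h U) (t x : ℝ) : ∫ ξ, relaxTerm ε U (t, x, ξ) = 0 := by
  simp only [relaxTerm]
  rw [integral_const_mul, integral_sub ((hU.isKinetic_equil hN).integrable_slice t x)
    (hU.integrable_slice t x)]
  have := dens_equil hN hU (t, x)
  simp only [dens] at this
  rw [this, sub_self, mul_zero]

lemma integrable_equil {U : ℝ × ℝ × ℝ → ℝ} (hU : N.IsKinetic h U) (cU : ContinuousInL1 U) {t : ℝ}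
    (ht : 0 ≤ t) : Integrable fun p => equil U (t, p) :=
  ⟨((measurable_equil hU.meas).comp measurable_prodMk_left).aestronglyMeasurable,
    (lintegral_equil_le hU t).trans_lt (cU.1 t ht).2⟩

lemma integrable_relaxTerm (ε : ℝ) {U : ℝ × ℝ × ℝ → ℝ} (hU : N.IsKinetic h U)
    (cU : ContinuousInL1 U) {t : ℝ} (ht : 0 ≤ t) : Integrable fun p => relaxTerm ε U (t, p) :=
  ((integrable_equil hU cU ht).sub (cU.1 t ht)).const_mul _

/-- The moments of the relaxation term, computed with Fubini's theorem. -/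
lemma integral_mul_relaxTerm (ε : ℝ) {U : ℝ × ℝ × ℝ → ℝ} (hU : N.IsKinetic h U)
    (cU : ContinuousInL1 U) {κ : ℝ → ℝ} (mκ : Measurable κ) (bκ : ∀ ξ, |κ ξ| ≤ 1) {t : ℝ}
    (ht : 0 ≤ t) :
    ∫ p : ℝ × ℝ, κ p.2 * relaxTerm ε U (t, p) = ∫ x, ∫ ξ, κ ξ * relaxTerm ε U (t, x, ξ) := by
  have : Integrable (fun p : ℝ × ℝ => κ p.2 * relaxTerm ε U (t, p)) :=
    (integrable_relaxTerm ε hU cU ht).bdd_mul (mκ.comp measurable_snd).aestronglyMeasurable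
      (c := 1) (Eventually.of_forall fun p => bκ p.2)
  rw [Measure.volume_eq_prod] at this ⊢
  rw [integral_prod _ this]

lemma abs_integral_mul_flux_le {L : ℝ} (hL0 : 0 ≤ L) (hL : ∀ ξ, |N.speed h ξ| ≤ L)
    {γ : ℝ × ℝ → ℝ} (bγ : ∀ q, |γ q| ≤ 1) {κ : ℝ → ℝ} (bκ : ∀ ξ, |κ ξ| ≤ 1) (s : ℝ) :
    |∫ ξ, κ ξ * (N.speed h ξ * N.crossData h γ (s, ξ))| ≤ L * (volume (N.K h)).toReal := by
  rw [← setIntegral_eq_integral_of_forall_compl_eq_zero (s := N.K h)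
    (fun ξ hξ => by simp [crossData, hξ])]
  have hfin : volume (N.K h) < ∞ := by simp [K]
  rw [← Real.norm_eq_abs]
  refine norm_setIntegral_le_of_norm_le_const hfin fun ξ _ => ?_
  rw [Real.norm_eq_abs, abs_mul, abs_mul]
  calc |κ ξ| * (|N.speed h ξ| * |N.crossData h γ (s, ξ)|) ≤ 1 * (L * 1) := by
        gcongr
        · exact bκ ξ
        · exact hL ξ
        · exact abs_crossData_le bγ _
    _ = L := by ring

lemma abs_integral_integral_mul_flux_le {L : ℝ} (hL0 : 0 ≤ L) (hL : ∀ ξ, |N.speed h ξ| ≤ L)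
    {γ : ℝ × ℝ → ℝ} (bγ : ∀ q, |γ q| ≤ 1) {κ : ℝ → ℝ} (bκ : ∀ ξ, |κ ξ| ≤ 1) {t : ℝ} (ht : 0 ≤ t) :
    |∫ s in Ioo 0 t, ∫ ξ, κ ξ * (N.speed h ξ * N.crossData h γ (s, ξ))|
      ≤ t * (L * (volume (N.K h)).toReal) := by
  have hfin : volume (Ioo 0 t) < ∞ := by simp
  refine (norm_setIntegral_le_of_norm_le_const (C := L * (volume (N.K h)).toReal) hfin
    fun s _ => (Real.norm_eq_abs _).trans_le
      (abs_integral_mul_flux_le hL0 hL bγ bκ s)).trans_eq ?_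
  simp [measureReal_def, ht, mul_comm]

/-- The evolution of the moments of a kinetic solution. -/
lemma IsKineticSolution.integral_mul_eq (hN : N.Admissible) {ε : ℝ}
    {U : Fin n ⊕ Fin m → ℝ × ℝ × ℝ → ℝ} {γ : Fin n ⊕ Fin m → ℝ × ℝ → ℝ}
    (hU : N.IsKineticSolution ε U γ) (h : Fin n ⊕ Fin m) {κ : ℝ → ℝ} (mκ : Measurable κ)
    (bκ : ∀ ξ, |κ ξ| ≤ 1) {t : ℝ} (ht : 0 ≤ t) :
    ∫ p : ℝ × ℝ, κ p.2 * U h (t, p) = (∫ p : ℝ × ℝ, κ p.2 * U h (0, p))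
      + (∫ s in Ioo 0 t, ∫ x, ∫ ξ, κ ξ * relaxTerm ε (U h) (s, x, ξ))
      + ∫ s in Ioo 0 t, ∫ ξ, κ ξ * (N.speed h ξ * N.crossData h (γ h) (s, ξ)) := by
  have h1 := integral_mul_mild (measurable_speed hN h)
    ((hU.kinetic h).isData_free hN (hU.cont h) (hU.meas_trace h) (hU.trace_mem h) ε) mκ bκ t
  have h2 : ∫ p : ℝ × ℝ, κ p.2 * U h (t, p) = ∫ p : ℝ × ℝ, κ p.2 * mild (N.speed h) 0
      (fun p => U h (0, p)) (fun q => ε⁻¹ * (equil (U h) q - U h q))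
      (N.crossData h (γ h)) t p := by
    refine integral_congr_ae ?_
    filter_upwards [hU.mild_free h t ht] with p hp
    rw [hp]
  rw [h2, h1]
  congr 2
  refine setIntegral_congr_fun measurableSet_Ioo fun s hs => ?_
  exact integral_mul_relaxTerm ε (hU.kinetic h) (hU.cont h) mκ bκ hs.1.le

/-- Conservation of mass: for the moment with `κ = 1` the relaxation term drops out, and the
boundary fluxes of all roads cancel by the coupling condition. -/
theorem IsKineticSolution.sum_integral_eq (hN : N.Admissible) {ε : ℝ}
    {U : Fin n ⊕ Fin m → ℝ × ℝ × ℝ → ℝ} {γ : Fin n ⊕ Fin m → ℝ × ℝ → ℝ}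
    (hU : N.IsKineticSolution ε U γ) {t : ℝ} (ht : 0 ≤ t) :
    ∑ h, ∫ p, U h (t, p) = ∑ h, ∫ p, U h (0, p) := by
  obtain ⟨L, hL0, hL⟩ := exists_abs_speed_le hN
  have h1 := fun h => hU.integral_mul_eq hN h (κ := fun _ => 1) measurable_const
    (fun _ => by simp) ht
  simp only [one_mul, fun h s x => integral_slice_relaxTerm hN ε (hU.kinetic h) s x,
    integral_zero, add_zero] at h1
  simp only [h1, Finset.sum_add_distrib]
  have e : ∀ h s, ∫ ξ, N.speed h ξ * N.crossData h (γ h) (s, ξ)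
      = (∫ ξ, N.outRate h ξ * γ h (s, ξ)) - N.inflow h fun ξ => γ h (s, ξ) := fun h s => by
    have mγ : Measurable fun ξ => γ h (s, ξ) := (hU.meas_trace h).comp measurable_prodMk_left
    have bγ : ∀ᵐ ξ ∂(volume.restrict (N.K h)), |γ h (s, ξ)| ≤ 1 :=
      Eventually.of_forall fun ξ => abs_le_one_of_mem_kinSet (hU.trace_mem h (s, ξ))
    rw [inflow, ← integral_sub (integrable_outRate_mul hN h mγ bγ)
      (integrable_inRate_mul hN h mγ bγ)]
    refine integral_congr_ae (Eventually.of_forall fun ξ => ?_)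
    dsimp only
    rw [← sub_mul, ← neg_sub (N.inRate h ξ), inRate_sub_outRate]
    by_cases hξ : ξ ∈ N.K h
    · simp only [crossData, indicator_of_mem hξ]; ring
    · simp [crossData, hξ]
  -- integrability of the fluxes in time, needed to exchange the sum over the roads and the integral
  have iflux : ∀ h, IntegrableOn
      (fun s => ∫ ξ, N.speed h ξ * N.crossData h (γ h) (s, ξ)) (Ioo 0 t) := fun h => by
    have mm : StronglyMeasurable fun q : ℝ × ℝ => N.speed h q.2 * N.crossData h (γ h) q :=
      (((measurable_speed hN h).comp measurable_snd).mul
        (measurable_crossData (hU.meas_trace h))).stronglyMeasurable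
    refine Integrable.of_bound mm.integral_prod_right'.aestronglyMeasurable
      (L * (volume (N.K h)).toReal) (Eventually.of_forall fun s => ?_)
    have := abs_integral_mul_flux_le hL0 (hL h)
      (fun q => abs_le_one_of_mem_kinSet (hU.trace_mem h q)) (κ := fun _ => 1) (by simp) s
    simpa using this
  rw [← integral_finsetSum _ fun h _ => iflux h, add_eq_left]
  refine (integral_congr_ae (g := fun _ => 0) ?_).trans (by simp)
  filter_upwards [ae_restrict_of_ae_restrict_of_subset Ioo_subset_Ioi_self hU.coupling]
    with s ⟨p, hp, hγ⟩
  have h2 := ((isCouplingParam_iff hN).1 hp).2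
  simp only [e, Finset.sum_sub_distrib, ← h2, sub_eq_zero]
  refine Finset.sum_congr rfl fun h _ => integral_congr_ae ?_
  filter_upwards [(ae_restrict_iff' (N.measurableSet_K h)).1 (hγ h)] with ξ hξ
  by_cases hK : ξ ∈ N.K h
  · rcases lt_or_ge (roadSign h * N.speed h ξ) 0 with hs | hs
    · rw [hξ hK hs]
    · simp only [outRate, indicator_of_mem hK]
      rw [max_eq_right (by linarith), zero_mul, zero_mul]
  · simp [outRate, hK]

/-- The primitive in `ξ` of the relaxation term that vanishes for `ξ` below the state interval. -/
def entropyDefect (ε : ℝ) (U : ℝ × ℝ × ℝ → ℝ) (q : ℝ × ℝ × ℝ) : ℝ :=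
  ∫ η in Iio q.2.2, relaxTerm ε U (q.1, q.2.1, η)

lemma measurable_entropyDefect (ε : ℝ) {U : ℝ × ℝ × ℝ → ℝ} (mU : Measurable U) :
    Measurable (entropyDefect ε U) := by
  have mS : MeasurableSet {w : (ℝ × ℝ × ℝ) × ℝ | w.2 < w.1.2.2} :=
    measurableSet_lt measurable_snd (by fun_prop)
  have m1 : Measurable fun w : (ℝ × ℝ × ℝ) × ℝ => relaxTerm ε U (w.1.1, w.1.2.1, w.2) :=
    (measurable_relaxTerm ε mU).comp (by fun_prop)
  have h1 : StronglyMeasurable ({w : (ℝ × ℝ × ℝ) × ℝ | w.2 < w.1.2.2}.indicator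
      fun w => relaxTerm ε U (w.1.1, w.1.2.1, w.2)) := (m1.indicator mS).stronglyMeasurable
  have e : entropyDefect ε U = fun q => ∫ η, {w : (ℝ × ℝ × ℝ) × ℝ | w.2 < w.1.2.2}.indicator
      (fun w => relaxTerm ε U (w.1.1, w.1.2.1, w.2)) (q, η) := by
    ext q
    rw [entropyDefect, ← integral_indicator measurableSet_Iio]
    rfl
  rw [e]
  exact h1.integral_prod_right'.measurable

/-- The relaxation term is nonnegative below the density and nonpositive above it, and its integral
vanishes; hence its primitive is nonnegative. -/
lemma entropyDefect_nonneg (hN : N.Admissible) {ε : ℝ} (hε : 0 < ε) {U : ℝ × ℝ × ℝ → ℝ}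
    (hU : N.IsKinetic h U) (q : ℝ × ℝ × ℝ) : 0 ≤ entropyDefect ε U q := by
  obtain ⟨t, x, ξ⟩ := q
  have hi := integrable_slice_relaxTerm hN ε hU t x
  rw [entropyDefect]
  dsimp only
  rcases le_or_gt ξ (dens U (t, x)) with hξ | hξ
  · refine setIntegral_nonneg measurableSet_Iio fun η hη => ?_
    exact mul_nonneg (inv_nonneg.2 hε.le) (sub_nonneg.2
      (le_chi_of_lt (hU.mem_kinSet (t, x, η)) (lt_of_lt_of_le hη hξ)))
  · have h1 := integral_add_compl (measurableSet_Iio (a := ξ)) hi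
    rw [integral_slice_relaxTerm hN ε hU t x, compl_Iio] at h1
    have h2 : ∫ η in Ici ξ, relaxTerm ε U (t, x, η) ≤ 0 := by
      refine setIntegral_nonpos measurableSet_Ici fun η hη => ?_
      exact mul_nonpos_of_nonneg_of_nonpos (inv_nonneg.2 hε.le) (sub_nonpos.2
        (chi_le_of_lt (hU.mem_kinSet (t, x, η)) (lt_of_lt_of_le hξ hη)))
    linarith

lemma abs_relaxTerm_le (hN : N.Admissible) {ε : ℝ} (hε : 0 < ε) {U : ℝ × ℝ × ℝ → ℝ}
    (hU : N.IsKinetic h U) (q : ℝ × ℝ × ℝ) :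
    |relaxTerm ε U q| ≤ (N.K h).indicator (fun _ => ε⁻¹ * 2) q.2.2 := by
  by_cases hq : q.2.2 ∈ N.K h
  · rw [indicator_of_mem hq, relaxTerm, abs_mul, abs_of_pos (inv_pos.2 hε)]
    gcongr
    refine (abs_sub _ _).trans ?_
    linarith [abs_equil_le U q, hU.abs_le q]
  · rw [indicator_of_notMem hq, relaxTerm, hU.support q fun hm => hq hm.2,
      (hU.isKinetic_equil hN).support q fun hm => hq hm.2]
    simp

lemma abs_entropyDefect_le (hN : N.Admissible) {ε : ℝ} (hε : 0 < ε) {U : ℝ × ℝ × ℝ → ℝ}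
    (hU : N.IsKinetic h U) (q : ℝ × ℝ × ℝ) :
    |entropyDefect ε U q| ≤ ∫ η, (N.K h).indicator (fun _ => ε⁻¹ * 2) η := by
  have hK : Integrable ((N.K h).indicator fun _ : ℝ => ε⁻¹ * 2) :=
    (integrable_indicator_iff (N.measurableSet_K h)).2 (integrable_const _)
  refine (abs_integral_le_integral_abs).trans ?_
  refine (setIntegral_mono_on ((integrable_slice_relaxTerm hN ε hU _ _).abs.integrableOn)
    hK.integrableOn measurableSet_Iio fun η _ => abs_relaxTerm_le hN hε hU _).trans ?_
  refine setIntegral_le_integral hK (Eventually.of_forall fun η => ?_)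
  exact indicator_nonneg (fun _ _ => by positivity) η

lemma integral_mul_eq_entropyDefect (ε : ℝ) (U : ℝ × ℝ × ℝ → ℝ) (t x ξ₀ : ℝ) :
    ∫ ξ, (Iio ξ₀).indicator (fun _ => 1) ξ * relaxTerm ε U (t, x, ξ)
      = entropyDefect ε U (t, x, ξ₀) := by
  rw [entropyDefect, ← integral_indicator measurableSet_Iio]
  refine integral_congr_ae (Eventually.of_forall fun ξ => ?_)
  by_cases hξ : ξ ∈ Iio ξ₀ <;> simp [hξ]

/-- The relaxation term is the distributional derivative of the entropy defect. -/
theorem Represents.relaxIsDerivOf (hN : N.Admissible) {ε : ℝ} (hε : 0 < ε)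
    {u : C(ℝ≥0, N.Kin h)} {U : ℝ × ℝ × ℝ → ℝ} (hU : N.Represents h u U) :
    N.RelaxIsDerivOf ε h u (entropyDefect ε U) := by
  intro φ hφ sφ tφ
  have kU := hU.toIsKinetic
  have cU := hU.continuousInL1
  have hd : Differentiable ℝ φ := hφ.differentiable (by simp)
  have hsub : ∀ q : ℝ × ℝ × ℝ, q ∈ tsupport φ → q.2 ∈ roadDomain h ×ˢ N.K h := fun q hq =>
    ⟨(tφ hq).2.1, Ioo_subset_Icc_self (tφ hq).2.2⟩
  have hpart : ∀ t x ξ, deriv (fun y => φ (t, x, y)) ξ = fderiv ℝ φ (t, x, ξ) (0, 0, 1) := by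
    intro t x ξ
    have e : HasDerivAt (fun y : ℝ => ((t, x, y) : ℝ × ℝ × ℝ)) (0, 0, 1) ξ :=
      (hasDerivAt_const _ _).prodMk ((hasDerivAt_const _ _).prodMk (hasDerivAt_id _))
    exact ((hd (t, x, ξ)).hasFDerivAt.comp_hasDerivAt ξ e).deriv
  have cD : Continuous fun q => fderiv ℝ φ q (0, 0, 1) :=
    (hφ.continuous_fderiv (by simp)).clm_apply continuous_const
  have sD : ∀ q, fderiv ℝ φ q (0, 0, 1) ≠ 0 → q ∈ tsupport φ := fun q hq =>
    support_fderiv_subset ℝ fun h0 => hq (by simp [h0])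
  rw [← integral_neg]
  refine setIntegral_congr_fun measurableSet_Ioi fun t ht => ?_
  have ht0 : 0 ≤ t := le_of_lt ht
  have hcomp : IsCompact (Prod.snd '' tsupport φ) := sφ.isCompact.image continuous_snd
  have iD : Integrable fun p : ℝ × ℝ => fderiv ℝ φ (t, p) (0, 0, 1) := by
    refine Continuous.integrable_of_hasCompactSupport (by fun_prop)
      (HasCompactSupport.intro hcomp fun p hp => ?_)
    by_contra hne
    exact hp ⟨(t, p), sD _ hne, rfl⟩
  obtain ⟨M, hM⟩ := sφ.exists_bound_of_continuous hφ.continuous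
  have i1 : Integrable fun p : ℝ × ℝ => relaxTerm ε U (t, p) * φ (t, p) :=
    (integrable_relaxTerm ε kU cU ht0).mul_bdd
      (hφ.continuous.comp (by fun_prop)).aestronglyMeasurable
      (c := M) (Eventually.of_forall fun p => hM (t, p))
  have i2 : Integrable fun p : ℝ × ℝ => entropyDefect ε U (t, p) * fderiv ℝ φ (t, p) (0, 0, 1) :=
    iD.bdd_mul ((measurable_entropyDefect ε hU.meas).comp
      measurable_prodMk_left).aestronglyMeasurable
      (Eventually.of_forall fun p => abs_entropyDefect_le hN hε kU (t, p))
  have e1 : ∫ p, N.relax ε h (u t.toNNReal) p * φ (t, p.1, p.2) ∂(N.phase h)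
      = ∫ p : ℝ × ℝ, relaxTerm ε U (t, p) * φ (t, p) := by
    rw [← setIntegral_eq_integral_of_forall_compl_eq_zero (s := roadDomain h ×ˢ N.K h)
      (f := fun p : ℝ × ℝ => relaxTerm ε U (t, p) * φ (t, p))
      fun p hp => by rw [image_eq_zero_of_notMem_tsupport fun hm => hp (hsub _ hm), mul_zero]]
    refine integral_congr_ae ?_
    filter_upwards [hU.relax_ae_eq ε ht0] with p hp
    rw [hp, relaxTerm]
  have e2 : ∫ p, entropyDefect ε U (t, p.1, p.2) * deriv (fun y => φ (t, p.1, y)) p.2 ∂(N.phase h)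
      = ∫ p : ℝ × ℝ, entropyDefect ε U (t, p) * fderiv ℝ φ (t, p) (0, 0, 1) := by
    simp only [hpart]
    refine setIntegral_eq_integral_of_forall_compl_eq_zero fun p hp => ?_
    have : fderiv ℝ φ (t, p) (0, 0, 1) = 0 := by
      by_contra hne
      exact hp (hsub _ (sD _ hne))
    rw [this, mul_zero]
  rw [e1, e2]
  rw [Measure.volume_eq_prod] at i1 i2 ⊢
  rw [integral_prod _ i1, integral_prod _ i2, ← integral_neg]
  refine integral_congr_ae (Eventually.of_forall fun x => ?_)
  have sx : HasCompactSupport fun ξ => φ (t, x, ξ) := by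
    refine HasCompactSupport.intro (hcomp.image continuous_snd) fun ξ hξ => ?_
    by_contra hne
    exact hξ ⟨(x, ξ), ⟨(t, x, ξ), subset_tsupport _ hne, rfl⟩, rfl⟩
  have cx : ContDiff ℝ 1 fun ξ => φ (t, x, ξ) :=
    (hφ.of_le (by simp)).comp (contDiff_const.prodMk (contDiff_const.prodMk contDiff_id))
  have key := integral_integral_Iio_mul_deriv (integrable_slice_relaxTerm hN ε kU t x) cx sx
  simp only [hpart] at key
  simp only [entropyDefect]
  rw [key, neg_neg]

/-- The total mass on a single road grows at most linearly, at a rate that does not depend on the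
relaxation parameter: the equilibrium minimizes the `L¹` norm among all kinetic functions with the
same density. -/
lemma IsKineticSolution.integral_abs_le (hN : N.Admissible) {ε : ℝ} (hε : 0 < ε)
    {U : Fin n ⊕ Fin m → ℝ × ℝ × ℝ → ℝ} {γ : Fin n ⊕ Fin m → ℝ × ℝ → ℝ}
    (hU : N.IsKineticSolution ε U γ) (h : Fin n ⊕ Fin m) {L : ℝ} (hL0 : 0 ≤ L)
    (hL : ∀ ξ, |N.speed h ξ| ≤ L) {t : ℝ} (ht : 0 ≤ t) :
    ∫ p, |U h (t, p)| ≤ (∫ p, |U h (0, p)|) + t * (L * (volume (N.K h)).toReal) := by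
  have ms : Measurable Real.sign :=
    Measurable.ite measurableSet_Iio measurable_const
      (Measurable.ite measurableSet_Ioi measurable_const measurable_const)
  have bs : ∀ ξ, |Real.sign ξ| ≤ 1 := fun ξ => by
    rcases Real.sign_apply_eq ξ with e | e | e <;> simp [e]
  have kU := hU.kinetic h
  have key := hU.integral_mul_eq hN h ms bs ht
  have e : ∀ s, ∫ p : ℝ × ℝ, Real.sign p.2 * U h (s, p) = ∫ p, |U h (s, p)| := fun s =>
    integral_congr_ae (Eventually.of_forall fun p => (kU.mem_kinSet (s, p)).1)
  rw [e, e] at key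
  -- the relaxation does not increase the `L¹` norm: `‖χ(ρ, ·)‖ = |ρ| ≤ ‖U‖`
  have hneg : ∫ s in Ioo 0 t, ∫ x, ∫ ξ, Real.sign ξ * relaxTerm ε (U h) (s, x, ξ) ≤ 0 := by
    refine integral_nonpos fun s => integral_nonpos fun x => ?_
    have iU := kU.integrable_slice s x
    have iE := (kU.isKinetic_equil hN).integrable_slice s x
    have e1 : ∀ ξ, Real.sign ξ * relaxTerm ε (U h) (s, x, ξ)
        = ε⁻¹ * (|equil (U h) (s, x, ξ)| - |U h (s, x, ξ)|) := fun ξ => by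
      rw [← ((kU.isKinetic_equil hN).mem_kinSet (s, x, ξ)).1, ← (kU.mem_kinSet (s, x, ξ)).1,
        relaxTerm]
      ring
    have e2 : ∫ ξ, |equil (U h) (s, x, ξ)| ≤ |dens (U h) (s, x)| := by
      have h1 := lintegral_chi_sub_le (dens (U h) (s, x)) 0
      have hz : ∀ ξ, chi 0 ξ = 0 := fun ξ => by simp [chi_of_nonneg le_rfl]
      simp only [hz, sub_zero] at h1
      rw [show (fun ξ => |equil (U h) (s, x, ξ)|) = fun ξ => ‖equil (U h) (s, x, ξ)‖ from rfl,
        integral_norm_eq_lintegral_enorm iE.aestronglyMeasurable]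
      refine ENNReal.toReal_le_of_le_ofReal (abs_nonneg _) ?_
      rw [← Real.enorm_eq_ofReal_abs]
      exact h1
    have e3 : |dens (U h) (s, x)| ≤ ∫ ξ, |U h (s, x, ξ)| := abs_integral_le_integral_abs
    simp only [e1]
    rw [integral_const_mul, integral_sub iE.abs iU.abs]
    exact mul_nonpos_of_nonneg_of_nonpos (inv_nonneg.2 hε.le) (by linarith)
  have hflux := le_of_abs_le (abs_integral_integral_mul_flux_le hL0 hL
    (fun q => abs_le_one_of_mem_kinSet (hU.trace_mem h q)) bs ht)
  linarith

/-- The entropy defect of a kinetic solution is bounded in `L¹(dt dx)`, uniformly in the relaxation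
parameter: for every `ξ₀` its integral is a difference of partial masses and boundary fluxes. -/
theorem IsKineticSolution.lintegral_entropyDefect_le (hN : N.Admissible) {ε : ℝ} (hε : 0 < ε)
    {U : Fin n ⊕ Fin m → ℝ × ℝ × ℝ → ℝ} {γ : Fin n ⊕ Fin m → ℝ × ℝ → ℝ}
    (hU : N.IsKineticSolution ε U γ) (h : Fin n ⊕ Fin m) {L : ℝ} (hL0 : 0 ≤ L)
    (hL : ∀ ξ, |N.speed h ξ| ≤ L) {T : ℝ} (hT : 0 ≤ T) (ξ₀ : ℝ) :
    ∫⁻ t in Ioo 0 T, ∫⁻ x in roadDomain h, ENNReal.ofReal (entropyDefect ε (U h) (t, x, ξ₀))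
      ≤ ENNReal.ofReal (2 * (∫ p, |U h (0, p)|)
        + 2 * (T * (L * (volume (N.K h)).toReal))) := by
  have kU := hU.kinetic h
  have cU := hU.cont h
  -- the weight for which the moment of the relaxation term is the entropy defect at `ξ₀`
  set κ : ℝ → ℝ := (Iio ξ₀).indicator fun _ => 1 with hκ
  have mκ : Measurable κ := measurable_const.indicator measurableSet_Iio
  have bκ : ∀ ξ, |κ ξ| ≤ 1 := fun ξ => by
    by_cases hξ : ξ ∈ Iio ξ₀ <;> simp [hκ, hξ]
  have bm : ∀ s, 0 ≤ s → |∫ p : ℝ × ℝ, κ p.2 * U h (s, p)| ≤ ∫ p, |U h (s, p)| := fun s hs => by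
    refine abs_integral_le_integral_abs.trans (integral_mono_of_nonneg
      (Eventually.of_forall fun p => abs_nonneg _) (cU.1 s hs).abs
      (Eventually.of_forall fun p => ?_))
    dsimp only
    rw [abs_mul]
    exact mul_le_of_le_one_left (abs_nonneg _) (bκ _)
  have key := hU.integral_mul_eq hN h mκ bκ hT
  simp only [hκ, integral_mul_eq_entropyDefect] at key
  rw [← hκ] at key
  have h1 := abs_le.1 (bm T hT)
  have h2 := abs_le.1 (bm 0 le_rfl)
  have h3 := abs_le.1 (abs_integral_integral_mul_flux_le hL0 hL
    (fun q => abs_le_one_of_mem_kinSet (hU.trace_mem h q)) bκ hT)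
  -- the mass at time `T`, bounded independently of `ε`
  have h4 := hU.integral_abs_le hN hε h hL0 hL hT
  have hx : ∀ s ∈ Ioo 0 T, Integrable fun x => entropyDefect ε (U h) (s, x, ξ₀) := fun s hs => by
    have : Integrable (fun p : ℝ × ℝ => κ p.2 * relaxTerm ε (U h) (s, p)) :=
      (integrable_relaxTerm ε kU cU hs.1.le).bdd_mul (mκ.comp measurable_snd).aestronglyMeasurable
        (c := 1) (Eventually.of_forall fun p => bκ p.2)
    rw [Measure.volume_eq_prod] at this
    simpa only [hκ, integral_mul_eq_entropyDefect] using this.integral_prod_left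
  have md : Measurable fun z : ℝ × ℝ => entropyDefect ε (U h) (z.1, z.2, ξ₀) :=
    (measurable_entropyDefect ε kU.meas).comp (by fun_prop)
  obtain ⟨C, hC⟩ :=
    (kU.isData_free hN cU (hU.meas_trace h) (hU.trace_mem h) ε).mass T
  have hs : IntegrableOn (fun s => ∫ x, entropyDefect ε (U h) (s, x, ξ₀)) (Ioo 0 T) := by
    refine Measure.integrableOn_of_bounded (M := (C : ℝ)) (by simp)
      md.stronglyMeasurable.integral_prod_right'.aestronglyMeasurable ?_
    filter_upwards [ae_restrict_mem measurableSet_Ioo] with s hs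
    have e := integral_mul_relaxTerm ε kU cU mκ bκ hs.1.le
    simp only [hκ, integral_mul_eq_entropyDefect] at e
    rw [← e, ← toReal_enorm]
    refine ENNReal.toReal_le_of_le_ofReal C.2 ?_
    refine (enorm_integral_le_lintegral_enorm _).trans ?_
    refine le_trans (lintegral_mono fun p => ?_) (le_self_add.trans ((hC s hs).trans (by simp)))
    rw [enorm_mul]
    refine mul_le_of_le_one_left' ?_
    rw [Real.enorm_eq_ofReal_abs, ENNReal.ofReal_le_one]
    exact bκ _
  calc ∫⁻ t in Ioo 0 T, ∫⁻ x in roadDomain h, ENNReal.ofReal (entropyDefect ε (U h) (t, x, ξ₀))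
      ≤ ∫⁻ t in Ioo 0 T, ∫⁻ x, ENNReal.ofReal (entropyDefect ε (U h) (t, x, ξ₀)) :=
        lintegral_mono fun t => setLIntegral_le_lintegral _ _
    _ = ∫⁻ t in Ioo 0 T, ENNReal.ofReal (∫ x, entropyDefect ε (U h) (t, x, ξ₀)) := by
        refine setLIntegral_congr_fun measurableSet_Ioo fun t ht => ?_
        exact (ofReal_integral_eq_lintegral_ofReal (hx t ht)
          (Eventually.of_forall fun x => entropyDefect_nonneg hN hε kU _)).symm
    _ = ENNReal.ofReal (∫ t in Ioo 0 T, ∫ x, entropyDefect ε (U h) (t, x, ξ₀)) :=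
        (ofReal_integral_eq_lintegral_ofReal hs (Eventually.of_forall fun t =>
          integral_nonneg fun x => entropyDefect_nonneg hN hε kU _)).symm
    _ ≤ _ := ENNReal.ofReal_le_ofReal (by linarith)

end Junction

/-! ### The response to a given driver -/

lemma exists_kinSet_eq_Icc (ξ : ℝ) : ∃ u v, kinSet ξ = Icc u v := by
  rcases lt_trichotomy ξ 0 with h | h | h
  · exact ⟨-1, 0, Set.ext fun g => mem_kinSet_of_neg h⟩
  · exact ⟨0, 0, Set.ext fun g => by rw [h, mem_kinSet_zero, Icc_self, mem_singleton_iff]⟩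
  · exact ⟨0, 1, Set.ext fun g => mem_kinSet_of_pos h⟩

/-- Damped averages of admissible kinetic values are admissible. -/
lemma exp_mul_average_mem_kinSet {lam r t ξ g : ℝ} (hlam : 0 ≤ lam) (hrt : r ≤ t)
    (hg : g ∈ kinSet ξ) {E : ℝ → ℝ} (mE : Measurable E) (hE : ∀ s, E s ∈ kinSet ξ) :
    Real.exp (-(lam * t)) * (Real.exp (lam * r) * g
      + ∫ s in Ioo r t, Real.exp (lam * s) * (lam * E s)) ∈ kinSet ξ := by
  obtain ⟨u, v, e⟩ := exists_kinSet_eq_Icc ξ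
  have bE : ∀ s, |E s| ≤ 1 := fun s => abs_le_one_of_mem_kinSet (hE s)
  rw [e] at hg ⊢
  simp only [e, mem_Icc] at hE
  have hexp : ∀ w : ℝ, ∫ s in Ioo r t, Real.exp (lam * s) * (lam * w)
      = (Real.exp (lam * t) - Real.exp (lam * r)) * w := fun w => by
    rw [← integral_Ioc_eq_integral_Ioo, ← intervalIntegral.integral_of_le hrt,
      intervalIntegral.integral_eq_sub_of_hasDerivAt (f := fun s => Real.exp (lam * s) * w)]
    · ring
    · intro s _
      have := ((hasDerivAt_id s).const_mul lam).exp.mul_const w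
      simpa [mul_assoc] using this
    · exact (by fun_prop : Continuous fun s => Real.exp (lam * s) * (lam * w)).intervalIntegrable
        _ _
  have iw : ∀ w : ℝ, IntegrableOn (fun s => Real.exp (lam * s) * (lam * w)) (Ioo r t) := fun w =>
    ((by fun_prop : Continuous fun s => Real.exp (lam * s) * (lam * w)).integrableOn_Icc
      (a := r) (b := t)).mono_set Ioo_subset_Icc_self
  have iE : IntegrableOn (fun s => Real.exp (lam * s) * (lam * E s)) (Ioo r t) := by
    refine Integrable.mono (iw 1) (by fun_prop) (Eventually.of_forall fun s => ?_)
    rw [Real.norm_eq_abs, Real.norm_eq_abs, abs_mul, abs_mul, abs_mul, abs_mul, abs_one]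
    exact mul_le_mul_of_nonneg_left (mul_le_mul_of_nonneg_left (bE s) (abs_nonneg _))
      (abs_nonneg _)
  have hee : Real.exp (-(lam * t)) * Real.exp (lam * t) = 1 := by rw [← Real.exp_add]; simp
  have h1 : ∫ s in Ioo r t, Real.exp (lam * s) * (lam * u)
      ≤ ∫ s in Ioo r t, Real.exp (lam * s) * (lam * E s) :=
    integral_mono (iw u) iE fun s => by
      have := (hE s).1
      dsimp only
      gcongr
  have h2 : ∫ s in Ioo r t, Real.exp (lam * s) * (lam * E s)
      ≤ ∫ s in Ioo r t, Real.exp (lam * s) * (lam * v) :=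
    integral_mono iE (iw v) fun s => by
      have := (hE s).2
      dsimp only
      gcongr
  rw [hexp] at h1 h2
  have hp := Real.exp_pos (-(lam * t))
  have hr := Real.exp_pos (lam * r)
  constructor
  · calc u = Real.exp (-(lam * t)) * (Real.exp (lam * r) * u
          + (Real.exp (lam * t) - Real.exp (lam * r)) * u) := by linear_combination (-u) * hee
      _ ≤ _ := by gcongr; exact hg.1
  · calc _ ≤ Real.exp (-(lam * t)) * (Real.exp (lam * r) * v
          + (Real.exp (lam * t) - Real.exp (lam * r)) * v) := by gcongr; exact hg.2
      _ = v := by linear_combination v * hee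

namespace Junction

open KineticTransport

variable {n m : ℕ} {N : Junction n m} {h : Fin n ⊕ Fin m}

/-- The values at `x = 0` of the solution on the whole line without source at `x = 0`; for
velocities directed into the junction they are the boundary values of the solution on the road. -/
def freeTrace (c : ℝ → ℝ) (lam : ℝ) (U₀ : ℝ × ℝ → ℝ) (X : ℝ × ℝ × ℝ → ℝ) (q : ℝ × ℝ) : ℝ :=
  if 0 < q.1 then mild c lam U₀ X (fun _ => 0) q.1 (0, q.2) else 0

lemma measurable_freeTrace {c : ℝ → ℝ} (hc : Measurable c) (lam : ℝ) {U₀ : ℝ × ℝ → ℝ}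
    (mU₀ : Measurable U₀) {X : ℝ × ℝ × ℝ → ℝ} (mX : Measurable X) :
    Measurable (freeTrace c lam U₀ X) :=
  Measurable.ite (measurableSet_lt measurable_const measurable_fst)
    ((measurable_mild_uncurry hc mU₀ mX measurable_const).comp
      (by fun_prop : Measurable fun q : ℝ × ℝ => (q.1, (0 : ℝ), q.2))) measurable_const

lemma mild_zero_mem_kinSet {c : ℝ → ℝ} {lam : ℝ} (hlam : 0 ≤ lam) {U₀ : ℝ × ℝ → ℝ}
    (kU₀ : ∀ p, U₀ p ∈ kinSet p.2) {E : ℝ × ℝ × ℝ → ℝ} (hE : N.IsKinetic h E) {t : ℝ}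
    (ht : 0 ≤ t) (p : ℝ × ℝ) :
    mild c lam U₀ (fun q => lam * E q) (fun _ => 0) t p ∈ kinSet p.2 := by
  have key := exp_mul_average_mem_kinSet (ξ := p.2) hlam ht (kU₀ (shift c (-t) p))
    (E := fun s => E (s, shift c s (shift c (-t) p)))
    (hE.meas.comp (by unfold shift; fun_prop))
    (fun s => hE.mem_kinSet (s, shift c s (shift c (-t) p)))
  have hz : crossTerm c lam (fun _ => 0) (Ioo 0 t) (shift c (-t) p) = 0 := by
    simp [crossTerm]
  rw [mul_zero, Real.exp_zero, one_mul] at key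
  rw [mild, lagrange, hz, add_zero]
  exact key

lemma freeTrace_mem_kinSet {c : ℝ → ℝ} {lam : ℝ} (hlam : 0 ≤ lam) {U₀ : ℝ × ℝ → ℝ}
    (kU₀ : ∀ p, U₀ p ∈ kinSet p.2) {E : ℝ × ℝ × ℝ → ℝ} (hE : N.IsKinetic h E) (q : ℝ × ℝ) :
    freeTrace c lam U₀ (fun q => lam * E q) q ∈ kinSet q.2 := by
  unfold freeTrace
  split_ifs with hq
  · exact mild_zero_mem_kinSet hlam kU₀ hE hq.le (0, q.2)
  · exact zero_mem_kinSet _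

/-- If the boundary values agree with the free trace for the velocities directed into the junction,
then the particles that leave the road are removed, and the mild solution vanishes outside the
road. -/
lemma mild_crossData_mem {lam : ℝ} (hlam : 0 ≤ lam) {U₀ : ℝ × ℝ → ℝ}
    (kU₀ : ∀ p, U₀ p ∈ kinSet p.2) (sU₀ : ∀ p ∉ roadDomain h ×ˢ N.K h, U₀ p = 0)
    {E : ℝ × ℝ × ℝ → ℝ} (hE : N.IsKinetic h E) {γ : ℝ × ℝ → ℝ} (kγ : ∀ q, γ q ∈ kinSet q.2)
    (hγ : ∀ t ξ, 0 < roadSign h * N.speed h ξ →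
      γ (t, ξ) = freeTrace (N.speed h) lam U₀ (fun q => lam * E q) (t, ξ))
    {t : ℝ} (ht : 0 ≤ t) {p : ℝ × ℝ} (hp : p.1 ≠ 0) :
    mild (N.speed h) lam U₀ (fun q => lam * E q) (N.crossData h γ) t p ∈ kinSet p.2 ∧
      (p ∉ roadDomain h ×ˢ N.K h →
        mild (N.speed h) lam U₀ (fun q => lam * E q) (N.crossData h γ) t p = 0) := by
  obtain ⟨y, ξ⟩ := p
  set c := N.speed h with hc
  set σ : ℝ := roadSign h
  have hσ : σ * σ = 1 := roadSign_mul_self h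
  have hσ0 : σ ≠ 0 := fun h0 => by simp [h0] at hσ
  set x := y + -t * c ξ with hx
  have hshift : shift c (-t) (y, ξ) = (x, ξ) := rfl
  have mE : ∀ x, Measurable fun s => E (s, x + s * c ξ, ξ) := fun x =>
    hE.meas.comp (by fun_prop)
  -- source and initial value vanish along the characteristic as long as it is outside the road
  have hE0 : ∀ s, 0 ≤ σ * (x + s * c ξ) → E (s, x + s * c ξ, ξ) = 0 := fun s hs =>
    hE.support _ fun hm => by
      have := (mem_roadDomain h _).1 hm.1
      exact absurd hs (not_le.2 this)
  have hU0 : 0 ≤ σ * x → U₀ (x, ξ) = 0 := fun hs => sU₀ _ fun hm => by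
    have := (mem_roadDomain h _).1 hm.1
    exact absurd hs (not_le.2 this)
  have hsrc : sourceTerm c lam (fun q => lam * E q) (Ioo 0 t) (x, ξ)
      = ∫ s in Ioo 0 t, Real.exp (lam * s) * (lam * E (s, x + s * c ξ, ξ)) := rfl
  have hdiv : crossTime c (x, ξ) = -(σ * x) / (σ * c ξ) := by
    rw [crossTime, ← mul_neg, mul_div_mul_left _ _ hσ0]
  by_cases hK : ξ ∈ N.K h
  swap
  · have hz : mild c lam U₀ (fun q => lam * E q) (N.crossData h γ) t (y, ξ) = 0 := by
      have h1 : U₀ (x, ξ) = 0 := sU₀ _ fun hm => hK hm.2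
      have h2 : ∀ s, E (s, x + s * c ξ, ξ) = 0 := fun s => hE.support _ fun hm => hK hm.2
      have h3 : crossTerm c lam (N.crossData h γ) (Ioo 0 t) (x, ξ) = 0 := by
        simp [crossTerm, crossData, hK, indicator]
      rw [mild, lagrange, hshift, h1, h3, hsrc]
      simp [h2]
    rw [hz]
    exact ⟨zero_mem_kinSet _, fun _ => rfl⟩
  by_cases hcr : crossTime c (x, ξ) ∈ Ioo 0 t
  · set τ := crossTime c (x, ξ) with hτ
    have hc0 : c ξ ≠ 0 := fun h0 => by
      have : τ = 0 := by rw [hτ, crossTime]; simp [h0]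
      exact hcr.1.ne' this
    have hxτ : x = -τ * c ξ := by
      rw [hτ, crossTime]; field_simp
    have hct : crossTerm c lam (N.crossData h γ) (Ioo 0 t) (x, ξ)
        = SignType.sign (c ξ) * Real.exp (lam * τ) * -(σ * γ (τ, ξ)) := by
      rw [crossTerm, ← hτ, indicator_of_mem hcr, crossData, indicator_of_mem hK]
    rcases lt_or_gt_of_ne (mul_ne_zero hσ0 hc0) with hs | hs
    · -- the particle enters the road at time `τ`
      have hsg : (SignType.sign (c ξ) : ℝ) * σ = -1 := by
        rcases mul_self_eq_one_iff.1 hσ with e | e <;> rw [e] at hs ⊢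
        · rw [sign_neg (by linarith)]; simp
        · rw [sign_pos (by linarith)]; simp
      have hin : (y, ξ) ∈ roadDomain h ×ˢ N.K h := by
        refine ⟨(mem_roadDomain h y).2 ?_, hK⟩
        have : y = (t - τ) * c ξ := by rw [hx] at hxτ; linarith
        change σ * y < 0
        rw [this]
        nlinarith [hcr.2]
      refine ⟨?_, fun hn => absurd hin hn⟩
      have h1 : U₀ (x, ξ) = 0 := hU0 (by rw [hxτ]; nlinarith [hcr.1])
      have h2 : ∫ s in Ioo 0 t, Real.exp (lam * s) * (lam * E (s, x + s * c ξ, ξ))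
          = ∫ s in Ioo τ t, Real.exp (lam * s) * (lam * E (s, x + s * c ξ, ξ)) := by
        refine setIntegral_eq_of_subset_of_forall_sdiff_eq_zero measurableSet_Ioo
          (Ioo_subset_Ioo_left hcr.1.le) fun s hs' => ?_
        have hsτ : s ≤ τ := by
          by_contra! hlt
          exact hs'.2 ⟨hlt, hs'.1.2⟩
        rw [hE0 s (by rw [hxτ]; nlinarith), mul_zero, mul_zero]
      have key := exp_mul_average_mem_kinSet (ξ := ξ) hlam hcr.2.le (kγ (τ, ξ)) (mE x)
        (fun s => hE.mem_kinSet (s, x + s * c ξ, ξ))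
      have e : mild c lam U₀ (fun q => lam * E q) (N.crossData h γ) t (y, ξ)
          = Real.exp (-(lam * t)) * (Real.exp (lam * τ) * γ (τ, ξ)
            + ∫ s in Ioo τ t, Real.exp (lam * s) * (lam * E (s, x + s * c ξ, ξ))) := by
        rw [mild, lagrange, hshift, h1, hsrc, h2, hct]
        linear_combination (-(Real.exp (-(lam * t)) * Real.exp (lam * τ) * γ (τ, ξ))) * hsg
      rw [e]; exact key
    · -- the particle leaves the road at time `τ`, with the free trace as its value
      have hsg : (SignType.sign (c ξ) : ℝ) * σ = 1 := by
        rcases mul_self_eq_one_iff.1 hσ with e | e <;> rw [e] at hs ⊢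
        · rw [sign_pos (by linarith)]; simp
        · rw [sign_neg (by linarith)]; simp
      have h2 : ∫ s in Ioo 0 t, Real.exp (lam * s) * (lam * E (s, x + s * c ξ, ξ))
          = ∫ s in Ioo 0 τ, Real.exp (lam * s) * (lam * E (s, x + s * c ξ, ξ)) := by
        refine setIntegral_eq_of_subset_of_forall_sdiff_eq_zero measurableSet_Ioo
          (Ioo_subset_Ioo_right hcr.2.le) fun s hs' => ?_
        have hsτ : τ ≤ s := by
          by_contra! hlt
          exact hs'.2 ⟨hs'.1.1, hlt⟩
        rw [hE0 s (by rw [hxτ]; nlinarith), mul_zero, mul_zero]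
      have hγτ : γ (τ, ξ) = Real.exp (-(lam * τ)) * (U₀ (x, ξ)
          + ∫ s in Ioo 0 τ, Real.exp (lam * s) * (lam * E (s, x + s * c ξ, ξ))) := by
        have hsh : shift c (-τ) (0, ξ) = (x, ξ) := by rw [hxτ]; simp [shift]
        have hz : crossTerm c lam (fun _ => 0) (Ioo 0 τ) (x, ξ) = 0 := by simp [crossTerm]
        rw [hγ τ ξ hs, freeTrace, if_pos hcr.1]
        dsimp only
        rw [mild, lagrange, hsh, hz, add_zero]
        rfl
      have hee : Real.exp (lam * τ) * Real.exp (-(lam * τ)) = 1 := by rw [← Real.exp_add]; simp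
      have hz : mild c lam U₀ (fun q => lam * E q) (N.crossData h γ) t (y, ξ) = 0 := by
        rw [mild, lagrange, hshift, hsrc, h2, hct, hγτ]
        set A := U₀ (x, ξ)
        set B := ∫ s in Ioo 0 τ, Real.exp (lam * s) * (lam * E (s, x + s * c ξ, ξ))
        linear_combination (-(Real.exp (-(lam * t)) * (A + B))) * hee
          - Real.exp (-(lam * t)) * Real.exp (lam * τ) * Real.exp (-(lam * τ)) * (A + B) * hsg
      rw [hz]
      exact ⟨zero_mem_kinSet _, fun _ => rfl⟩
  · have hct : crossTerm c lam (N.crossData h γ) (Ioo 0 t) (x, ξ) = 0 := by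
      rw [crossTerm, indicator_of_notMem hcr]
    have e : mild c lam U₀ (fun q => lam * E q) (N.crossData h γ) t (y, ξ)
        = Real.exp (-(lam * t)) * (Real.exp (lam * 0) * U₀ (x, ξ)
          + ∫ s in Ioo 0 t, Real.exp (lam * s) * (lam * E (s, x + s * c ξ, ξ))) := by
      rw [mild, lagrange, hshift, hct, hsrc, mul_zero, Real.exp_zero, one_mul, add_zero]
    refine ⟨?_, fun hn => ?_⟩
    · rw [e]
      exact exp_mul_average_mem_kinSet (ξ := ξ) hlam ht (kU₀ (x, ξ)) (mE x)
        (fun s => hE.mem_kinSet (s, x + s * c ξ, ξ))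
    · have hy : 0 < σ * y := by
        refine lt_of_le_of_ne (not_lt.1 fun hlt => hn ⟨(mem_roadDomain h y).2 hlt, hK⟩)
          (mul_ne_zero hσ0 hp).symm
      have hyx : σ * y = σ * x + t * (σ * c ξ) := by rw [hx]; ring
      -- a characteristic that ends outside and starts inside the road would cross the junction
      have hout : ∀ s, 0 ≤ s → s < t → 0 ≤ σ * (x + s * c ξ) := fun s hs0 hst => by
        by_contra! hlt
        have hlt' : σ * x + s * (σ * c ξ) < 0 := by linarith
        have hpos : 0 < σ * c ξ := by nlinarith
        refine hcr ⟨?_, ?_⟩ <;> rw [hdiv]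
        · exact div_pos (by nlinarith) hpos
        · rw [div_lt_iff₀ hpos]; linarith
      rw [e]
      have h2 : ∫ s in Ioo 0 t, Real.exp (lam * s) * (lam * E (s, x + s * c ξ, ξ)) = 0 :=
        setIntegral_eq_zero_of_forall_eq_zero fun s hs => by
          rw [hE0 s (hout s hs.1.le hs.2), mul_zero, mul_zero]
      have h1 : U₀ (x, ξ) = 0 := by
        rcases ht.eq_or_lt with rfl | htp
        · exact hU0 (by linarith)
        · exact hU0 (by simpa using hout 0 le_rfl htp)
      rw [h1, h2]; simp

end Junction

lemma KineticTransport.ContinuousInL1.congr {U V : ℝ × ℝ × ℝ → ℝ}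
    (hV : KineticTransport.ContinuousInL1 V) (h : ∀ t ≥ 0, ∀ᵐ p, U (t, p) = V (t, p)) :
    KineticTransport.ContinuousInL1 U := by
  refine ⟨fun t ht => (hV.1 t ht).congr ((h t ht).mono fun p hp => hp.symm), fun t₀ ht₀ => ?_⟩
  refine (hV.2 t₀ ht₀).congr' ?_
  filter_upwards [self_mem_nhdsWithin] with t ht
  refine lintegral_congr_ae ?_
  filter_upwards [h t ht, h t₀ ht₀] with p e1 e2
  rw [e1, e2]

namespace Junction

open KineticTransport

variable {n m : ℕ} {N : Junction n m} {h : Fin n ⊕ Fin m}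

/-- Every driver has a response with prescribed initial values: the particles that leave the roads
determine the total flux, the flux determines the states at the junction, and these states
determine the particles that enter the roads. -/
theorem exists_isResponse (hN : N.Admissible) {ε : ℝ} (hε : 0 < ε)
    {U₀ : Fin n ⊕ Fin m → ℝ × ℝ → ℝ} (mU₀ : ∀ h, Measurable (U₀ h))
    (kU₀ : ∀ h p, U₀ h p ∈ kinSet p.2) (sU₀ : ∀ h, ∀ p ∉ roadDomain h ×ˢ N.K h, U₀ h p = 0)
    (iU₀ : ∀ h, ∫⁻ p, ‖U₀ h p‖ₑ < ∞) {V : Fin n ⊕ Fin m → ℝ × ℝ × ℝ → ℝ}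
    (kV : ∀ h, N.IsKinetic h (V h)) (cV : ∀ h, ContinuousInL1 (V h)) :
    ∃ U γ, N.IsResponse ε V U γ ∧ ∀ h p, U h (0, p) = U₀ h p := by
  classical
  have hlam : 0 ≤ ε⁻¹ := inv_nonneg.2 hε.le
  obtain ⟨L, -, hL⟩ := exists_abs_speed_le hN
  obtain ⟨R, mR, hR⟩ := exists_monotone_state hN
  have mc := fun h => measurable_speed hN h
  have kE : ∀ h, N.IsKinetic h (equil (V h)) := fun h => (kV h).isKinetic_equil hN
  have mX : ∀ h, Measurable fun q => ε⁻¹ * equil (V h) q := fun h => (kE h).meas.const_mul _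
  -- the boundary values of the particles that leave the roads, and the total flux `Q` that they
  -- carry
  let γin : Fin n ⊕ Fin m → ℝ × ℝ → ℝ := fun h =>
    freeTrace (N.speed h) ε⁻¹ (U₀ h) fun q => ε⁻¹ * equil (V h) q
  have mγin : ∀ h, Measurable (γin h) := fun h => measurable_freeTrace (mc h) _ (mU₀ h) (mX h)
  have kγin : ∀ h q, γin h q ∈ kinSet q.2 := fun h q =>
    freeTrace_mem_kinSet hlam (kU₀ h) (kE h) q
  let Q : ℝ → ℝ := fun t => ∑ h, N.inflow h fun ξ => γin h (t, ξ)
  have mQ : Measurable Q := by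
    refine Finset.measurable_fun_sum _ fun h _ => ?_
    have : StronglyMeasurable fun q : ℝ × ℝ => N.inRate h q.2 * γin h q :=
      (((measurable_inRate hN h).comp measurable_snd).mul (mγin h)).stronglyMeasurable
    exact this.integral_prod_right'.measurable
  -- the full boundary values, with the coupling states for the velocities directed into the roads
  let γ : Fin n ⊕ Fin m → ℝ × ℝ → ℝ := fun h q =>
    if roadSign h * N.speed h q.2 < 0 then chi (R h (Q q.1)) q.2 else γin h q
  have mγ : ∀ h, Measurable (γ h) := fun h =>
    Measurable.ite (measurableSet_lt (((mc h).comp measurable_snd).const_mul _) measurable_const)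
      (measurable_chi.comp (((mR h).measurable.comp (mQ.comp measurable_fst)).prodMk
        measurable_snd)) (mγin h)
  have kγ : ∀ h q, γ h q ∈ kinSet q.2 := fun h q => by
    simp only [γ]
    split_ifs
    · exact chi_mem_kinSet _ _
    · exact kγin h q
  have hγ : ∀ h t ξ, 0 < roadSign h * N.speed h ξ → γ h (t, ξ) = γin h (t, ξ) :=
    fun h t ξ hs => if_neg hs.not_gt
  have hd : ∀ h, IsData (N.speed h) (U₀ h) (fun q => ε⁻¹ * equil (V h) q)
      (N.crossData h (γ h)) := fun h => by
    refine isData_crossData hN (mU₀ h) (fun p => abs_le_one_of_mem_kinSet (kU₀ h p)) (iU₀ h)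
      (mX h) ⟨|ε⁻¹|, fun q => ?_⟩ (fun T => ?_) (mγ h)
      (fun q => abs_le_one_of_mem_kinSet (kγ h q))
    · rw [abs_mul]
      exact mul_le_of_le_one_right (abs_nonneg _) (abs_equil_le _ q)
    · obtain ⟨C, hC⟩ := exists_lintegral_source_le (kV h) (cV h) ε T
      exact ⟨C, fun s hs => hC s ⟨hs.1.le, hs.2.le⟩⟩
  let W : Fin n ⊕ Fin m → ℝ × ℝ × ℝ → ℝ := fun h q =>
    mild (N.speed h) ε⁻¹ (U₀ h) (fun q => ε⁻¹ * equil (V h) q) (N.crossData h (γ h)) q.1 q.2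
  have mW : ∀ h, Measurable (W h) := fun h =>
    measurable_mild_uncurry (mc h) (mU₀ h) (mX h) (measurable_crossData (mγ h))
  have mS : ∀ h, MeasurableSet {q : ℝ × ℝ × ℝ | q.2 ∈ roadDomain h ×ˢ N.K h} := fun h =>
    measurable_snd ((measurableSet_roadDomain h).prod (N.measurableSet_K h))
  have mk : ∀ h, MeasurableSet {q : ℝ × ℝ × ℝ | W h q ∈ kinSet q.2.2} := fun h =>
    (measurable_snd.snd.prodMk (mW h)) measurableSet_kinSet
  -- the mild solution, changed on null sets so that support and values are correct everywhere
  let U : Fin n ⊕ Fin m → ℝ × ℝ × ℝ → ℝ := fun h q =>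
    if q.2 ∈ roadDomain h ×ˢ N.K h ∧ W h q ∈ kinSet q.2.2 then W h q else 0
  have kU : ∀ h, N.IsKinetic h (U h) := fun h => by
    refine ⟨Measurable.ite ((mS h).inter (mk h)) (mW h) measurable_const, fun q => ?_,
      fun q hq => if_neg fun hh => hq hh.1⟩
    simp only [U]
    split_ifs with hq
    · exact hq.2
    · exact zero_mem_kinSet _
  have hne : ∀ᵐ p : ℝ × ℝ, p.1 ≠ 0 := by
    have : ∀ᵐ x : ℝ, x ≠ 0 := by simp [ae_iff]
    exact Measure.quasiMeasurePreserving_fst.ae this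
  have UW : ∀ h, ∀ t ≥ 0, ∀ᵐ p, U h (t, p) = W h (t, p) := fun h t ht => by
    filter_upwards [hne] with p hp
    obtain ⟨h1, h2⟩ := mild_crossData_mem hlam (kU₀ h) (sU₀ h) (kE h) (kγ h) (hγ h) ht hp
    by_cases hS : p ∈ roadDomain h ×ˢ N.K h
    · exact if_pos ⟨hS, h1⟩
    · exact (if_neg fun hh => hS hh.1).trans (h2 hS).symm
  have U0 : ∀ h p, U h (0, p) = U₀ h p := fun h p => by
    have e : W h (0, p) = U₀ h p := by
      simp [W, mild, lagrange, sourceTerm, crossTerm]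
    by_cases hS : p ∈ roadDomain h ×ˢ N.K h
    · exact (if_pos ⟨hS, by rw [e]; exact kU₀ h p⟩).trans e
    · exact (if_neg fun hh => hS hh.1).trans (sU₀ h p hS).symm
  refine ⟨U, γ, ⟨kV, cV, kU, fun h => (continuousInL1_mild (mc h) (hL h) (hd h)).congr (UW h),
    mγ, kγ, fun h t ht => ?_, ?_⟩, U0⟩
  · simp only [U0]
    exact UW h t ht
  · refine Eventually.of_forall fun t => ?_
    have hinf : ∀ h, N.inflow h (fun ξ => γ h (t, ξ)) = N.inflow h fun ξ => γin h (t, ξ) :=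
      fun h => by
        refine integral_congr_ae (Eventually.of_forall fun ξ => ?_)
        dsimp only
        by_cases hs : roadSign h * N.speed h ξ < 0
        · have : N.inRate h ξ = 0 := by
            by_cases hK : ξ ∈ N.K h
            · rw [inRate, indicator_of_mem hK, max_eq_right hs.le]
            · rw [inRate, indicator_of_notMem hK]
          rw [this, zero_mul, zero_mul]
        · simp only [γ, if_neg hs]
    have hQ := sum_inflow_mem hN (g := fun h ξ => γin h (t, ξ))
      (fun h => (mγin h).comp measurable_prodMk_left)
      fun h => Eventually.of_forall fun ξ => kγin h (t, ξ)
    obtain ⟨p, hp1, hp2, hp3⟩ := hR (Q t) hQ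
    refine ⟨p, (isCouplingParam_iff hN).2 ⟨hp1, ?_⟩, fun h => Eventually.of_forall fun ξ hs => ?_⟩
    · simp only [hinf]; exact hp2
    · rw [hp3]; exact if_pos hs

/-! ### Existence of solutions -/

/-- A kinetic function that is continuous in `L¹` represents a curve. -/
lemma IsKinetic.exists_curve {U : ℝ × ℝ × ℝ → ℝ} (hU : N.IsKinetic h U) (cU : ContinuousInL1 U) :
    ∃ u, N.Represents h u U := by
  have hi : ∀ t : ℝ≥0, Integrable (fun p => U (t, p)) (N.phase h) := fun t =>
    (cU.1 t t.2).restrict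
  let f : ℝ≥0 → N.Kin h := fun t => (hi t).toL1 _
  have hf : ∀ t : ℝ≥0, ∀ᵐ p ∂(N.phase h), U (t, p) = f t p := fun t =>
    (hi t).coeFn_toL1.mono fun p hp => hp.symm
  have cf : Continuous f := by
    refine continuous_iff_continuousAt.2 fun t₀ => ?_
    rw [ContinuousAt, tendsto_iff_edist_tendsto_0]
    have h1 : Tendsto (fun t : ℝ≥0 => (t : ℝ)) (𝓝 t₀) (𝓝[Ici 0] (t₀ : ℝ)) :=
      tendsto_nhdsWithin_iff.2 ⟨NNReal.continuous_coe.tendsto _, Eventually.of_forall fun t => t.2⟩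
    refine ((cU.2 t₀ t₀.2).comp h1).congr fun t => ?_
    rw [edist_eq_enorm_sub]
    exact lintegral_sub_eq_of_ae_eq (fun p hp => hU.support (t, p) hp)
      (fun p hp => hU.support (t₀, p) hp) (hf t) (hf t₀)
  exact ⟨⟨f, cf⟩, ⟨hU, hf⟩⟩

/-- The condition `u ∈ L¹(Ω_h × K_h, D_ξ)` is closed, since the sets `D_ξ` are closed. -/
lemma takesKinValues_of_tendsto {u : ℕ → N.Kin h} {v : N.Kin h} (hu : ∀ k, N.TakesKinValues h (u k))
    (hv : Tendsto u atTop (𝓝 v)) : N.TakesKinValues h v := by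
  obtain ⟨ns, -, hns⟩ := (tendstoInMeasure_of_tendsto_Lp hv).exists_seq_tendsto_ae
  filter_upwards [hns, ae_all_iff.2 hu] with p h1 h2
  obtain ⟨a, b, e⟩ := exists_kinSet_eq_Icc p.2
  have hc : IsClosed (kinSet p.2) := by rw [e]; exact isClosed_Icc
  exact hc.mem_of_tendsto h1 (Eventually.of_forall fun i => h2 (ns i))

/-- The iterated responses converge, because the response map contracts the distance on every
bounded time interval by a factor less than one; the limit is its own response. -/
theorem exists_isResponse_self (hN : N.Admissible) {ε : ℝ} (hε : 0 < ε)
    {U₀ : Fin n ⊕ Fin m → ℝ × ℝ → ℝ} (mU₀ : ∀ h, Measurable (U₀ h))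
    (kU₀ : ∀ h p, U₀ h p ∈ kinSet p.2) (sU₀ : ∀ h, ∀ p ∉ roadDomain h ×ˢ N.K h, U₀ h p = 0)
    (iU₀ : ∀ h, ∫⁻ p, ‖U₀ h p‖ₑ < ∞) :
    ∃ (v : ∀ h, C(ℝ≥0, N.Kin h)) (V U : Fin n ⊕ Fin m → ℝ × ℝ × ℝ → ℝ)
      (γ : Fin n ⊕ Fin m → ℝ × ℝ → ℝ), (∀ h t, N.TakesKinValues h (v h t)) ∧
      (∀ h, N.Represents h (v h) (V h)) ∧ (∀ h, N.Represents h (v h) (U h)) ∧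
      N.IsResponse ε V U γ ∧ ∀ h p, U h (0, p) = U₀ h p := by
  have hlam : 0 ≤ ε⁻¹ := inv_nonneg.2 hε.le
  let Drv := {V : Fin n ⊕ Fin m → ℝ × ℝ × ℝ → ℝ //
    (∀ h, N.IsKinetic h (V h)) ∧ ∀ h, ContinuousInL1 (V h)}
  have hstep : ∀ V : Drv, ∃ (U : Drv) (γ : Fin n ⊕ Fin m → ℝ × ℝ → ℝ),
      N.IsResponse ε V.1 U.1 γ ∧ ∀ h p, U.1 h (0, p) = U₀ h p := fun V => by
    obtain ⟨U, γ, hU, e⟩ := exists_isResponse hN hε mU₀ kU₀ sU₀ iU₀ V.2.1 V.2.2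
    exact ⟨⟨U, hU.kinetic, hU.cont⟩, γ, hU, e⟩
  choose Φ Γ hΦ hΦ0 using hstep
  -- the iteration starts with the initial values, constant in time
  let V₀ : Drv := ⟨fun h q => U₀ h q.2, fun h => ⟨(mU₀ h).comp measurable_snd,
    fun q => kU₀ h q.2, fun q hq => sU₀ h q.2 hq⟩, fun h => ⟨fun t _ =>
      ⟨(mU₀ h).aestronglyMeasurable, iU₀ h⟩, fun t₀ _ => by
        simp only [sub_self, enorm_zero, lintegral_zero]; exact tendsto_const_nhds⟩⟩
  let W : ℕ → Drv := fun k => Φ^[k] V₀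
  have hW : ∀ k, W (k + 1) = Φ (W k) := fun k => Function.iterate_succ_apply' Φ k V₀
  have rW : ∀ k, N.IsResponse ε (W k).1 (W (k + 1)).1 (Γ (W k)) := fun k => by
    rw [hW]; exact hΦ _
  have W0 : ∀ k h p, (W k).1 h (0, p) = U₀ h p := fun k h p => by
    cases k with
    | zero => rfl
    | succ k => rw [hW]; exact hΦ0 _ h p
  have hq : ∀ T : ℝ, 0 ≤ T → 0 ≤ 1 - Real.exp (-(ε⁻¹ * T)) ∧ 1 - Real.exp (-(ε⁻¹ * T)) < 1 :=
    fun T hT => by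
      have h1 : Real.exp (-(ε⁻¹ * T)) ≤ 1 := Real.exp_le_one_iff.2 (by
        have := mul_nonneg hlam hT; linarith)
      exact ⟨by linarith, by linarith [Real.exp_pos (-(ε⁻¹ * T))]⟩
  -- consecutive iterates approach each other geometrically, uniformly on `[0, T]`
  have hdist : ∀ T : ℝ, 0 ≤ T → ∃ D : ℝ, 0 ≤ D ∧ ∀ k : ℕ, ∀ r ∈ Icc 0 T,
      ∑ h, ∫⁻ p, ‖(W (k + 1)).1 h (r, p) - (W k).1 h (r, p)‖ₑ
        ≤ ENNReal.ofReal ((1 - Real.exp (-(ε⁻¹ * T))) ^ k * D) := fun T hT => by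
    choose C hC using fun h =>
      exists_lintegral_le_of_continuousInL1 (((W 1).2.2 h).sub ((W 0).2.2 h)) T
    refine ⟨∑ h, (C h : ℝ), by positivity, fun k => ?_⟩
    induction k with
    | zero =>
      intro r hr
      refine (Finset.sum_le_sum fun h _ => hC h r hr).trans_eq ?_
      rw [pow_zero, one_mul, ENNReal.ofReal_sum_of_nonneg fun _ _ => NNReal.coe_nonneg _]
      simp
    | succ k ih =>
      intro r hr
      rw [pow_succ', mul_assoc, ← zero_add ((1 - Real.exp (-(ε⁻¹ * T))) * _)]
      refine le_ofReal_of_exp_mul_le hlam hr.1 hr.2 le_rfl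
        (mul_nonneg (pow_nonneg (hq T hT).1 k) (by positivity)) ?_
      rw [zero_add]
      have key := (rW (k + 1)).exp_mul_sum_le hN hε (rW k) hr.1
        fun s hs => ih s ⟨hs.1.le, hs.2.le.trans hr.2⟩
      simpa only [W0, sub_self, enorm_zero, lintegral_zero, Finset.sum_const_zero,
        ENNReal.ofReal_zero] using key
  choose u hu using fun k h => ((W k).2.1 h).exists_curve ((W k).2.2 h)
  have hcd : ∀ T : ℝ, 0 ≤ T → ∃ D : ℝ, ∀ h k, ∀ r : ℝ≥0, (r : ℝ) ≤ T →
      dist (u k h r) (u (k + 1) h r) ≤ D * (1 - Real.exp (-(ε⁻¹ * T))) ^ k := fun T hT => by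
    obtain ⟨D, hD0, hD⟩ := hdist T hT
    refine ⟨D, fun h k r hr => ?_⟩
    rw [dist_comm, dist_eq_norm, ← toReal_enorm, ← (hu (k + 1) h).lintegral_sub (hu k h)]
    refine ENNReal.toReal_le_of_le_ofReal (mul_nonneg hD0 (pow_nonneg (hq T hT).1 k)) ?_
    rw [mul_comm D]
    exact (Finset.single_le_sum (f := fun h => ∫⁻ p, ‖(W (k + 1)).1 h ((r : ℝ), p)
      - (W k).1 h ((r : ℝ), p)‖ₑ) (fun _ _ => zero_le) (Finset.mem_univ h)).trans
      (hD k r ⟨r.2, hr⟩)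
  have hlim : ∀ h, ∀ t : ℝ≥0, ∃ v, Tendsto (fun k => u k h t) atTop (𝓝 v) := fun h t => by
    obtain ⟨D, hD⟩ := hcd t t.2
    exact cauchySeq_tendsto_of_complete
      (cauchySeq_of_le_geometric _ D (hq t t.2).2 fun k => hD h k t le_rfl)
  choose f hf using hlim
  -- the iterates converge to `f`, uniformly on `[0, T]`
  have hrate : ∀ T : ℝ, 0 ≤ T → ∃ D : ℝ, ∀ h k, ∀ r : ℝ≥0, (r : ℝ) ≤ T →
      dist (u k h r) (f h r) ≤ D * (1 - Real.exp (-(ε⁻¹ * T))) ^ k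
        / (1 - (1 - Real.exp (-(ε⁻¹ * T)))) := fun T hT => by
    obtain ⟨D, hD⟩ := hcd T hT
    exact ⟨D, fun h k r hr => dist_le_of_le_geometric_of_tendsto _ D (hq T hT).2
      (fun k => hD h k r hr) (hf h r) k⟩
  have hzero : ∀ (T : ℝ) (D : ℝ), 0 ≤ T → Tendsto (fun k : ℕ =>
      D * (1 - Real.exp (-(ε⁻¹ * T))) ^ k / (1 - (1 - Real.exp (-(ε⁻¹ * T))))) atTop (𝓝 0) :=
    fun T D hT => by
      have := ((tendsto_pow_atTop_nhds_zero_of_lt_one (hq T hT).1 (hq T hT).2).const_mul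
        D).div_const (1 - (1 - Real.exp (-(ε⁻¹ * T))))
      simpa using this
  have cf : ∀ h, Continuous (f h) := fun h => by
    have : TendstoLocallyUniformly (fun k t => u k h t) (f h) atTop := by
      rw [Metric.tendstoLocallyUniformly_iff]
      intro δ hδ t
      have hT : (0 : ℝ) ≤ (t : ℝ) + 1 := by positivity
      obtain ⟨D, hD⟩ := hrate (t + 1) hT
      refine ⟨Iio (t + 1), Iio_mem_nhds (by simp), ?_⟩
      filter_upwards [(hzero _ D hT).eventually_lt_const hδ] with k hk r hr
      rw [dist_comm]
      exact (hD h k r (by exact_mod_cast (le_of_lt hr))).trans_lt hk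
    exact this.continuous (Eventually.of_forall fun k => (u k h).continuous).frequently
  let v : ∀ h, C(ℝ≥0, N.Kin h) := fun h => ⟨f h, cf h⟩
  have kv : ∀ h t, N.TakesKinValues h (v h t) := fun h t => by
    refine takesKinValues_of_tendsto (fun k => ?_) (hf h t)
    filter_upwards [(hu k h).ae_eq t] with p hp
    rw [← hp]
    exact (hu k h).mem_kinSet (t, p)
  choose V hV using fun h => exists_represents (kv h)
  obtain ⟨U, γ, hU, hU0⟩ := exists_isResponse hN hε mU₀ kU₀ sU₀ iU₀
    (fun h => (hV h).toIsKinetic) fun h => (hV h).continuousInL1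
  choose u' hu' using fun h => (hU.kinetic h).exists_curve (hU.cont h)
  -- the response to the limit is the limit of the responses, which is the limit itself
  have huv : ∀ h, u' h = v h := fun h => by
    ext1 t
    refine tendsto_nhds_unique ?_ ((tendsto_add_atTop_iff_nat 1).2 (hf h t))
    obtain ⟨D, hD⟩ := hrate t t.2
    rw [tendsto_iff_edist_tendsto_0]
    have hS : Tendsto (fun k : ℕ => ENNReal.ofReal (Real.exp (ε⁻¹ * t) - 1)
        * ∑ _h : Fin n ⊕ Fin m, ENNReal.ofReal (D * (1 - Real.exp (-(ε⁻¹ * t))) ^ k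
          / (1 - (1 - Real.exp (-(ε⁻¹ * t)))))) atTop (𝓝 0) := by
      have h1 := (ENNReal.continuous_ofReal.tendsto _).comp (hzero t D t.2)
      have h2 := tendsto_finsetSum (Finset.univ : Finset (Fin n ⊕ Fin m)) fun _ _ => h1
      have h3 := ENNReal.Tendsto.const_mul (a := ENNReal.ofReal (Real.exp (ε⁻¹ * t) - 1)) h2
        (Or.inr ENNReal.ofReal_ne_top)
      simpa using h3
    refine tendsto_of_tendsto_of_tendsto_of_le_of_le tendsto_const_nhds hS
      (fun _ => zero_le) fun k => ?_
    have key := (rW k).exp_mul_sum_le hN hε hU (t := t) t.2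
      (S := ∑ _h : Fin n ⊕ Fin m, ENNReal.ofReal (D * (1 - Real.exp (-(ε⁻¹ * t))) ^ k
          / (1 - (1 - Real.exp (-(ε⁻¹ * t)))))) fun s hs => by
        refine Finset.sum_le_sum fun h _ => ?_
        lift s to ℝ≥0 using hs.1.le
        rw [(hu k h).lintegral_sub (hV h), ← edist_eq_enorm_sub, edist_dist]
        exact ENNReal.ofReal_le_ofReal (hD h k s hs.2.le)
    simp only [W0, hU0, sub_self, enorm_zero, lintegral_zero, Finset.sum_const_zero,
      zero_add] at key
    refine le_trans ?_ key
    dsimp only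
    rw [edist_eq_enorm_sub, ← (hu (k + 1) h).lintegral_sub (hu' h)]
    refine le_trans (Finset.single_le_sum (f := fun h => ∫⁻ p, ‖(W (k + 1)).1 h ((t : ℝ), p)
      - U h ((t : ℝ), p)‖ₑ) (fun _ _ => zero_le) (Finset.mem_univ h)) ?_
    refine le_mul_of_one_le_left' ?_
    rw [ENNReal.one_le_ofReal]
    exact Real.one_le_exp (mul_nonneg hlam t.2)
  exact ⟨v, V, U, γ, kv, hV, fun h => huv h ▸ hu' h, hU, hU0⟩

/-- Any two parameters that balance the flux of the same data give the same values for the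
velocities directed away from the junction. -/
lemma chi_prio_ae_eq (hN : N.Admissible) {g : Fin n ⊕ Fin m → ℝ → ℝ} (mg : ∀ h, Measurable (g h))
    (hg : ∀ h, ∀ᵐ ξ ∂(volume.restrict (N.K h)), g h ξ ∈ kinSet ξ) {p p' : ℝ × ℝ}
    (hp : N.IsCouplingParam g p) (hp' : N.IsCouplingParam g p') (h : Fin n ⊕ Fin m) :
    ∀ᵐ ξ ∂(volume.restrict (N.K h)), roadSign h * N.speed h ξ < 0 →
      chi (N.prio h p.1 p.2) ξ = chi (N.prio h p'.1 p'.2) ξ := by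
  have h1 := coupling_contraction hN mg hg mg hg hp hp'
  simp only [sub_self, mul_zero, enorm_zero, lintegral_zero, Finset.sum_const_zero,
    nonpos_iff_eq_zero, Finset.sum_eq_zero_iff, Finset.mem_univ, forall_true_left] at h1
  have h2 := (lintegral_eq_zero_iff ((measurable_outRate hN h).mul
    ((measurable_chi_right _).sub (measurable_chi_right _))).enorm).1 (h1 h)
  refine (ae_restrict_iff' (N.measurableSet_K h)).2 ?_
  filter_upwards [h2] with ξ hξ hK hs
  have h3 : N.outRate h ξ ≠ 0 := by
    rw [outRate, indicator_of_mem hK, max_eq_left (by linarith)]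
    linarith
  have h4 := (mul_eq_zero.1 (enorm_eq_zero.1 hξ)).resolve_left h3
  exact sub_eq_zero.1 h4

/-- The fixed point of the response map is a distributional solution. Its trace satisfies the
coupling condition with the pair of parameters chosen in `Psi`, because all balancing pairs give the
same values. -/
theorem exists_isBGKSolution (hN : N.Admissible) {ε : ℝ} (hε : 0 < ε) {g0 : ∀ h, N.Kin h}
    (hg0 : ∀ h, N.TakesKinValues h (g0 h)) : ∃ g, N.IsBGKSolution ε g0 g := by
  -- representatives of the initial values
  choose G hG using fun h => exists_represents (u := ContinuousMap.const ℝ≥0 (g0 h))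
    fun _ => hg0 h
  obtain ⟨v, V, U, γ, kv, hV, hU, hR, hU0⟩ := exists_isResponse_self hN hε
    (U₀ := fun h p => G h (0, p)) (fun h => (hG h).meas.comp measurable_prodMk_left)
    (fun h p => (hG h).mem_kinSet (0, p)) (fun h p hp => (hG h).support (0, p) hp)
    (fun h => ((hG h).continuousInL1.1 0 le_rfl).2)
  obtain ⟨L, -, hL⟩ := exists_abs_speed_le hN
  refine ⟨v, kv, fun h => ?_, fun h t ξ => γ h (t, ξ), fun h => hR.meas_trace h, fun h =>
    Eventually.of_forall fun q => hR.trace_mem h q, fun h φ hφ sφ tφ => ?_, ?_⟩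
  · refine Lp.ext ?_
    filter_upwards [(hU h).ae_eq 0, (hG h).ae_eq 0] with p h1 h2
    rw [← h1, NNReal.coe_zero, hU0]
    exact h2
  · have hd := hR.isData hN h
    obtain ⟨C1, b1⟩ := hd.bdd_init
    obtain ⟨C2, b2⟩ := hd.bdd_source
    obtain ⟨C3, b3⟩ := hd.bdd_cross
    have key := mild_weak (lam := ε⁻¹) (measurable_speed hN h) (hL h) hd.meas_init b1
      hd.meas_source b2
      hd.meas_cross b3 (hφ.of_le (by simp)) sφ tφ
    rw [← integral_trace N h (γ := γ h) (Eventually.of_forall fun t =>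
      Eventually.of_forall fun ξ => rfl) φ, ← sub_eq_add_neg] at key
    refine Eq.trans ?_ key
    refine congrArg₂ _ (setIntegral_congr_fun measurableSet_Ioi fun t ht => ?_) rfl
    have ht0 : 0 ≤ t := le_of_lt ht
    rw [(hV h).integral_weak hN (lam := ε⁻¹) (X := fun q => ε⁻¹ * equil (V h) q)
      (fun q => by ring) hφ ht0]
    have e : ∀ᵐ p, V h (t, p) = U h (t, p) := by
      lift t to ℝ≥0 using ht0
      have h1 := (hV h).lintegral_sub (hU h) t t
      rw [sub_self, enorm_zero] at h1
      have mm : Measurable fun p : ℝ × ℝ => ‖V h ((t : ℝ), p) - U h ((t : ℝ), p)‖ₑ :=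
        (((hV h).meas.comp measurable_prodMk_left).sub
          ((hU h).meas.comp measurable_prodMk_left)).enorm
      filter_upwards [(lintegral_eq_zero_iff mm).1 h1] with p hp
      exact sub_eq_zero.1 (enorm_eq_zero.1 hp)
    refine integral_congr_ae ?_
    filter_upwards [e, hR.mild_damped h t ht0] with p h1 h2
    rw [h1, h2]
  · filter_upwards [hR.coupling] with t ⟨p, hp, hγ⟩ h
    rw [ae_restrict_Gout_iff hN]
    have hex : ∃ p, N.IsCouplingParam (fun k ξ => γ k (t, ξ)) p := ⟨p, hp⟩
    filter_upwards [hγ h, chi_prio_ae_eq hN (fun h => (hR.meas_trace h).comp measurable_prodMk_left)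
      (fun h => Eventually.of_forall fun ξ => hR.trace_mem h (t, ξ)) hex.choose_spec hp h]
      with ξ h1 h2 hs
    rw [h1 hs, ← h2 hs, Psi, dif_pos hex]

end Junction

end

theorem mainTheorem9 {n m : ℕ} (N : Junction n m) (hN : N.Admissible) :
    -- existence and uniqueness
    (∀ ε : ℝ, 0 < ε → ∀ g0 : (∀ h, N.Kin h), (∀ h, N.TakesKinValues h (g0 h)) →
      ∃! g : (∀ h, C(ℝ≥0, N.Kin h)), N.IsBGKSolution ε g0 g) ∧
    -- the densities take values in the state intervals; conservation of mass
    (∀ ε : ℝ, 0 < ε → ∀ (g0 : ∀ h, N.Kin h) (g : ∀ h, C(ℝ≥0, N.Kin h)),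
      N.IsBGKSolution ε g0 g →
        (∀ h t, ∀ᵐ x ∂(volume.restrict (roadDomain h)), N.density h (g h t) x ∈ N.K h) ∧
        (∀ T : ℝ≥0, ∑ h, ∫ p, g h T p ∂(N.phase h) = ∑ h, ∫ p, g0 h p ∂(N.phase h))) ∧
    -- contraction
    (∀ ε : ℝ, 0 < ε → ∀ (g01 g02 : ∀ h, N.Kin h) (g1 g2 : ∀ h, C(ℝ≥0, N.Kin h)),
      N.IsBGKSolution ε g01 g1 → N.IsBGKSolution ε g02 g2 → ∀ t : ℝ≥0,
        ∑ h, eLpNorm (fun x => N.density h (g1 h t) x - N.density h (g2 h t) x) 1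
            (volume.restrict (roadDomain h))
          ≤ ENNReal.ofReal (∑ h, ‖g1 h t - g2 h t‖) ∧
        ∑ h, ‖g1 h t - g2 h t‖ ≤ ∑ h, ‖g01 h - g02 h‖) ∧
    -- the relaxation term is a derivative in `ξ`, with a bound that is uniform in `ε`
    (∀ (g0 : ∀ h, N.Kin h) (g : ℝ → ∀ h, C(ℝ≥0, N.Kin h)),
      (∀ ε : ℝ, 0 < ε → N.IsBGKSolution ε g0 (g ε)) →
        ∃ w : ℝ → Fin n ⊕ Fin m → ℝ × ℝ × ℝ → ℝ,
          (∀ ε : ℝ, 0 < ε → ∀ h, Measurable (w ε h) ∧ (∀ q, 0 ≤ w ε h q) ∧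
            (∃ C : ℝ, ∀ q, w ε h q ≤ C) ∧ N.RelaxIsDerivOf ε h (g ε h) (w ε h)) ∧
          ∀ T : ℝ, 0 < T → ∃ μ : Fin n ⊕ Fin m → ℝ → ℝ,
            (∀ h, MemLp (μ h) ⊤ (volume.restrict (N.K h))) ∧
            ∀ ε : ℝ, 0 < ε → ∀ h, ∀ᵐ ξ ∂(volume.restrict (N.K h)),
              ∫⁻ t in Ioo (0 : ℝ) T, ∫⁻ x in roadDomain h,
                ENNReal.ofReal (w ε h (t, x, ξ)) ≤ ENNReal.ofReal (μ h ξ)) := by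
  have norm_eq : ∀ (g g' : ∀ h, N.Kin h), ENNReal.ofReal (∑ h, ‖g h - g' h‖)
      = ∑ h, ‖g h - g' h‖ₑ := fun g g' => by
    rw [ENNReal.ofReal_sum_of_nonneg fun _ _ => norm_nonneg _]
    simp only [ofReal_norm]
  have contr : ∀ ε : ℝ, 0 < ε → ∀ (g01 g02 : ∀ h, N.Kin h) (g1 g2 : ∀ h, C(ℝ≥0, N.Kin h)),
      N.IsBGKSolution ε g01 g1 → N.IsBGKSolution ε g02 g2 → ∀ t : ℝ≥0,
      ∑ h, ‖g1 h t - g2 h t‖ ≤ ∑ h, ‖g01 h - g02 h‖ := by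
    intro ε hε g01 g02 g1 g2 h1 h2 t
    obtain ⟨U₁, γ₁, k1, r1⟩ := h1.exists_kineticSolution hN
    obtain ⟨U₂, γ₂, k2, r2⟩ := h2.exists_kineticSolution hN
    have key := k1.contraction hN hε k2 t.coe_nonneg
    have e0 := fun h => (r1 h).lintegral_sub (r2 h) 0 0
    rw [NNReal.coe_zero] at e0
    simp only [fun h => (r1 h).lintegral_sub (r2 h) t t, e0, h1.initial, h2.initial] at key
    rwa [← norm_eq (fun h => g1 h t) (fun h => g2 h t), ← norm_eq,
      ENNReal.ofReal_le_ofReal_iff (by positivity)] at key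
  refine ⟨fun ε hε g0 hg0 => ?_, fun ε hε g0 g hg => ⟨fun h t => ?_, fun T => ?_⟩,
    fun ε hε g01 g02 g1 g2 h1 h2 t => ⟨?_, contr ε hε g01 g02 g1 g2 h1 h2 t⟩, fun g0 g hg => ?_⟩
  · obtain ⟨g, hg⟩ := Junction.exists_isBGKSolution hN hε hg0
    refine ⟨g, hg, fun g' hg' => ?_⟩
    funext h
    ext1 t
    have key := contr ε hε g0 g0 g' g hg' hg t
    simp only [sub_self, norm_zero, Finset.sum_const_zero] at key
    have h1 := (Finset.single_le_sum (f := fun h => ‖g' h t - g h t‖)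
      (fun _ _ => norm_nonneg _) (Finset.mem_univ h)).trans key
    exact sub_eq_zero.1 (norm_le_zero_iff.1 h1)
  · obtain ⟨U, γ, -, r⟩ := hg.exists_kineticSolution hN
    filter_upwards [(r h).density_eq t] with x hx
    rw [hx]
    exact (r h).dens_mem hN _
  · obtain ⟨U, γ, k, r⟩ := hg.exists_kineticSolution hN
    have key := k.sum_integral_eq hN T.coe_nonneg
    have e : ∀ h (t : ℝ≥0), ∫ p, U h (t, p) = ∫ p, g h t p ∂(N.phase h) := fun h t => by
      rw [← setIntegral_eq_integral_of_forall_compl_eq_zero (s := roadDomain h ×ˢ N.K h)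
        fun p hp => (r h).support (t, p) hp]
      exact integral_congr_ae ((r h).ae_eq t)
    have e0 := fun h => e h 0
    rw [NNReal.coe_zero] at e0
    simpa only [e, e0, hg.initial] using key
  · obtain ⟨U₁, γ₁, k1, r1⟩ := h1.exists_kineticSolution hN
    obtain ⟨U₂, γ₂, k2, r2⟩ := h2.exists_kineticSolution hN
    rw [norm_eq (fun h => g1 h t) fun h => g2 h t]
    refine Finset.sum_le_sum fun h _ => ?_
    rw [← (r1 h).lintegral_sub (r2 h), eLpNorm_one_eq_lintegral_enorm]
    refine le_trans (le_of_eq_of_le (lintegral_congr_ae ?_) (setLIntegral_le_lintegral _ _))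
      (Junction.lintegral_dens_sub_le (r1 h).toIsKinetic (r2 h).toIsKinetic t t)
    filter_upwards [(r1 h).density_eq t, (r2 h).density_eq t] with x e1 e2
    rw [e1, e2]
  · obtain ⟨L, hL0, hL⟩ := Junction.exists_abs_speed_le hN
    have hex : ∀ ε : ℝ, ∃ U : Fin n ⊕ Fin m → ℝ × ℝ × ℝ → ℝ, 0 < ε →
        (∃ γ, N.IsKineticSolution ε U γ) ∧ ∀ h, N.Represents h (g ε h) (U h) := fun ε => by
      by_cases hε : 0 < ε
      · obtain ⟨U, γ, k, r⟩ := (hg ε hε).exists_kineticSolution hN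
        exact ⟨U, fun _ => ⟨⟨γ, k⟩, r⟩⟩
      · exact ⟨fun _ _ => 0, fun h => absurd h hε⟩
    choose U hU using hex
    refine ⟨fun ε h => Junction.entropyDefect ε (U ε h), fun ε hε h => ?_, fun T hT => ?_⟩
    · have r := (hU ε hε).2 h
      exact ⟨Junction.measurable_entropyDefect ε r.meas,
        Junction.entropyDefect_nonneg hN hε r.toIsKinetic,
        ⟨_, fun q => (le_abs_self _).trans
          (Junction.abs_entropyDefect_le hN hε r.toIsKinetic q)⟩, r.relaxIsDerivOf hN hε⟩
    · refine ⟨fun h _ => 2 * ‖g0 h‖ + 2 * (T * (L * (volume (N.K h)).toReal)),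
        fun h => memLp_const _, fun ε hε h => Eventually.of_forall fun ξ => ?_⟩
      obtain ⟨⟨γ, k⟩, r⟩ := hU ε hε
      have e : ∫ p, |U ε h (0, p)| = ‖g0 h‖ := by
        have h0 := (r h).lintegral_eq 0
        rw [NNReal.coe_zero, (hg ε hε).initial h] at h0
        rw [← toReal_enorm, ← h0]
        exact integral_norm_eq_lintegral_enorm
          ((r h).meas.comp measurable_prodMk_left).aestronglyMeasurable
      change _ ≤ ENNReal.ofReal (2 * ‖g0 h‖ + _)
      rw [← e]
      exact k.lintegral_entropyDefect_le hN hε h hL0 (hL h) hT.le ξ
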